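/- Let $K$ be a field of characteristic $0$, let $V_d$ be the $SL_2$-module of binary forms of degree $d$ over $K$, and let $\mathcal I = K[2V_1\oplus V_3]^{SL_2}=K[V_1\oplus V_1\oplus V_3]^{SL_2}$ be the algebra of polynomial $SL_2(K)$-invariant functions, graded by degree. Then $\mathcal I$ has a finite minimal generating system consisting of homogeneous elements. Let $f_1,\dots,f_m$ be any such system, let $R=K[x_1,\dots,x_m]$ be graded by $\deg x_i=\deg f_i$, and regard $\mathcal I$ as a graded $R$-module, $x_i$ acting as multiplication by $f_i$. Then the following hold. (a) The homological (projective) dimension of $\mathcal I$ over $R$ is $8$. (b) $\mathcal I$ has a minimal graded free resolution over $R$ of the form $$0 \to F_8\to F_7\to F_6\to F_5\to F_4\to F_3\to F_2\to F_1\to F_0\to \mathcal I\to 0,$$ where $$\begin{aligned} F_0&=R,\\ F_1&=R(-8)^{10}\oplus R(-10)^{15}\oplus R(-12)^{10},\\ F_2&=R(-12)^{20}\oplus R(-14)^{60}\oplus R(-16)^{60}\oplus R(-18)^{20},\\ F_3&=R(-16)^{15}\oplus R(-18)^{90}\oplus R(-20)^{140}\oplus R(-22)^{90}\oplus R(-24)^{15},\\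 F_4&=R(-20)^{4}\oplus R(-22)^{60}\oplus R(-24)^{160}\oplus R(-26)^{160}\oplus R(-28)^{60}\oplus R(-30)^{4},\\ F_5&=R(-26)^{15}\oplus R(-28)^{90}\oplus R(-30)^{140}\oplus R(-32)^{90}\oplus R(-34)^{15},\\ F_6&=R(-32)^{20}\oplus R(-34)^{60}\oplus R(-36)^{60}\oplus R(-38)^{20},\\ F_7&=R(-38)^{10}\oplus R(-40)^{15}\oplus R(-42)^{10},\\ F_8&=R(-50). \end{aligned}$$ Equivalently, the graded Betti diagram of $\mathcal I$ has as its entry $\beta_{i,j}$ the exponent of $R(-j)$ in $F_i$, all other entries being $0$. (c) The Hilbert series does not determine the Betti numbers: there is a homogeneous ideal $J\subset R$ such that $R/J$ has the same Hilbert series as $\mathcal I$, and $R/J$ has a minimal graded free resolution over $R$, but none whose graded Betti numbers are those of (b). -/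

import Mathlib

open MvPolynomial

noncomputable section

namespace SLInv

/-! ### Binary forms and their polynomial invariants -/

section Invariants

variable {K : Type*} [Field K]

/-- The binary form `∑ i, c i * x ^ (e - i) * y ^ i` of degree `e` with coefficients `c`. -/
def binaryForm {e : ℕ} (c : Fin (e + 1) → K) : MvPolynomial (Fin 2) K :=
  ∑ i : Fin (e + 1), C (c i) * X 0 ^ (e - (i : ℕ)) * X 1 ^ (i : ℕ)

/-- The coefficients of `x ^ (e - i) * y ^ i`, `i = 0, …, e`, in a polynomial in two variables. -/
def formCoeff (e : ℕ) (p : MvPolynomial (Fin 2) K) : Fin (e + 1) → K :=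
  fun i => coeff (Finsupp.single 0 (e - (i : ℕ)) + Finsupp.single 1 (i : ℕ)) p

/-- The action of `SL₂(K)` on the space `V_e` of binary forms of degree `e`, in coefficients:
`(g • F)(x, y) = F((x, y) g)`. -/
def slAct {e : ℕ} (g : Matrix.SpecialLinearGroup (Fin 2) K) (c : Fin (e + 1) → K) :
    Fin (e + 1) → K :=
  formCoeff e (bind₁ (fun j : Fin 2 => ∑ k : Fin 2, C (g.1 k j) * X k) (binaryForm c))

/-- Coordinates on `V_{d 0} ⊕ ⋯ ⊕ V_{d (n-1)}`. -/
abbrev Coord {n : ℕ} (d : Fin n → ℕ) : Type := Σ i : Fin n, Fin (d i + 1)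

/-- The value of a polynomial function at a point of `V_{d 0} ⊕ ⋯ ⊕ V_{d (n-1)}`. -/
def evalAt {n : ℕ} {d : Fin n → ℕ} (v : ∀ i : Fin n, Fin (d i + 1) → K)
    (P : MvPolynomial (Coord d) K) : K :=
  eval (fun q : Coord d => v q.1 q.2) P

variable (K) in
/-- The algebra `K[V_{d 0} ⊕ ⋯ ⊕ V_{d (n-1)}]^{SL₂}` of polynomial `SL₂`-invariant functions
(`K` will be infinite, so polynomials and polynomial functions are the same). -/
def invariants {n : ℕ} (d : Fin n → ℕ) : Subalgebra K (MvPolynomial (Coord d) K) where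
  carrier := {P | ∀ (g : Matrix.SpecialLinearGroup (Fin 2) K)
    (v : ∀ i : Fin n, Fin (d i + 1) → K), evalAt (fun i => slAct g (v i)) P = evalAt v P}
  mul_mem' := by
    intro P Q hP hQ g v
    have h1 := hP g v
    have h2 := hQ g v
    simp only [evalAt, map_mul] at *
    rw [h1, h2]
  add_mem' := by
    intro P Q hP hQ g v
    have h1 := hP g v
    have h2 := hQ g v
    simp only [evalAt, map_add] at *
    rw [h1, h2]
  algebraMap_mem' := by
    intro r g v
    simp [evalAt]

variable (K) in
/-- The invariants that are homogeneous of degree `s`. -/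
def invariantsPiece {n : ℕ} (d : Fin n → ℕ) (s : ℕ) : Submodule K (invariants K d) :=
  (homogeneousSubmodule (Coord d) K s).comap (invariants K d).val.toLinearMap

/-- `f` is a minimal generating system of the algebra of invariants that consists of homogeneous
elements, `f i` being of degree `deg i`. -/
structure IsMinimalGeneratingSystem {n : ℕ} {d : Fin n → ℕ} {m : ℕ}
    (f : Fin m → invariants K d) (deg : Fin m → ℕ) : Prop where
  homogeneous : ∀ i, f i ∈ invariantsPiece K d (deg i)
  generates : Algebra.adjoin K (Set.range f) = ⊤
  minimal : ∀ i, f i ∉ Algebra.adjoin K (f '' {i}ᶜ)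

/-- The structure of a module over `R = K[x_1, …, x_m]` on the algebra of invariants,
`x_i` acting as multiplication by `f i`. -/
@[reducible]
def moduleVia {n : ℕ} {d : Fin n → ℕ} {m : ℕ} (f : Fin m → invariants K d) :
    Module (MvPolynomial (Fin m) K) (invariants K d) :=
  Module.compHom (invariants K d) (aeval (R := K) f).toRingHom

end Invariants

/-! ### Graded modules and minimal graded free resolutions -/

section Resolutions

variable {K : Type*} [Field K] {m : ℕ}

/-- The Hilbert series of a graded vector space. -/
def hilbertSeries {M : Type*} [AddCommGroup M] [Module K M] (ℳ : ℕ → Submodule K M) :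
    PowerSeries ℤ :=
  PowerSeries.mk fun s => (Module.finrank K (ℳ s) : ℤ)

variable (K m) in
/-- The free module `F_i = ⊕_j R(-j)^{β i j}` over `R = K[x_1, …, x_m]`: the basis vector with
index `⟨j, a⟩`, `a < β i j`, is of degree `j`. -/
abbrev FreeTerm (β : ℕ → ℕ → ℕ) (i : ℕ) : Type _ :=
  (Σ j : ℕ, Fin (β i j)) →₀ MvPolynomial (Fin m) K

/-- A minimal graded free resolution
`⋯ → F_2 → F_1 → F_0 → M → 0` with `F_i = ⊕_j R(-j)^{β i j}` of a graded module `M = ⊕ ℳ s` over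
`R = K[x_1, …, x_m]`, where `x_k` has degree `deg k`. -/
structure MinimalGradedFreeResolution (deg : Fin m → ℕ) (M : Type*) [AddCommGroup M] [Module K M]
    [Module (MvPolynomial (Fin m) K) M] (ℳ : ℕ → Submodule K M) (β : ℕ → ℕ → ℕ) where
  /-- The differentials. -/
  d : ∀ i, FreeTerm K m β (i + 1) →ₗ[MvPolynomial (Fin m) K] FreeTerm K m β i
  /-- The augmentation. -/
  ε : FreeTerm K m β 0 →ₗ[MvPolynomial (Fin m) K] M
  surjective : Function.Surjective ε
  exact_zero : Function.Exact (d 0) ε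
  exact_succ : ∀ i, Function.Exact (d (i + 1)) (d i)
  /-- The augmentation preserves degrees. -/
  ε_graded : ∀ b, ε (Finsupp.single b 1) ∈ ℳ b.1
  /-- The differentials preserve degrees: the entry in column `b` and row `c` is homogeneous of
  degree `b.1 - c.1`. -/
  d_graded : ∀ i b c, ∀ p ∈ (d i (Finsupp.single b 1) c).support,
    Finsupp.weight deg p + c.1 = b.1
  /-- Minimality: the image of `F_{i+1}` lies in `(x_1, …, x_m) F_i`. -/
  minimal : ∀ i x c, constantCoeff (d i x c) = 0

/-- The ideal `J` of `K[x_1, …, x_m]` is homogeneous for the grading in which `x_k` has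
degree `deg k`. -/
def IsHomogeneousIdeal (deg : Fin m → ℕ) (J : Ideal (MvPolynomial (Fin m) K)) : Prop :=
  ∀ p ∈ J, ∀ s : ℕ, weightedHomogeneousComponent deg s p ∈ J

/-- The grading of `R / J` induced by the grading of `R = K[x_1, …, x_m]` in which `x_k` has
degree `deg k`. -/
def quotientPiece (deg : Fin m → ℕ) (J : Ideal (MvPolynomial (Fin m) K)) (s : ℕ) :
    Submodule K (MvPolynomial (Fin m) K ⧸ J) :=
  (weightedHomogeneousSubmodule K deg s).map (Ideal.Quotient.mkₐ K J).toLinearMap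

end Resolutions

/-- The graded Betti diagram: `bettiTable i j` is the exponent of `R(-j)` in the `i`-th term. -/
def bettiTable : ℕ → ℕ → ℕ
  | 0, 0 => 1
  | 1, 8 => 10
  | 1, 10 => 15
  | 1, 12 => 10
  | 2, 12 => 20
  | 2, 14 => 60
  | 2, 16 => 60
  | 2, 18 => 20
  | 3, 16 => 15
  | 3, 18 => 90
  | 3, 20 => 140
  | 3, 22 => 90
  | 3, 24 => 15
  | 4, 20 => 4
  | 4, 22 => 60
  | 4, 24 => 160
  | 4, 26 => 160
  | 4, 28 => 60
  | 4, 30 => 4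
  | 5, 26 => 15
  | 5, 28 => 90
  | 5, 30 => 140
  | 5, 32 => 90
  | 5, 34 => 15
  | 6, 32 => 20
  | 6, 34 => 60
  | 6, 36 => 60
  | 6, 38 => 20
  | 7, 38 => 10
  | 7, 40 => 15
  | 7, 42 => 10
  | 8, 50 => 1
  | _, _ => 0

end SLInv

end

/-! The two linear forms have zeros `p`, `q`. Writing the cubic form, its Hessian and its cubic
covariant in terms of `p` and `q` gives invariants as coefficients. With the determinant of the
linear forms and the discriminant of the cubic they yield thirteen generators: parameters `y_0, …,
y_4` of degrees 2, 4, 4, 4, 4 and further invariants `v_0, …, v_7`, four of degree 4 and four of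
degree 6. The heart of the proof is `isFreeTable_invariants`: the algebra of invariants is free over
`K[y]` with basis `1`, `v_0, …, v_7`, `v_2 v_5`, and modulo the parameters `v_i v_j` is `v_2 v_5` if
`i + j = 7` and `0` otherwise.

Three facts combine to this. First, if the linear forms are independent, then `SL₂` moves them to
`-y` and `t x`, and the coefficients of the transformed cubic are generators divided by powers of `t
= 2 y_0`. So every invariant lies in the algebra of the generators after multiplication by a power
of `y_0` (`exists_pow_mul_mem_genAlgebra`). Second, the multiplication table, verified in this
normal form, makes the `K[y]`-span of the ten basis elements a ring (`hasMulTable_poly`,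
`HasMulTable.adjoin_le`). Third, at suitable points where the linear forms are proportional, `y_0`
vanishes while the ten elements stay independent over `K[y_1, …, y_4]`
(`polyComb_special_injective`). Hence a combination divisible by `y_0` has coefficients divisible by
`y_0` (`X_dvd_of_polyComb_eq`). This gives independence over `K[y]` and also cancels the power of
`y_0` from the first fact.

For the Betti numbers, a minimal resolution exists (`exists_minimalGradedFreeResolution`), and it
stays a minimal resolution after reduction modulo the regular sequence of the parameters
(`MinimalGradedFreeResolution.reduce`). It then resolves the Artinian algebra with basis `1`, `v_k`,
`σ` over a polynomial ring in eight variables. Betti numbers are dimensions of Koszul homology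
(`betti_eq_koszulDim`), and for this algebra the Koszul cycles can be counted by hand
(`finrank_koszulCycles`). Any other minimal generating system differs by an isomorphism of graded
polynomial rings (`exists_isGradedEquiv`), along which resolutions are transported. Minimality
together with `F_8 ≠ 0 = F_9` gives the projective dimension (`projectiveDimension_eq`).

For (c), a monomial ideal is chosen whose standard monomials correspond, weight by weight, to the
`K`-basis of the invariants, but which has the minimal generator `v_0² v_4` of degree 14. The
resolution of (b) has no generator of `F_1` beyond degree 12 (`not_nonempty_resolution`). -/

noncomputable section
namespace SLInv

/-! ### Koszul complexes -/

section Koszul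

variable {K : Type*} [Field K] {n : ℕ} {R : Type*} [CommRing R] {E : Type*} [AddCommGroup E]
  [Module R E]

/-- The sign of `k` with respect to `T`: `-1` to the number of elements of `T` below `k`. -/
def koszulSign (k : Fin n) (T : Finset (Fin n)) : ℤ := (-1) ^ (T.filter (· < k)).card

lemma koszulSign_mul_self (k : Fin n) (T : Finset (Fin n)) :
    koszulSign k T * koszulSign k T = 1 := by
  rw [koszulSign, ← pow_add, ← two_mul, pow_mul]; simp

lemma koszulSign_erase (k : Fin n) (T : Finset (Fin n)) :
    koszulSign k (T.erase k) = koszulSign k T := by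
  unfold koszulSign
  congr 2
  ext l
  simp only [Finset.mem_filter, Finset.mem_erase]
  constructor
  · rintro ⟨⟨_, h⟩, h'⟩; exact ⟨h, h'⟩
  · rintro ⟨h, h'⟩; exact ⟨⟨h'.ne, h⟩, h'⟩

lemma koszulSign_insert (k l : Fin n) {T : Finset (Fin n)} (hl : l ∉ T) :
    koszulSign k (insert l T) = (if l < k then -1 else 1) * koszulSign k T := by
  unfold koszulSign
  rw [Finset.filter_insert]
  split_ifs with h
  · rw [Finset.card_insert_of_notMem (by simp [hl]), pow_succ]; ring
  · simp

/-- Exactly one of `k`, `l` lies below the other, so exactly one of the two insertions changes a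
sign. This is the anticommutativity of the exterior algebra. -/
lemma koszulSign_insert_comm {k l : Fin n} (hkl : k ≠ l) {T : Finset (Fin n)} (hk : k ∉ T)
    (hl : l ∉ T) :
    koszulSign k T * koszulSign l (insert k T) = -(koszulSign l T * koszulSign k (insert l T)) := by
  rw [koszulSign_insert l k hk, koszulSign_insert k l hl]
  rcases lt_or_gt_of_ne hkl with h | h
  · rw [if_pos h, if_neg h.not_gt]; ring
  · rw [if_neg h.not_gt, if_pos h]; ring

variable (R E) in
/-- Contraction with the `k`-th dual basis vector, on `E ⊗ Λ (Rⁿ)` viewed as functions on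
subsets. -/
def contract (k : Fin n) : (Finset (Fin n) → E) →ₗ[R] (Finset (Fin n) → E) where
  toFun c T := if k ∈ T then 0 else koszulSign k T • c (insert k T)
  map_add' c c' := by ext T; by_cases h : k ∈ T <;> simp [h]
  map_smul' r c := by ext T; by_cases h : k ∈ T <;> simp [h, smul_comm r (koszulSign k T)]

variable (R E) in
/-- Multiplication by the `k`-th basis vector, on `E ⊗ Λ (Rⁿ)` viewed as functions on subsets. -/
def wedge (k : Fin n) : (Finset (Fin n) → E) →ₗ[R] (Finset (Fin n) → E) where
  toFun c T := if k ∈ T then koszulSign k T • c (T.erase k) else 0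
  map_add' c c' := by ext T; by_cases h : k ∈ T <;> simp [h]
  map_smul' r c := by ext T; by_cases h : k ∈ T <;> simp [h, smul_comm r (koszulSign k T)]

lemma contract_apply (k : Fin n) (c : Finset (Fin n) → E) (T : Finset (Fin n)) :
    contract R E k c T = if k ∈ T then 0 else koszulSign k T • c (insert k T) := rfl

lemma wedge_apply (k : Fin n) (c : Finset (Fin n) → E) (T : Finset (Fin n)) :
    wedge R E k c T = if k ∈ T then koszulSign k T • c (T.erase k) else 0 := rfl

lemma contract_contract (k l : Fin n) (c : Finset (Fin n) → E) :
    contract R E k (contract R E l c) = - contract R E l (contract R E k c) := by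
  ext T
  simp only [contract_apply, Pi.neg_apply, Finset.mem_insert]
  by_cases hkl : k = l
  · subst hkl; simp
  by_cases hk : k ∈ T
  · simp [hk]
  by_cases hl : l ∈ T
  · simp [hl]
  rw [if_neg hk, if_neg hl, if_neg (by tauto), if_neg (by tauto), smul_smul, smul_smul,
    koszulSign_insert_comm hkl hk hl, neg_smul, Finset.insert_comm]

/-- The anticommutation relation of contraction and exterior multiplication. It makes the Euler
homotopy below diagonal. -/
lemma contract_wedge_add (k l : Fin n) (c : Finset (Fin n) → E) :
    contract R E k (wedge R E l c) + wedge R E l (contract R E k c) = if k = l then c else 0 := by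
  ext T
  simp only [contract_apply, wedge_apply, Pi.add_apply, Finset.mem_insert, Finset.mem_erase]
  by_cases hkl : k = l
  · subst hkl
    by_cases hk : k ∈ T
    · simp [hk, smul_smul, koszulSign_erase, koszulSign_mul_self, Finset.insert_erase]
    · simp [hk, smul_smul, koszulSign_insert, koszulSign_mul_self]
  · by_cases hk : k ∈ T
    · simp [hk, hkl]
    by_cases hl : l ∈ T
    · rw [if_neg hk, if_pos (Or.inr hl), if_pos hl, if_neg (by tauto), smul_smul, smul_smul,
        if_neg hkl]
      rw [Finset.erase_insert_of_ne hkl]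
      have h3 : koszulSign k T * koszulSign l (insert k T)
          = - (koszulSign l T * koszulSign k (T.erase l)) := by
        have e1 := koszulSign_insert k l (Finset.notMem_erase l T)
        have e2 := koszulSign_insert l k hk
        rw [Finset.insert_erase hl] at e1
        rw [e1, e2]
        rcases lt_or_gt_of_ne hkl with h | h
        · rw [if_pos h, if_neg h.not_gt]; ring
        · rw [if_neg h.not_gt, if_pos h]; ring
      rw [h3, neg_smul, neg_add_cancel]; rfl
    · simp [hk, hl, hkl, Ne.symm hkl]

lemma wedge_contract_self (k : Fin n) (c : Finset (Fin n) → E) (T : Finset (Fin n)) :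
    wedge R E k (contract R E k c) T = if k ∈ T then c T else 0 := by
  simp only [contract_apply, wedge_apply]
  by_cases hk : k ∈ T
  · simp [hk, smul_smul, koszulSign_erase, koszulSign_mul_self, Finset.insert_erase]
  · simp [hk]

variable (K E) in
/-- The Koszul differential of a module over `K[x_1, …, x_n]`. -/
def koszulD [Module (MvPolynomial (Fin n) K) E] :
    (Finset (Fin n) → E) →ₗ[MvPolynomial (Fin n) K] (Finset (Fin n) → E) :=
  ∑ k : Fin n, (X k : MvPolynomial (Fin n) K) • contract (MvPolynomial (Fin n) K) E k

variable [Module (MvPolynomial (Fin n) K) E]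

lemma koszulD_eq_sum (c : Finset (Fin n) → E) :
    koszulD K E c
      = ∑ k : Fin n, (X k : MvPolynomial (Fin n) K) • contract (MvPolynomial (Fin n) K) E k c := by
  simp [koszulD]

lemma koszulD_apply (c : Finset (Fin n) → E) (T : Finset (Fin n)) :
    koszulD K E c T = ∑ k : Fin n, (X k : MvPolynomial (Fin n) K) •
      (if k ∈ T then 0 else koszulSign k T • c (insert k T)) := by
  simp [koszulD, contract_apply]

/-- Contractions anticommute, so exchanging the two summation indices shows that the square equals
its own negative. Division by `2` finishes. -/
lemma koszulD_koszulD [CharZero K] (c : Finset (Fin n) → E) : koszulD K E (koszulD K E c) = 0 := by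
  have h : koszulD K E (koszulD K E c) = - koszulD K E (koszulD K E c) := by
    simp only [koszulD_eq_sum, map_sum, map_smul, Finset.smul_sum]
    conv_lhs => rw [Finset.sum_comm]
    rw [← Finset.sum_neg_distrib]
    refine Finset.sum_congr rfl fun k _ => ?_
    rw [← Finset.sum_neg_distrib]
    refine Finset.sum_congr rfl fun l _ => ?_
    rw [contract_contract, smul_neg, smul_neg, smul_comm]
  have h2 : (C (2 : K) : MvPolynomial (Fin n) K) • koszulD K E (koszulD K E c) = 0 := by
    rw [map_ofNat, two_smul]
    nth_rewrite 2 [h]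
    simp
  have h3 := congrArg (fun z => (C ((2 : K)⁻¹) : MvPolynomial (Fin n) K) • z) h2
  simpa [smul_smul, ← C_mul] using h3

lemma koszulD_map {E' : Type*} [AddCommGroup E'] [Module (MvPolynomial (Fin n) K) E']
    (φ : E →ₗ[MvPolynomial (Fin n) K] E') (c : Finset (Fin n) → E) :
    koszulD K E' (fun T => φ (c T)) = fun T => φ (koszulD K E c T) := by
  ext T
  simp only [koszulD_apply, map_sum, map_smul]
  refine Finset.sum_congr rfl fun k _ => ?_
  split_ifs <;> simp

end Koszul
end SLInv
end

/-! ### Koszul homology in graded pieces and dimension shifting -/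

noncomputable section
namespace SLInv

section KoszulHomology

variable {K : Type*} [Field K] {n : ℕ} {E : Type*} [AddCommGroup E] [Module K E]
  [Module (MvPolynomial (Fin n) K) E] [IsScalarTower K (MvPolynomial (Fin n) K) E]

/-- The part of degree `j - w` of a graded vector space. -/
def pieceAt (𝒩 : ℕ → Submodule K E) (j w : ℕ) : Submodule K E := if w ≤ j then 𝒩 (j - w) else ⊥

/-- The Koszul chains of homological degree `p` and internal degree `j`. -/
def koszulChains (deg : Fin n → ℕ) (𝒩 : ℕ → Submodule K E) (p j : ℕ) :
    Submodule K (Finset (Fin n) → E) where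
  carrier := {c | ∀ T, c T ∈ pieceAt 𝒩 j (∑ k ∈ T, deg k) ∧ (T.card ≠ p → c T = 0)}
  add_mem' := by
    intro c c' h h' T
    exact ⟨add_mem (h T).1 (h' T).1, fun hT => by simp [(h T).2 hT, (h' T).2 hT]⟩
  zero_mem' := fun T => ⟨zero_mem _, fun _ => rfl⟩
  smul_mem' := by
    intro r c h T
    exact ⟨Submodule.smul_mem _ _ (h T).1, fun hT => by simp [(h T).2 hT]⟩

variable (K E) in
/-- The Koszul differential as a `K`-linear map. -/
def koszulDK : (Finset (Fin n) → E) →ₗ[K] (Finset (Fin n) → E) :=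
  (koszulD K E).restrictScalars K

@[simp] lemma koszulDK_apply (c : Finset (Fin n) → E) : koszulDK K E c = koszulD K E c := rfl

/-- The Koszul cycles. -/
def koszulCycles (deg : Fin n → ℕ) (𝒩 : ℕ → Submodule K E) (p j : ℕ) :
    Submodule K (Finset (Fin n) → E) := koszulChains deg 𝒩 p j ⊓ LinearMap.ker (koszulDK K E)

/-- The Koszul boundaries. -/
def koszulBoundaries (deg : Fin n → ℕ) (𝒩 : ℕ → Submodule K E) (p j : ℕ) :
    Submodule K (Finset (Fin n) → E) := (koszulChains deg 𝒩 (p + 1) j).map (koszulDK K E)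

/-- The dimension of the Koszul homology in homological degree `p` and internal degree `j`. -/
def koszulDim (deg : Fin n → ℕ) (𝒩 : ℕ → Submodule K E) (p j : ℕ) : ℕ :=
  Module.finrank K (koszulCycles deg 𝒩 p j ⧸
    (koszulBoundaries deg 𝒩 p j).submoduleOf (koszulCycles deg 𝒩 p j))

/-- The multiplications by the variables raise degrees by the degrees of the variables. -/
def IsGradedAction (deg : Fin n → ℕ) (𝒩 : ℕ → Submodule K E) : Prop :=
  ∀ k s, ∀ x ∈ 𝒩 s, (X k : MvPolynomial (Fin n) K) • x ∈ 𝒩 (s + deg k)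

lemma koszulD_mem_chains {deg : Fin n → ℕ} {𝒩 : ℕ → Submodule K E}
    (h𝒩 : IsGradedAction deg 𝒩) {p j : ℕ} {c : Finset (Fin n) → E}
    (hc : c ∈ koszulChains deg 𝒩 (p + 1) j) : koszulD K E c ∈ koszulChains deg 𝒩 p j := by
  intro T
  rw [koszulD_apply]
  constructor
  · refine Submodule.sum_mem _ fun k _ => ?_
    split_ifs with hk
    · simp
    · rw [smul_comm]
      refine zsmul_mem ?_ _
      have h1 := (hc (insert k T)).1
      rw [Finset.sum_insert hk] at h1
      unfold pieceAt at h1 ⊢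
      split_ifs at h1 with h2
      · rw [if_pos (by omega)]
        have h3 := h𝒩 k _ _ h1
        rwa [show j - (deg k + ∑ k ∈ T, deg k) + deg k = j - ∑ k ∈ T, deg k by omega] at h3
      · rw [(Submodule.mem_bot K).1 h1]; simp
  · intro hT
    refine Finset.sum_eq_zero fun k _ => ?_
    split_ifs with hk
    · simp
    · rw [(hc (insert k T)).2 (by rw [Finset.card_insert_of_notMem hk]; omega)]; simp

/-- `φ` induces an isomorphism from `B` modulo the preimage of `N` onto `Z` modulo `N ∩ Z`. Used
twice with the same `B`, it compares two homology groups without constructing a map between them. -/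
lemma finrank_quotient_eq_of_surjective {V W : Type*} [AddCommGroup V] [Module K V]
    [AddCommGroup W] [Module K W] (φ : V →ₗ[K] W) (B : Submodule K V) (Z N : Submodule K W)
    (h1 : ∀ x ∈ B, φ x ∈ Z) (h2 : ∀ z ∈ Z, ∃ x ∈ B, z - φ x ∈ N) :
    Module.finrank K (Z ⧸ N.submoduleOf Z)
      = Module.finrank K (B ⧸ (N.comap φ).submoduleOf B) := by
  let ψ : B →ₗ[K] (Z ⧸ N.submoduleOf Z) := (N.submoduleOf Z).mkQ ∘ₗ φ.restrict h1
  have hψ : Function.Surjective ψ := by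
    intro z
    obtain ⟨⟨z, hz⟩, rfl⟩ := Submodule.mkQ_surjective _ z
    obtain ⟨x, hx, hxz⟩ := h2 z hz
    refine ⟨⟨x, hx⟩, ?_⟩
    simp only [ψ, LinearMap.comp_apply, Submodule.mkQ_apply]
    symm
    rw [Submodule.Quotient.eq]
    exact hxz
  have hker : LinearMap.ker ψ = (N.comap φ).submoduleOf B := by
    ext ⟨x, hx⟩
    simp only [ψ, LinearMap.mem_ker, LinearMap.comp_apply, Submodule.mkQ_apply,
      Submodule.Quotient.mk_eq_zero]
    rfl
  rw [← hker]
  exact (ψ.quotKerEquivOfSurjective hψ).finrank_eq.symm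

variable {E' : Type*} [AddCommGroup E'] [Module K E']
  [Module (MvPolynomial (Fin n) K) E'] [IsScalarTower K (MvPolynomial (Fin n) K) E']

lemma pieceAt_map (φ : E →ₗ[K] E') (𝓕 : ℕ → Submodule K E) (j w : ℕ) :
    pieceAt (fun s => (𝓕 s).map φ) j w = (pieceAt 𝓕 j w).map φ := by
  unfold pieceAt; split_ifs <;> simp

lemma pieceAt_inf_ker (φ : E →ₗ[K] E') (𝓕 : ℕ → Submodule K E) (j w : ℕ) :
    pieceAt (fun s => 𝓕 s ⊓ LinearMap.ker φ) j w = pieceAt 𝓕 j w ⊓ LinearMap.ker φ := by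
  unfold pieceAt; split_ifs <;> simp

/-- Dimension shifting for Koszul homology. -/
lemma koszulDim_succ_map [CharZero K] {deg : Fin n → ℕ} {𝓕 : ℕ → Submodule K E}
    (h𝓕 : IsGradedAction deg 𝓕) (φ : E →ₗ[MvPolynomial (Fin n) K] E') (p j : ℕ)
    (hacyc : ∀ c ∈ koszulCycles deg 𝓕 (p + 1) j, c ∈ koszulBoundaries deg 𝓕 (p + 1) j)
    (hlift : ∀ c ∈ koszulCycles deg (fun s => 𝓕 s ⊓ LinearMap.ker (φ.restrictScalars K)) p j,
      c ∈ koszulBoundaries deg 𝓕 p j) :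
    koszulDim deg (fun s => (𝓕 s).map (φ.restrictScalars K)) (p + 1) j
      = koszulDim deg (fun s => 𝓕 s ⊓ LinearMap.ker (φ.restrictScalars K)) p j := by
  set 𝒵 : ℕ → Submodule K E := fun s => 𝓕 s ⊓ LinearMap.ker (φ.restrictScalars K) with h𝒵
  set 𝓜 : ℕ → Submodule K E' := fun s => (𝓕 s).map (φ.restrictScalars K) with h𝓜
  -- Chains of `F` whose boundary lies in the kernel of `φ`. Both homology groups are quotients of
  -- this space: one via the differential (`e1`), the other via `φ` (`e2`).
  let B : Submodule K (Finset (Fin n) → E) :=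
    koszulChains deg 𝓕 (p + 1) j ⊓ (koszulChains deg 𝒵 p j).comap (koszulDK K E)
  let Φ : (Finset (Fin n) → E) →ₗ[K] (Finset (Fin n) → E') := φ.restrictScalars K |>.compLeft _
  have hΦ : ∀ c T, Φ c T = φ (c T) := fun c T => rfl
  have hΦd : ∀ c, koszulD K E' (Φ c) = Φ (koszulD K E c) := fun c => koszulD_map φ c
  have hΦchains : ∀ q, ∀ c ∈ koszulChains deg 𝓕 q j, Φ c ∈ koszulChains deg 𝓜 q j := by
    intro q c hc T
    refine ⟨?_, fun hT => by rw [hΦ, (hc T).2 hT, map_zero]⟩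
    rw [h𝓜, pieceAt_map]
    exact ⟨c T, (hc T).1, rfl⟩
  have hlifts : ∀ q, ∀ z ∈ koszulChains deg 𝓜 q j, ∃ c ∈ koszulChains deg 𝓕 q j, Φ c = z := by
    intro q z hz
    have : ∀ T, ∃ x ∈ pieceAt 𝓕 j (∑ k ∈ T, deg k), φ x = z T ∧ (T.card ≠ q → x = 0) := by
      intro T
      by_cases hT : T.card = q
      · have := (hz T).1
        rw [h𝓜, pieceAt_map] at this
        obtain ⟨x, hx, hx'⟩ := this
        exact ⟨x, hx, hx', fun h => absurd hT h⟩
      · exact ⟨0, zero_mem _, by rw [(hz T).2 hT, map_zero], fun _ => rfl⟩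
    choose x h1 h2 h3 using this
    exact ⟨x, fun T => ⟨h1 T, h3 T⟩, funext h2⟩
  have hZ : ∀ q c, c ∈ koszulChains deg 𝒵 q j ↔ c ∈ koszulChains deg 𝓕 q j ∧ Φ c = 0 := by
    intro q c
    constructor
    · intro h
      refine ⟨fun T => ⟨?_, (h T).2⟩, funext fun T => ?_⟩ <;>
      · have := (h T).1
        rw [h𝒵, pieceAt_inf_ker] at this
        first | exact this.1 | exact this.2
    · rintro ⟨h, h'⟩ T
      refine ⟨?_, (h T).2⟩
      rw [h𝒵, pieceAt_inf_ker]
      exact ⟨(h T).1, congrFun h' T⟩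
  have e1 := finrank_quotient_eq_of_surjective (koszulDK K E) B (koszulCycles deg 𝒵 p j)
    (koszulBoundaries deg 𝒵 p j)
    (fun x hx => ⟨hx.2, by simp [koszulD_koszulD]⟩)
    (fun z hz => by
      obtain ⟨c, hc, hcz⟩ := hlift z hz
      refine ⟨c, ⟨hc, ?_⟩, ?_⟩
      · rw [SetLike.mem_coe, Submodule.mem_comap, hcz]; exact hz.1
      · rw [hcz, sub_self]; exact zero_mem _)
  have e2 := finrank_quotient_eq_of_surjective Φ B (koszulCycles deg 𝓜 (p + 1) j)
    (koszulBoundaries deg 𝓜 (p + 1) j)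
    (fun x hx => ⟨hΦchains _ _ hx.1, by
      rw [SetLike.mem_coe, LinearMap.mem_ker, koszulDK_apply, hΦd]
      exact ((hZ _ _).1 hx.2).2⟩)
    (fun z hz => by
      obtain ⟨c, hc, rfl⟩ := hlifts _ z hz.1
      refine ⟨c, ⟨hc, (hZ _ _).2 ⟨koszulD_mem_chains h𝓕 hc, ?_⟩⟩, ?_⟩
      · have := hz.2
        rw [SetLike.mem_coe, LinearMap.mem_ker, koszulDK_apply, hΦd] at this
        exact this
      · rw [sub_self]; exact zero_mem _)
  rw [koszulDim, koszulDim, e1, e2]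
  -- The two kernels agree. If `φ x` is the boundary of `φ c`, then `x - d c` has values in the
  -- kernel and the same boundary as `x`. Conversely, if `d x = d y` with `y` in the kernel,
  -- acyclicity writes `x - y` as a boundary.
  have : ((koszulBoundaries deg 𝓜 (p + 1) j).comap Φ).submoduleOf B
      = ((koszulBoundaries deg 𝒵 p j).comap (koszulDK K E)).submoduleOf B := by
    ext ⟨x, hx⟩
    simp only [Submodule.submoduleOf, Submodule.mem_comap, Submodule.subtype_apply]
    constructor
    · rintro ⟨y, hy, hyx⟩
      obtain ⟨c, hc, rfl⟩ := hlifts _ y hy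
      rw [koszulDK_apply, hΦd] at hyx
      refine ⟨x - koszulD K E c, (hZ _ _).2 ⟨sub_mem hx.1 (koszulD_mem_chains h𝓕 hc), ?_⟩, ?_⟩
      · rw [map_sub, hyx, sub_self]
      · rw [map_sub]; simp [koszulD_koszulD]
    · rintro ⟨y, hy, hyx⟩
      have hy' := (hZ _ _).1 hy
      obtain ⟨w, hw, hwx⟩ := hacyc (x - y) ⟨sub_mem hx.1 hy'.1, by
        rw [SetLike.mem_coe, LinearMap.mem_ker, map_sub, hyx, sub_self]⟩
      refine ⟨Φ w, hΦchains _ _ hw, ?_⟩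
      rw [koszulDK_apply, hΦd]
      rw [koszulDK_apply] at hwx
      rw [hwx, map_sub, hy'.2, sub_zero]
  rw [this]

end KoszulHomology

end SLInv
end

/-! ### Acyclicity of the Koszul complex of a graded free module -/

noncomputable section
namespace SLInv

section KoszulFree

variable {K : Type*} [Field K] {n : ℕ}

lemma contract_pderiv (k l : Fin n) (c : Finset (Fin n) → MvPolynomial (Fin n) K) :
    contract (MvPolynomial (Fin n) K) _ k (fun T => pderiv l (c T))
      = fun T => pderiv l (contract (MvPolynomial (Fin n) K) _ k c T) := by
  ext1 T; simp only [contract_apply]; split_ifs <;> simp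

lemma wedge_pderiv (k l : Fin n) (c : Finset (Fin n) → MvPolynomial (Fin n) K) :
    wedge (MvPolynomial (Fin n) K) _ k (fun T => pderiv l (c T))
      = fun T => pderiv l (wedge (MvPolynomial (Fin n) K) _ k c T) := by
  ext1 T; simp only [wedge_apply]; split_ifs <;> simp

/-- The weighted Euler homotopy on the Koszul complex of the polynomial ring. -/
def koszulHomotopy (deg : Fin n → ℕ) (c : Finset (Fin n) → MvPolynomial (Fin n) K) :
    Finset (Fin n) → MvPolynomial (Fin n) K :=
  ∑ l : Fin n, deg l • wedge (MvPolynomial (Fin n) K) (MvPolynomial (Fin n) K) l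
    (fun T => pderiv l (c T))

lemma koszulHomotopy_apply (deg : Fin n → ℕ) (c : Finset (Fin n) → MvPolynomial (Fin n) K)
    (T : Finset (Fin n)) :
    koszulHomotopy deg c T = ∑ l : Fin n, deg l •
      (if l ∈ T then koszulSign l T • pderiv l (c (T.erase l)) else 0) := by
  simp [koszulHomotopy, wedge_apply]

/-- Cartan's formula: the differential is contraction with the Euler field and the homotopy a
weighted exterior derivative, so their anticommutator is a weighted Lie derivative. On a monomial at
`T` it multiplies by the weight of the monomial plus the weight of `T`. -/
lemma koszulD_koszulHomotopy_add (deg : Fin n → ℕ) (c : Finset (Fin n) → MvPolynomial (Fin n) K)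
    (T : Finset (Fin n)) :
    koszulD K _ (koszulHomotopy deg c) T + koszulHomotopy deg (koszulD K _ c) T
      = ∑ k, deg k • (X k * pderiv k (c T)) + (∑ k ∈ T, deg k) • c T := by
  have h1 : koszulD K _ (koszulHomotopy deg c) T = ∑ l, ∑ k, deg l •
      (X k * pderiv l (contract (MvPolynomial (Fin n) K) _ k (wedge (MvPolynomial (Fin n) K) _ l c) T)) := by
    rw [koszulD_eq_sum, koszulHomotopy, Finset.sum_apply, Finset.sum_comm]
    refine Finset.sum_congr rfl fun k _ => ?_
    rw [map_sum, Finset.smul_sum, Finset.sum_apply]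
    refine Finset.sum_congr rfl fun l _ => ?_
    rw [map_nsmul, wedge_pderiv, contract_pderiv]
    simp only [Pi.smul_apply, smul_eq_mul, mul_smul_comm]
  -- By the Leibniz rule, differentiating the factor `X k` adds a term for `k = l`. These terms
  -- account for the weight of `T`.
  have h2 : koszulHomotopy deg (koszulD K _ c) T = ∑ l, ∑ k, deg l •
      (X k * pderiv l (wedge (MvPolynomial (Fin n) K) _ l (contract (MvPolynomial (Fin n) K) _ k c) T) +
        if k = l then wedge (MvPolynomial (Fin n) K) _ l (contract (MvPolynomial (Fin n) K) _ k c) T else 0) := by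
    rw [koszulHomotopy, Finset.sum_apply]
    refine Finset.sum_congr rfl fun l _ => ?_
    rw [wedge_pderiv, koszulD_eq_sum, map_sum]
    simp only [Pi.smul_apply, Finset.sum_apply, map_sum, Finset.smul_sum, map_smul, smul_eq_mul]
    refine Finset.sum_congr rfl fun k _ => ?_
    congr 1
    change pderiv l (X k * wedge (MvPolynomial (Fin n) K) _ l (contract (MvPolynomial (Fin n) K) _ k c) T) = _
    rw [Derivation.leibniz, pderiv_X]
    by_cases hkl : k = l
    · subst hkl; simp
    · rw [Pi.single_eq_of_ne hkl, if_neg hkl]; simp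
  rw [h1, h2, ← Finset.sum_add_distrib]
  have h3 : (∑ k ∈ T, deg k) • c T = ∑ l, deg l • wedge (MvPolynomial (Fin n) K) _ l (contract (MvPolynomial (Fin n) K) _ l c) T := by
    simp only [wedge_contract_self, smul_ite, smul_zero]
    rw [← Finset.sum_filter, Finset.sum_smul]
    simp
  rw [h3, ← Finset.sum_add_distrib]
  refine Finset.sum_congr rfl fun l _ => ?_
  rw [← Finset.sum_add_distrib]
  have h4 : ∀ k, deg l • (X k * pderiv l (contract (MvPolynomial (Fin n) K) _ k (wedge (MvPolynomial (Fin n) K) _ l c) T)) +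
      deg l • (X k * pderiv l (wedge (MvPolynomial (Fin n) K) _ l (contract (MvPolynomial (Fin n) K) _ k c) T) +
        if k = l then wedge (MvPolynomial (Fin n) K) _ l (contract (MvPolynomial (Fin n) K) _ k c) T else 0) =
      if k = l then deg l • (X l * pderiv l (c T)) + deg l • wedge (MvPolynomial (Fin n) K) _ l (contract (MvPolynomial (Fin n) K) _ l c) T
        else 0 := by
    intro k
    have h5 := congrFun (contract_wedge_add (R := MvPolynomial (Fin n) K) k l c) T
    rw [Pi.add_apply] at h5
    rw [← smul_add, ← add_assoc, ← mul_add, ← map_add, h5]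
    by_cases hkl : k = l
    · subst hkl; simp
    · simp [hkl]
  rw [Finset.sum_congr rfl fun k _ => h4 k]
  simp only [Finset.sum_ite_eq', Finset.mem_univ, if_true]

lemma add_single_mem_support_of_mem_support_pderiv {k : Fin n} {f : MvPolynomial (Fin n) K}
    {m : Fin n →₀ ℕ} (h : m ∈ (pderiv k f).support) : m + Finsupp.single k 1 ∈ f.support := by
  rw [mem_support_iff, coeff_pderiv] at h
  rw [mem_support_iff]
  exact left_ne_zero_of_mul h

/-- On internal degree `j - δ > 0` the homotopy inverts the differential up to the factor `j - δ`, a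
unit in characteristic 0. The last clause of the conclusion keeps supports finite when the lemma is
applied to the components of an element of a free module. -/
lemma exists_koszulD_eq [CharZero K] {deg : Fin n → ℕ} {p j δ : ℕ}
    {c : Finset (Fin n) → MvPolynomial (Fin n) K}
    (hc : ∀ T, ∀ m ∈ (c T).support, Finsupp.weight deg m + ∑ k ∈ T, deg k + δ = j)
    (hp : ∀ T : Finset (Fin n), T.card ≠ p → c T = 0) (hδ : j ≤ δ → c = 0)
    (hd : koszulD K _ c = 0) :
    ∃ b : Finset (Fin n) → MvPolynomial (Fin n) K,
      (∀ T, ∀ m ∈ (b T).support, Finsupp.weight deg m + ∑ k ∈ T, deg k + δ = j) ∧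
      (∀ T : Finset (Fin n), T.card ≠ p + 1 → b T = 0) ∧ koszulD K _ b = c ∧
      (c = 0 → b = 0) := by
  classical
  by_cases hj : j ≤ δ
  · refine ⟨0, by simp, by simp, ?_, fun _ => rfl⟩
    rw [hδ hj, map_zero]
  push Not at hj
  have hN : ((j - δ : ℕ) : K) ≠ 0 := by
    rw [Nat.cast_ne_zero]; omega
  refine ⟨(C (((j - δ : ℕ) : K)⁻¹) : MvPolynomial (Fin n) K) • koszulHomotopy deg c,
    ?_, ?_, ?_, ?_⟩
  · intro T m hm
    rw [Pi.smul_apply, smul_eq_mul, mem_support_iff, coeff_C_mul] at hm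
    have hm := right_ne_zero_of_mul hm
    rw [koszulHomotopy_apply, coeff_sum] at hm
    obtain ⟨l, _, hl⟩ := Finset.exists_ne_zero_of_sum_ne_zero hm
    by_cases hlT : l ∈ T
    · rw [if_pos hlT] at hl
      have hl2 : coeff m (pderiv l (c (T.erase l))) ≠ 0 := by
        intro h0
        apply hl
        rw [nsmul_eq_mul, zsmul_eq_mul, ← map_natCast (C (σ := Fin n) (R := K)),
          ← map_intCast (C (σ := Fin n) (R := K)), coeff_C_mul, coeff_C_mul, h0]
        simp
      have h3 := hc _ _ (add_single_mem_support_of_mem_support_pderiv (mem_support_iff.2 hl2))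
      rw [map_add, Finsupp.weight_single, one_smul] at h3
      have h4 := Finset.add_sum_erase T deg hlT
      omega
    · rw [if_neg hlT] at hl; simp at hl
  · intro T hT
    rw [Pi.smul_apply, koszulHomotopy_apply, Finset.sum_eq_zero, smul_zero]
    intro l _
    split_ifs with hl
    · rw [hp (T.erase l) (by
        rw [Finset.card_erase_of_mem hl]
        have := Finset.card_pos.2 ⟨l, hl⟩
        omega)]
      simp
    · simp
  · ext1 T
    rw [map_smul, Pi.smul_apply]
    have h := koszulD_koszulHomotopy_add (K := K) deg c T
    rw [hd] at h
    have h0 : koszulHomotopy (K := K) deg 0 T = 0 := by simp [koszulHomotopy_apply]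
    rw [h0, add_zero] at h
    rw [h]
    by_cases hcT : c T = 0
    · simp [hcT]
    obtain ⟨m, hm⟩ := support_nonempty.2 hcT
    have hm := hc T m hm
    have hh : (c T).IsWeightedHomogeneous deg (j - δ - ∑ k ∈ T, deg k) := by
      intro m hm
      have := hc T m (mem_support_iff.2 hm)
      omega
    rw [hh.sum_weight_X_mul_pderiv, ← add_smul,
      show j - δ - ∑ k ∈ T, deg k + ∑ k ∈ T, deg k = j - δ by omega, nsmul_eq_mul,
      ← map_natCast (C (σ := Fin n) (R := K)), smul_eq_mul, ← mul_assoc, ← C_mul,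
      inv_mul_cancel₀ hN, C_1, one_mul]
  · rintro rfl
    ext1 T
    simp [koszulHomotopy_apply]

/-- The part of degree `j` of the free module with basis `ι`, the basis vector with index `i` being
of degree `δ i`. -/
def freePiece {ι : Type*} (deg : Fin n → ℕ) (δ : ι → ℕ) (j : ℕ) :
    Submodule K (ι →₀ MvPolynomial (Fin n) K) where
  carrier := {x | ∀ i, ∀ m ∈ (x i).support, Finsupp.weight deg m + δ i = j}
  add_mem' := by
    classical
    intro x y hx hy i m hm
    rcases Finset.mem_union.1 (support_add hm) with h | h
    exacts [hx i m h, hy i m h]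
  zero_mem' := by intro i m hm; simp at hm
  smul_mem' := by
    intro r x hx i m hm
    exact hx i m (support_smul hm)

lemma mem_freePiece {ι : Type*} {deg : Fin n → ℕ} {δ : ι → ℕ} {j : ℕ}
    {x : ι →₀ MvPolynomial (Fin n) K} :
    x ∈ freePiece deg δ j ↔ ∀ i, ∀ m ∈ (x i).support, Finsupp.weight deg m + δ i = j := Iff.rfl

lemma isGradedAction_freePiece {ι : Type*} (deg : Fin n → ℕ) (δ : ι → ℕ) :
    IsGradedAction deg (freePiece (K := K) deg δ) := by
  intro k s x hx i m hm
  rw [Finsupp.smul_apply, smul_eq_mul, support_X_mul, Finset.mem_map] at hm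
  obtain ⟨m', hm', rfl⟩ := hm
  have := hx i m' hm'
  simp only [addLeftEmbedding_apply, map_add, Finsupp.weight_single, one_smul]
  omega

lemma mem_pieceAt_freePiece {ι : Type*} {deg : Fin n → ℕ} {δ : ι → ℕ} {j w : ℕ}
    {x : ι →₀ MvPolynomial (Fin n) K} : x ∈ pieceAt (freePiece deg δ) j w ↔
      ∀ i, ∀ m ∈ (x i).support, Finsupp.weight deg m + w + δ i = j := by
  unfold pieceAt
  split_ifs with h
  · rw [mem_freePiece]
    refine forall_congr' fun i => forall₂_congr fun m _ => ?_
    omega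
  · rw [Submodule.mem_bot]
    constructor
    · rintro rfl; simp
    · intro hx
      ext1 i
      by_contra hi
      obtain ⟨m, hm⟩ := support_nonempty.2 hi
      have := hx i m hm
      omega

/-- The Koszul complex of a free module is acyclic. -/
lemma koszul_acyclic_free [CharZero K] {ι : Type*} {deg : Fin n → ℕ} (hdeg : ∀ k, 0 < deg k)
    {δ : ι → ℕ} {p j : ℕ} {c : Finset (Fin n) → (ι →₀ MvPolynomial (Fin n) K)}
    (hc : c ∈ koszulCycles deg (freePiece deg δ) p j)
    (h0 : ∀ i, constantCoeff (c ∅ i) = 0) :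
    c ∈ koszulBoundaries deg (freePiece deg δ) p j := by
  classical
  have key : ∀ i, ∃ b : Finset (Fin n) → MvPolynomial (Fin n) K,
      (∀ T, ∀ m ∈ (b T).support, Finsupp.weight deg m + ∑ k ∈ T, deg k + δ i = j) ∧
      (∀ T : Finset (Fin n), T.card ≠ p + 1 → b T = 0) ∧ koszulD K _ b = (fun T => c T i) ∧
      ((fun T => c T i) = 0 → b = 0) := by
    intro i
    apply exists_koszulD_eq
    · intro T m hm
      exact mem_pieceAt_freePiece.1 (hc.1 T).1 i m hm
    · intro T hT
      rw [(hc.1 T).2 hT, Finsupp.zero_apply]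
    -- In degree `j ≤ δ i` only constants at `T = ∅` can occur, and these are excluded by `h0`.
    · intro hj
      ext1 T
      by_contra hne
      obtain ⟨m, hm⟩ := support_nonempty.2 hne
      have h1 := mem_pieceAt_freePiece.1 (hc.1 T).1 i m hm
      have hw : Finsupp.weight deg m = 0 := by omega
      have hT : ∑ k ∈ T, deg k = 0 := by omega
      have hm0 : m = 0 := by
        ext k
        by_contra hk
        have := Finsupp.le_weight deg (s := k) (hdeg k).ne' m
        rw [hw] at this
        exact hk (by simpa using this)
      have hT0 : T = ∅ := by
        rw [Finset.sum_eq_zero_iff] at hT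
        refine Finset.eq_empty_of_forall_notMem fun k hk => ?_
        exact (hdeg k).ne' (hT k hk)
      subst hm0 hT0
      exact (mem_support_iff.1 hm) (h0 i)
    · have := koszulD_map (Finsupp.lapply i : (ι →₀ MvPolynomial (Fin n) K)
        →ₗ[MvPolynomial (Fin n) K] MvPolynomial (Fin n) K) c
      simp only [Finsupp.lapply_apply] at this
      rw [this]
      have h2 := hc.2
      rw [SetLike.mem_coe, LinearMap.mem_ker, koszulDK_apply] at h2
      rw [h2]; rfl
  choose b hb1 hb2 hb3 hb4 using key
  -- Only finitely many components of `c` are nonzero, and the solutions of the others were chosen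
  -- to be `0`.
  let U : Finset ι := Finset.univ.biUnion fun T => (c T).support
  have hU : ∀ T i, b i T ≠ 0 → i ∈ U := by
    intro T i hT
    by_contra hi
    apply hT
    rw [hb4 i, Pi.zero_apply]
    ext1 T'
    by_contra h
    exact hi (Finset.mem_biUnion.2 ⟨T', Finset.mem_univ _, Finsupp.mem_support_iff.2 h⟩)
  refine ⟨fun T => Finsupp.onFinset U (fun i => b i T) (hU T), ?_, ?_⟩
  · intro T
    constructor
    · rw [mem_pieceAt_freePiece]
      intro i m hm
      exact hb1 i T m hm
    · intro hT
      ext1 i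
      exact hb2 i T hT
  · rw [koszulDK_apply]
    ext1 T
    ext1 i
    have := koszulD_map (Finsupp.lapply i : (ι →₀ MvPolynomial (Fin n) K)
        →ₗ[MvPolynomial (Fin n) K] MvPolynomial (Fin n) K)
        (fun T => Finsupp.onFinset U (fun i => b i T) (hU T))
    have h2 := congrFun this T
    simp only [Finsupp.lapply_apply, Finsupp.onFinset_apply] at h2
    rw [← h2]
    exact congrFun (hb3 i) T

end KoszulFree

end SLInv
end

/-! ### Graded vector spaces and homogeneous lifts -/

noncomputable section
namespace SLInv

set_option linter.unusedSectionVars false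

section Graded

variable {K : Type*} [Field K] {n : ℕ}

/-- The vector space `M` is the direct sum of the subspaces `ℳ s`. -/
structure IsGrading {M : Type*} [AddCommGroup M] [Module K M] (ℳ : ℕ → Submodule K M) : Prop where
  exists_sum : ∀ x : M, ∃ (S : Finset ℕ) (g : ℕ → M), (∀ s, g s ∈ ℳ s) ∧ x = ∑ s ∈ S, g s
  eq_zero : ∀ (S : Finset ℕ) (g : ℕ → M), (∀ s, g s ∈ ℳ s) → ∑ s ∈ S, g s = 0 → ∀ s ∈ S, g s = 0

lemma IsGrading.eq_of_sum_eq {M : Type*} [AddCommGroup M] [Module K M] {ℳ : ℕ → Submodule K M}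
    (hℳ : IsGrading ℳ) {S : Finset ℕ} {g : ℕ → M} (hg : ∀ s, g s ∈ ℳ s) {j : ℕ} {x : M}
    (hx : x ∈ ℳ j) (h : ∑ s ∈ S, g s = x) : (if j ∈ S then g j else 0) = x := by
  classical
  let g' : ℕ → M := fun s => (if s ∈ S then g s else 0) - if s = j then x else 0
  have hg' : ∀ s, g' s ∈ ℳ s := by
    intro s
    refine sub_mem ?_ ?_
    · split_ifs
      exacts [hg s, zero_mem _]
    · split_ifs with hs
      · rw [hs]; exact hx
      · exact zero_mem _
  have := hℳ.eq_zero (insert j S) g' hg' (by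
    simp only [g', Finset.sum_sub_distrib]
    rw [Finset.sum_ite_eq' (insert j S) j (fun _ => x), if_pos (Finset.mem_insert_self _ _),
      ← h, sub_eq_zero, ← Finset.sum_filter]
    congr 1
    ext s; simp) j (Finset.mem_insert_self _ _)
  simpa [g', sub_eq_zero] using this

/-- A degree-preserving map commutes with homogeneous components, so the component of `x` in degree
`j` already has the image `φ x`. Every homogeneous lift below comes from here. -/
lemma IsGrading.exists_mem_of_map_mem {M N : Type*} [AddCommGroup M] [Module K M]
    [AddCommGroup N] [Module K N] {ℳ : ℕ → Submodule K M} {𝒩 : ℕ → Submodule K N}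
    (hℳ : IsGrading ℳ) (h𝒩 : IsGrading 𝒩) (φ : M →ₗ[K] N) (hφ : ∀ s, ∀ x ∈ ℳ s, φ x ∈ 𝒩 s)
    {j : ℕ} {x : M} (hx : φ x ∈ 𝒩 j) : ∃ y ∈ ℳ j, φ y = φ x := by
  obtain ⟨S, g, hg, rfl⟩ := hℳ.exists_sum x
  have h := h𝒩.eq_of_sum_eq (S := S) (g := fun s => φ (g s)) (fun s => hφ s _ (hg s)) hx
    (by simp)
  refine ⟨if j ∈ S then g j else 0, ?_, ?_⟩
  · split_ifs
    exacts [hg j, zero_mem _]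
  · rw [← h]; split_ifs <;> simp

lemma IsGrading.submodule {M : Type*} [AddCommGroup M] [Module K M] {ℳ : ℕ → Submodule K M}
    (hℳ : IsGrading ℳ) {R : Type*} [CommRing R] [Algebra K R] [Module R M] [IsScalarTower K R M]
    (N : Submodule R M)
    (hN : ∀ (S : Finset ℕ) (g : ℕ → M), (∀ s, g s ∈ ℳ s) → ∑ s ∈ S, g s ∈ N → ∀ s ∈ S, g s ∈ N) :
    IsGrading (fun s => (ℳ s).comap (N.subtype.restrictScalars K)) := by
  classical
  constructor
  · rintro ⟨x, hx⟩
    obtain ⟨S, g, hg, rfl⟩ := hℳ.exists_sum x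
    have h := hN S g hg hx
    refine ⟨S, fun s => if hs : s ∈ S then ⟨g s, h s hs⟩ else 0, ?_, ?_⟩
    · intro s
      dsimp only
      split_ifs
      · exact hg s
      · exact zero_mem _
    · ext1
      simp only [AddSubmonoidClass.coe_finsetSum]
      refine Finset.sum_congr rfl fun s hs => ?_
      rw [dif_pos hs]
  · intro S g hg h s hs
    have := hℳ.eq_zero S (fun s => (g s : M)) hg (by
      have := congrArg Subtype.val h
      simpa using this) s hs
    exact Subtype.ext this

lemma isGrading_freePiece {ι : Type*} (deg : Fin n → ℕ) (δ : ι → ℕ) :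
    IsGrading (freePiece (K := K) deg δ) := by
  classical
  constructor
  · intro x
    let S : Finset ℕ := x.support.biUnion fun i => (x i).support.image fun m =>
      Finsupp.weight deg m + δ i
    let g : ℕ → (ι →₀ MvPolynomial (Fin n) K) := fun s =>
      x.support.sum fun i => Finsupp.single i
        (if δ i ≤ s then weightedHomogeneousComponent deg (s - δ i) (x i) else 0)
    have hgi : ∀ s i, g s i
        = if δ i ≤ s then weightedHomogeneousComponent deg (s - δ i) (x i) else 0 := by
      intro s i
      simp only [g, Finsupp.finsetSum_apply, Finsupp.single_apply]
      rw [Finset.sum_ite_eq']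
      split_ifs with h h'
      · rfl
      · rfl
      · have : x i = 0 := by simpa using h
        simp [this]
      · rfl
    refine ⟨S, g, ?_, ?_⟩
    · intro s i m hm
      rw [hgi] at hm
      split_ifs at hm with h
      · have := weightedHomogeneousComponent_isWeightedHomogeneous (w := deg) (s - δ i) (x i)
          (mem_support_iff.1 hm)
        omega
      · simp at hm
    · ext i m
      rw [Finsupp.finsetSum_apply, coeff_sum]
      simp only [hgi]
      by_cases hm : coeff m (x i) = 0
      · rw [hm, Finset.sum_eq_zero]
        intro s _
        split_ifs
        · rw [coeff_weightedHomogeneousComponent, hm, ite_self]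
        · simp
      · have hmS : Finsupp.weight deg m + δ i ∈ S := by
          refine Finset.mem_biUnion.2 ⟨i, ?_, Finset.mem_image.2 ⟨m, mem_support_iff.2 hm, rfl⟩⟩
          rw [Finsupp.mem_support_iff]
          rintro h0
          rw [h0] at hm; simp at hm
        rw [Finset.sum_eq_single_of_mem _ hmS]
        · rw [if_pos (by omega), coeff_weightedHomogeneousComponent, if_pos (by omega)]
        · intro s _ hs
          split_ifs
          · rw [coeff_weightedHomogeneousComponent, if_neg (by omega)]
          · simp
  · intro S g hg h s hs
    ext i m
    by_contra hm
    have h1 := congrArg (fun x => coeff m (x i)) h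
    simp only [Finsupp.finsetSum_apply, coeff_sum, Finsupp.coe_zero, Pi.zero_apply,
      coeff_zero] at h1
    have hs' := hg s i m (mem_support_iff.2 hm)
    rw [Finset.sum_eq_single_of_mem s hs] at h1
    · exact hm h1
    · intro s' _ hne
      by_contra h2
      have := hg s' i m (mem_support_iff.2 h2)
      omega

end Graded

/-! ### Koszul homology in homological degree zero -/

section Betti

variable {K : Type*} [Field K] {n : ℕ}

lemma map_mem_of_mem_freePiece {ι : Type*} {M : Type*} [AddCommGroup M] [Module K M]
    [Module (MvPolynomial (Fin n) K) M] [IsScalarTower K (MvPolynomial (Fin n) K) M]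
    {deg : Fin n → ℕ} {δ : ι → ℕ} {ℳ : ℕ → Submodule K M} (hact : IsGradedAction deg ℳ)
    (φ : (ι →₀ MvPolynomial (Fin n) K) →ₗ[MvPolynomial (Fin n) K] M)
    (hφ : ∀ i, φ (Finsupp.single i 1) ∈ ℳ (δ i)) {j : ℕ} {x : ι →₀ MvPolynomial (Fin n) K}
    (hx : x ∈ freePiece deg δ j) : φ x ∈ ℳ j := by
  have hmon : ∀ (m : Fin n →₀ ℕ) (s : ℕ) (y : M), y ∈ ℳ s →
      (monomial m (1 : K)) • y ∈ ℳ (s + Finsupp.weight deg m) := by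
    intro m
    induction m using Finsupp.induction_linear with
    | zero =>
      intro s y hy
      rw [map_zero, add_zero]
      change (C (1 : K) : MvPolynomial (Fin n) K) • y ∈ _
      simpa using hy
    | add a b ha hb =>
      intro s y hy
      have h := ha _ _ (hb s y hy)
      rw [smul_smul, monomial_mul, one_mul] at h
      rw [map_add, add_comm (Finsupp.weight deg a), ← add_assoc]
      exact h
    | single k e =>
      induction e with
      | zero =>
        intro s y hy
        rw [Finsupp.single_zero, map_zero, add_zero]
        change (C (1 : K) : MvPolynomial (Fin n) K) • y ∈ _
        simpa using hy
      | succ e ih =>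
        intro s y hy
        have h := hact k _ _ (ih s y hy)
        rw [smul_smul, X, monomial_mul, one_mul, ← Finsupp.single_add, add_comm 1 e] at h
        rw [Finsupp.weight_single, smul_eq_mul] at h ⊢
        rwa [add_mul, one_mul, ← add_assoc]
  rw [← Finsupp.sum_single x, Finsupp.sum, map_sum]
  refine Submodule.sum_mem _ fun i _ => ?_
  rw [show Finsupp.single i (x i) = x i • Finsupp.single i (1 : MvPolynomial (Fin n) K) by simp,
    map_smul, as_sum (x i), Finset.sum_smul]
  refine Submodule.sum_mem _ fun m hm => ?_
  have h1 := hx i m hm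
  have h2 := hmon m _ _ (hφ i)
  rw [show monomial m (coeff m (x i)) = (coeff m (x i)) • monomial m (1 : K) by
    rw [smul_monomial, smul_eq_mul, mul_one], smul_assoc]
  rw [add_comm, h1] at h2
  exact Submodule.smul_mem _ _ h2

variable {M : Type*} [AddCommGroup M] [Module K M]
  [Module (MvPolynomial (Fin n) K) M] [IsScalarTower K (MvPolynomial (Fin n) K) M]

lemma single_mem_koszulChains {deg : Fin n → ℕ} {j : ℕ} {ℳ : ℕ → Submodule K M} {x : M}
    (hx : x ∈ ℳ j) : (Pi.single ∅ x : Finset (Fin n) → M) ∈ koszulChains deg ℳ 0 j := by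
  intro T
  by_cases hT : T = ∅
  · subst hT; simp [pieceAt, hx]
  · rw [Pi.single_eq_of_ne hT]
    exact ⟨zero_mem _, fun _ => rfl⟩

lemma koszulD_single_empty (x : M) :
    koszulD K M (Pi.single ∅ x : Finset (Fin n) → M) = 0 := by
  ext1 T
  rw [koszulD_apply, Finset.sum_eq_zero]
  · rfl
  · intro k _
    split_ifs
    · simp
    · rw [Pi.single_eq_of_ne (Finset.insert_ne_empty k T)]; simp

/-- `H_0` is the quotient by the variables. The kernel of a minimal cover lies in the maximal ideal
times the free module, so the quotient is the same as for the free module, where the generators of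
degree `j` form a basis. -/
lemma koszulDim_zero_map [CharZero K] {deg : Fin n → ℕ} (hdeg : ∀ k, 0 < deg k) (b : ℕ → ℕ)
    (φ : ((Σ j, Fin (b j)) →₀ MvPolynomial (Fin n) K) →ₗ[MvPolynomial (Fin n) K] M)
    (hφ : ∀ x, φ x = 0 → ∀ i, constantCoeff (x i) = 0) (j : ℕ) :
    koszulDim deg (fun s => (freePiece deg (fun i : Σ j, Fin (b j) => i.1) s).map
      (φ.restrictScalars K)) 0 j = b j := by
  classical
  set 𝓕 := freePiece (K := K) deg (fun i : Σ j, Fin (b j) => i.1) with h𝓕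
  set 𝓜 : ℕ → Submodule K M := fun s => (𝓕 s).map (φ.restrictScalars K) with h𝓜
  let Ψ : ((Σ j, Fin (b j)) →₀ MvPolynomial (Fin n) K) →ₗ[K] (Finset (Fin n) → M) :=
    (LinearMap.single K (fun _ => M) ∅) ∘ₗ (φ.restrictScalars K)
  let Ψ' : ((Σ j, Fin (b j)) →₀ MvPolynomial (Fin n) K) →ₗ[K] (Fin (b j) → K) :=
    { toFun := fun x a => constantCoeff (x ⟨j, a⟩)
      map_add' := fun x y => by ext a; simp
      map_smul' := fun r x => by ext a; simp [smul_eq_C_mul] }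
  have hΨ : ∀ x, Ψ x = Pi.single ∅ (φ x) := fun x => rfl
  have e1 := finrank_quotient_eq_of_surjective Ψ (𝓕 j) (koszulCycles deg 𝓜 0 j)
    (koszulBoundaries deg 𝓜 0 j)
    (fun x hx => ⟨single_mem_koszulChains ⟨x, hx, rfl⟩, koszulD_single_empty _⟩)
    (fun z hz => by
      have h1 := (hz.1 ∅).1
      simp only [pieceAt, Finset.sum_empty, zero_le, if_true, Nat.sub_zero] at h1
      obtain ⟨x, hx, hxz⟩ := h1
      refine ⟨x, hx, ?_⟩
      suffices z = Ψ x by rw [this, sub_self]; exact zero_mem _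
      ext1 T
      by_cases hT : T = ∅
      · subst hT; rw [hΨ, Pi.single_eq_same]; exact hxz.symm
      · rw [hΨ, Pi.single_eq_of_ne hT, (hz.1 T).2 (by simpa using hT)])
  have e2 := finrank_quotient_eq_of_surjective Ψ' (𝓕 j) ⊤ ⊥ (fun _ _ => trivial)
    (fun z _ => by
      refine ⟨∑ a, Finsupp.single ⟨j, a⟩ (C (z a)), ?_, ?_⟩
      · refine Submodule.sum_mem _ fun a _ => ?_
        intro i m hm
        rw [Finsupp.single_apply] at hm
        split_ifs at hm with hi
        · subst hi
          rw [mem_support_iff, coeff_C] at hm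
          split_ifs at hm with h0
          · subst h0; simp
          · exact absurd rfl hm
        · simp at hm
      · rw [Submodule.mem_bot, sub_eq_zero]
        funext a
        change z a = constantCoeff ((∑ a, Finsupp.single (⟨j, a⟩ : Σ j, Fin (b j)) (C (z a))) ⟨j, a⟩)
        rw [Finsupp.finsetSum_apply, map_sum, Finset.sum_eq_single a]
        · simp
        · intro a' _ hne
          rw [Finsupp.single_apply, if_neg (by simpa using hne), map_zero]
        · simp)
  rw [koszulDim, e1]
  -- An element becomes a boundary in the image exactly when its constant terms vanish. One
  -- direction is the minimality of `φ`, the other the acyclicity of the free module.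
  have e3 : ((koszulBoundaries deg 𝓜 0 j).comap Ψ).submoduleOf (𝓕 j)
      = ((⊥ : Submodule K (Fin (b j) → K)).comap Ψ').submoduleOf (𝓕 j) := by
    ext ⟨x, hx⟩
    simp only [Submodule.submoduleOf, Submodule.mem_comap, Submodule.subtype_apply,
      Submodule.mem_bot]
    constructor
    · rintro ⟨c, hc, hcx⟩
      have : ∀ T, ∃ y, φ y = c T := fun T => by
        have := (hc T).1
        rw [h𝓜, pieceAt_map] at this
        obtain ⟨y, _, hy⟩ := this
        exact ⟨y, hy⟩
      choose y hy using this
      have h1 : φ (koszulD K _ y ∅) = φ x := by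
        have := congrFun (koszulD_map φ y) ∅
        simp only [hy] at this
        rw [← this]
        have := congrFun hcx ∅
        rw [hΨ, Pi.single_eq_same] at this
        exact this
      have h2 := hφ (x - koszulD K _ y ∅) (by rw [map_sub, h1, sub_self])
      ext a
      have h3 := h2 ⟨j, a⟩
      rw [Finsupp.sub_apply, map_sub, koszulD_apply, Finsupp.finsetSum_apply, map_sum,
        Finset.sum_eq_zero, sub_zero] at h3
      · exact h3
      · intro k _
        simp
    · intro h0
      have h1 : ∀ i, constantCoeff (x i) = 0 := by
        rintro ⟨s, a⟩
        by_contra hne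
        have h2 := hx ⟨s, a⟩ 0 (mem_support_iff.2 hne)
        simp only [map_zero, zero_add] at h2
        subst h2
        exact hne (congrFun h0 a)
      obtain ⟨c, hc, hcx⟩ := koszul_acyclic_free (p := 0) (j := j) hdeg
        (c := Pi.single ∅ x) (δ := fun i : Σ j, Fin (b j) => i.1)
        ⟨single_mem_koszulChains hx, koszulD_single_empty x⟩ (by rw [Pi.single_eq_same]; exact h1)
      refine ⟨fun T => φ (c T), ?_, ?_⟩
      · intro T
        refine ⟨?_, fun hT => by dsimp only; rw [(hc T).2 hT, map_zero]⟩
        rw [h𝓜, pieceAt_map]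
        exact ⟨c T, (hc T).1, rfl⟩
      · rw [koszulDK_apply] at hcx ⊢
        rw [koszulD_map, hcx, hΨ]
        ext1 T
        by_cases hT : T = ∅
        · subst hT; simp
        · simp [Pi.single_eq_of_ne hT]
  rw [e3, ← e2, (Submodule.quotEquivOfEqBot _ (Submodule.ker_subtype _)).finrank_eq]
  simp

end Betti

end SLInv
end

/-! ### Betti numbers as dimensions of Koszul homology -/

noncomputable section
namespace SLInv

section Resolution

set_option linter.unusedSectionVars false

variable {K : Type*} [Field K] {n : ℕ} {M : Type*} [AddCommGroup M] [Module K M]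
  [Module (MvPolynomial (Fin n) K) M] [IsScalarTower K (MvPolynomial (Fin n) K) M]

/-- The degree `j` part of a term of a resolution. -/
abbrev termPiece (deg : Fin n → ℕ) (b : ℕ → ℕ) (j : ℕ) :
    Submodule K ((Σ j, Fin (b j)) →₀ MvPolynomial (Fin n) K) :=
  freePiece deg (fun i : Σ j, Fin (b j) => i.1) j

/-- In general `H_1` of the image is the kernel of the map from `H_0` of the kernel of `φ` to `H_0`
of the free module. Minimality makes that map zero, so the shift is already valid for `p = 0`. -/
lemma koszulDim_succ_free [CharZero K] {deg : Fin n → ℕ} (hdeg : ∀ k, 0 < deg k) {b : ℕ → ℕ}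
    (φ : ((Σ j, Fin (b j)) →₀ MvPolynomial (Fin n) K) →ₗ[MvPolynomial (Fin n) K] M)
    (hφ : ∀ x, φ x = 0 → ∀ i, constantCoeff (x i) = 0) (p j : ℕ) :
    koszulDim deg (fun s => (termPiece deg b s).map (φ.restrictScalars K)) (p + 1) j
      = koszulDim deg (fun s => termPiece deg b s ⊓ LinearMap.ker (φ.restrictScalars K)) p j := by
  apply koszulDim_succ_map (isGradedAction_freePiece _ _)
  · intro c hc
    apply koszul_acyclic_free hdeg hc
    intro i
    rw [(hc.1 ∅).2 (by simp)]; simp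
  · intro c hc
    have hc' : ∀ T, c T ∈ pieceAt (termPiece deg b) j (∑ k ∈ T, deg k) ⊓
        LinearMap.ker (φ.restrictScalars K) := by
      intro T
      have := (hc.1 T).1
      rwa [pieceAt_inf_ker] at this
    exact koszul_acyclic_free hdeg ⟨fun T => ⟨(hc' T).1, (hc.1 T).2⟩, hc.2⟩ (hφ _ (hc' ∅).2)

namespace MinimalGradedFreeResolution

variable {deg : Fin n → ℕ} {ℳ : ℕ → Submodule K M} {β : ℕ → ℕ → ℕ}

lemma constantCoeff_eq_zero_of_ε (r : MinimalGradedFreeResolution deg M ℳ β)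
    (x : FreeTerm K n β 0) (hx : r.ε x = 0) (i) : constantCoeff (x i) = 0 := by
  obtain ⟨y, rfl⟩ := (r.exact_zero x).1 hx
  exact r.minimal 0 y i

lemma constantCoeff_eq_zero_of_d (r : MinimalGradedFreeResolution deg M ℳ β) (k : ℕ)
    (x : FreeTerm K n β (k + 1)) (hx : r.d k x = 0) (i) : constantCoeff (x i) = 0 := by
  obtain ⟨y, rfl⟩ := (r.exact_succ k x).1 hx
  exact r.minimal (k + 1) y i

lemma d_mem (r : MinimalGradedFreeResolution deg M ℳ β) (k s : ℕ) (x : FreeTerm K n β (k + 1))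
    (hx : x ∈ termPiece deg (β (k + 1)) s) : r.d k x ∈ termPiece deg (β k) s :=
  map_mem_of_mem_freePiece (isGradedAction_freePiece _ _) (r.d k) (fun b c => r.d_graded k b c) hx

lemma map_ε (r : MinimalGradedFreeResolution deg M ℳ β) (hℳ : IsGrading ℳ)
    (hact : IsGradedAction deg ℳ) (s : ℕ) :
    (termPiece deg (β 0) s).map (r.ε.restrictScalars K) = ℳ s := by
  have h : ∀ s, ∀ x ∈ termPiece deg (β 0) s, r.ε x ∈ ℳ s := fun s x hx =>
    map_mem_of_mem_freePiece hact r.ε r.ε_graded hx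
  ext y
  constructor
  · rintro ⟨x, hx, rfl⟩
    exact h s x hx
  · intro hy
    obtain ⟨x, rfl⟩ := r.surjective y
    exact IsGrading.exists_mem_of_map_mem (isGrading_freePiece _ _) hℳ (r.ε.restrictScalars K) h hy

lemma map_d (r : MinimalGradedFreeResolution deg M ℳ β) (k s : ℕ) :
    (termPiece deg (β (k + 1)) s).map ((r.d k).restrictScalars K)
      = termPiece deg (β k) s ⊓ (LinearMap.range (r.d k)).restrictScalars K := by
  ext y
  constructor
  · rintro ⟨x, hx, rfl⟩
    exact ⟨r.d_mem k s x hx, ⟨x, rfl⟩⟩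
  · rintro ⟨hy, ⟨x, rfl⟩⟩
    exact IsGrading.exists_mem_of_map_mem (isGrading_freePiece _ _) (isGrading_freePiece _ _)
      ((r.d k).restrictScalars K) (r.d_mem k) hy

/-- The graded Betti numbers are the dimensions of the Koszul homology. -/
theorem betti_eq_koszulDim [CharZero K] (hdeg : ∀ k, 0 < deg k) (hℳ : IsGrading ℳ)
    (hact : IsGradedAction deg ℳ) (r : MinimalGradedFreeResolution deg M ℳ β) (i j : ℕ) :
    β i j = koszulDim deg ℳ i j := by
  have hε : (fun s => (termPiece deg (β 0) s).map (r.ε.restrictScalars K)) = ℳ :=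
    funext fun s => r.map_ε hℳ hact s
  -- The kernel of each map is the image of the next, so every dimension shift passes to the next
  -- syzygy module, again the image of a free module under a minimal cover.
  have h0 : ∀ p, koszulDim deg ℳ (p + 1) j =
      koszulDim deg (fun s => (termPiece deg (β 1) s).map ((r.d 0).restrictScalars K)) p j := by
    intro p
    conv_lhs => rw [← hε]
    rw [koszulDim_succ_free hdeg r.ε r.constantCoeff_eq_zero_of_ε]
    congr 1
    funext s
    rw [r.map_d]
    congr 1
    ext x
    exact r.exact_zero x
  have h1 : ∀ k p, koszulDim deg
        (fun s => (termPiece deg (β (k + 1)) s).map ((r.d k).restrictScalars K)) (p + 1) j =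
      koszulDim deg
        (fun s => (termPiece deg (β (k + 2)) s).map ((r.d (k + 1)).restrictScalars K)) p j := by
    intro k p
    rw [koszulDim_succ_free hdeg (r.d k) (r.constantCoeff_eq_zero_of_d k)]
    congr 1
    funext s
    rw [r.map_d]
    congr 1
    ext x
    exact r.exact_succ k x
  have h2 : ∀ k p, koszulDim deg ℳ (p + k + 1) j = koszulDim deg
      (fun s => (termPiece deg (β (k + 1)) s).map ((r.d k).restrictScalars K)) p j := by
    intro k
    induction k with
    | zero => intro p; exact h0 p
    | succ k ih => intro p; rw [← h1, ← ih]; congr 1; omega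
  cases i with
  | zero =>
    conv_rhs => rw [← hε]
    rw [koszulDim_zero_map hdeg (β 0) r.ε r.constantCoeff_eq_zero_of_ε]
  | succ i =>
    have := h2 i 0
    rw [Nat.zero_add] at this
    rw [this, koszulDim_zero_map hdeg (β (i + 1)) (r.d i) (r.constantCoeff_eq_zero_of_d i)]

end MinimalGradedFreeResolution

/-! ### Existence of minimal graded free resolutions -/

/-- This is acyclicity of the Koszul complex in homological degree `0`, read off at `∅`. -/
lemma exists_eq_sum_X_smul [CharZero K] {ι : Type*} {deg : Fin n → ℕ} (hdeg : ∀ k, 0 < deg k)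
    {δ : ι → ℕ} {s : ℕ} {x : ι →₀ MvPolynomial (Fin n) K} (hx : x ∈ freePiece deg δ s)
    (h0 : ∀ i, constantCoeff (x i) = 0) :
    ∃ y : Fin n → (ι →₀ MvPolynomial (Fin n) K),
      (∀ k, y k ∈ pieceAt (freePiece deg δ) s (deg k)) ∧
      x = ∑ k, (X k : MvPolynomial (Fin n) K) • y k := by
  obtain ⟨c, hc, hcx⟩ := koszul_acyclic_free (p := 0) (j := s) hdeg
    (c := Pi.single ∅ x) (δ := δ) ⟨single_mem_koszulChains hx, koszulD_single_empty x⟩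
    (by rw [Pi.single_eq_same]; exact h0)
  refine ⟨fun k => koszulSign k ∅ • c {k}, ?_, ?_⟩
  · intro k
    refine zsmul_mem ?_ _
    simpa using (hc {k}).1
  · have := congrFun hcx ∅
    rw [koszulDK_apply, Pi.single_eq_same, koszulD_apply] at this
    rw [← this]
    simp

/-- `hind` says that the images of the generators are independent modulo decomposables. The constant
part `x0` of a homogeneous relation `x` differs from `x` by an element of the maximal ideal times
the free module. So `φ x0` is decomposable, and the coefficients of `x0` vanish. -/
lemma constantCoeff_eq_zero_of_cover [CharZero K] {deg : Fin n → ℕ} (hdeg : ∀ k, 0 < deg k)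
    {ℳ : ℕ → Submodule K M} (hℳ : IsGrading ℳ) (hact : IsGradedAction deg ℳ) {b : ℕ → ℕ}
    (φ : ((Σ j, Fin (b j)) →₀ MvPolynomial (Fin n) K) →ₗ[MvPolynomial (Fin n) K] M)
    (hφ : ∀ i, φ (Finsupp.single i 1) ∈ ℳ i.1)
    (hind : ∀ (s : ℕ) (c : Fin (b s) → K) (y : Fin n → M), (∀ k, y k ∈ pieceAt ℳ s (deg k)) →
      ∑ a, c a • φ (Finsupp.single ⟨s, a⟩ 1) = ∑ k, (X k : MvPolynomial (Fin n) K) • y k → c = 0)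
    {x : (Σ j, Fin (b j)) →₀ MvPolynomial (Fin n) K} (hx : φ x = 0) (i : Σ j, Fin (b j)) :
    constantCoeff (x i) = 0 := by
  classical
  have hφ' : ∀ s, ∀ x ∈ termPiece deg b s, φ x ∈ ℳ s := fun s x hx =>
    map_mem_of_mem_freePiece hact φ hφ hx
  have key : ∀ s, ∀ x ∈ termPiece (K := K) deg b s, φ x = 0 → ∀ i, constantCoeff (x i) = 0 := by
    intro s x hx h0
    let c : Fin (b s) → K := fun a => constantCoeff (x ⟨s, a⟩)
    let x0 : (Σ j, Fin (b j)) →₀ MvPolynomial (Fin n) K :=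
      ∑ a, c a • Finsupp.single (⟨s, a⟩ : Σ j, Fin (b j)) 1
    have hx0 : ∀ a, constantCoeff (x0 ⟨s, a⟩) = c a := by
      intro a
      simp only [x0]
      rw [Finsupp.finsetSum_apply, map_sum, Finset.sum_eq_single a]
      · simp [smul_eq_C_mul]
      · intro a' _ hne
        rw [Finsupp.smul_apply, Finsupp.single_apply, if_neg (by simpa using hne)]; simp
      · simp
    have hx0s : x0 ∈ termPiece deg b s := by
      refine Submodule.sum_mem _ fun a _ => Submodule.smul_mem _ _ ?_
      intro i m hm
      rw [Finsupp.single_apply] at hm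
      split_ifs at hm with hi
      · subst hi
        rw [mem_support_iff, coeff_one] at hm
        split_ifs at hm with h0
        · subst h0; simp
        · exact absurd rfl hm
      · simp at hm
    have hzero : ∀ y ∈ termPiece (K := K) deg b s, (∀ a, constantCoeff (y ⟨s, a⟩) = 0) →
        ∀ i, constantCoeff (y i) = 0 := by
      rintro y hy h ⟨t, a⟩
      by_contra hne
      have h2 := hy ⟨t, a⟩ 0 (mem_support_iff.2 hne)
      simp only [map_zero, zero_add] at h2
      subst h2
      exact hne (h a)
    obtain ⟨y, hy, hxy⟩ := exists_eq_sum_X_smul hdeg (sub_mem hx0s hx)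
      (hzero _ (sub_mem hx0s hx) fun a => by rw [Finsupp.sub_apply, map_sub, hx0, sub_self])
    have hc := hind s c (fun k => φ (y k)) (fun k => by
      have := hy k
      unfold pieceAt at this ⊢
      split_ifs with h
      · rw [if_pos h] at this; exact hφ' _ _ this
      · rw [if_neg h, Submodule.mem_bot] at this
        rw [this, map_zero]; exact zero_mem _) (by
      have : φ x0 = ∑ k, (X k : MvPolynomial (Fin n) K) • φ (y k) := by
        rw [← sub_zero (φ x0), ← h0, ← map_sub, hxy, map_sum]
        simp only [map_smul]
      rw [← this]
      simp only [x0, map_sum]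
      refine Finset.sum_congr rfl fun a _ => ?_
      exact ((φ.restrictScalars K).map_smul _ _).symm)
    exact hzero x hx fun a => congrFun hc a
  obtain ⟨S, g, hg, rfl⟩ := (isGrading_freePiece deg (fun i : Σ j, Fin (b j) => i.1)).exists_sum x
  have h1 := hℳ.eq_zero S (fun s => φ (g s)) (fun s => hφ' s _ (hg s)) (by rw [← map_sum, hx])
  rw [Finsupp.finsetSum_apply, map_sum]
  exact Finset.sum_eq_zero fun s hs => key s _ (hg s) (h1 s hs) i

/-- Every graded module with finite-dimensional pieces has a minimal graded free cover. -/
lemma exists_minimal_cover [CharZero K] {deg : Fin n → ℕ} (hdeg : ∀ k, 0 < deg k)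
    {ℳ : ℕ → Submodule K M} (hℳ : IsGrading ℳ) (hact : IsGradedAction deg ℳ)
    (hfin : ∀ s, FiniteDimensional K (ℳ s)) :
    ∃ (b : ℕ → ℕ) (φ : ((Σ j, Fin (b j)) →₀ MvPolynomial (Fin n) K)
      →ₗ[MvPolynomial (Fin n) K] M), Function.Surjective φ ∧
      (∀ i, φ (Finsupp.single i 1) ∈ ℳ i.1) ∧
      ∀ x, φ x = 0 → ∀ i, constantCoeff (x i) = 0 := by
  classical
  -- The decomposable elements of degree `s`. The generators are chosen as a basis of a complement
  -- `W s`.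
  let 𝔪 : ∀ s, Submodule K (ℳ s) := fun s =>
    { carrier := {x | ∃ y : Fin n → M, (∀ k, y k ∈ pieceAt ℳ s (deg k)) ∧
        (x : M) = ∑ k, (X k : MvPolynomial (Fin n) K) • y k}
      add_mem' := by
        rintro x x' ⟨y, hy, h⟩ ⟨y', hy', h'⟩
        exact ⟨y + y', fun k => add_mem (hy k) (hy' k), by
          simp [h, h', smul_add, Finset.sum_add_distrib]⟩
      zero_mem' := ⟨0, fun k => zero_mem _, by simp⟩
      smul_mem' := by
        rintro c x ⟨y, hy, h⟩
        exact ⟨c • y, fun k => Submodule.smul_mem _ _ (hy k), by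
          simp only [Submodule.coe_smul, h, Finset.smul_sum, Pi.smul_apply]
          exact Finset.sum_congr rfl fun k _ => smul_comm _ _ _⟩ }
  have hW : ∀ s, ∃ W : Submodule K (ℳ s), IsCompl (𝔪 s) W := fun s => exists_isCompl _
  choose W hW using hW
  let b : ℕ → ℕ := fun s => Module.finrank K (W s)
  let w : (Σ j, Fin (b j)) → M := fun i => ((Module.finBasis K (W i.1) i.2 : W i.1) : ℳ i.1)
  let φ : ((Σ j, Fin (b j)) →₀ MvPolynomial (Fin n) K) →ₗ[MvPolynomial (Fin n) K] M :=
    Finsupp.linearCombination _ w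
  have hφ1 : ∀ i, φ (Finsupp.single i 1) = w i := fun i => by simp [φ]
  have hφ2 : ∀ i, φ (Finsupp.single i 1) ∈ ℳ i.1 := fun i => by
    rw [hφ1]; exact Submodule.coe_mem _
  refine ⟨b, φ, ?_, hφ2, ?_⟩
  -- Graded Nakayama lemma: all variables have positive degree, so decomposables are combinations of
  -- elements of smaller degree.
  · have key : ∀ s, ∀ x ∈ ℳ s, x ∈ LinearMap.range φ := by
      intro s
      induction s using Nat.strong_induction_on with
      | _ s ih =>
        intro x hx
        have htop : (⟨x, hx⟩ : ℳ s) ∈ 𝔪 s ⊔ W s := by rw [(hW s).sup_eq_top]; trivial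
        obtain ⟨u, ⟨y, hy, huy⟩, v, hv, huv⟩ := Submodule.mem_sup.1 htop
        have : x = u + v := (congrArg Subtype.val huv).symm
        rw [this]
        refine add_mem ?_ ?_
        · rw [huy]
          refine Submodule.sum_mem _ fun k _ => Submodule.smul_mem _ _ ?_
          have hk := hy k
          unfold pieceAt at hk
          split_ifs at hk with h
          · exact ih _ (by have := hdeg k; omega) _ hk
          · rw [(Submodule.mem_bot K).1 hk]; exact zero_mem _
        · have h1 := (Module.finBasis K (W s)).sum_repr ⟨v, hv⟩
          have h2 : (v : M) = ∑ a, (Module.finBasis K (W s)).repr ⟨v, hv⟩ a • w ⟨s, a⟩ := by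
            have := congrArg (fun z : W s => ((z : ℳ s) : M)) h1
            simp only [Submodule.coe_sum, Submodule.coe_smul] at this
            exact this.symm
          rw [h2]
          refine Submodule.sum_mem _ fun a _ => ?_
          rw [← hφ1, ← algebraMap_smul (MvPolynomial (Fin n) K)]
          exact Submodule.smul_mem _ _ ⟨_, rfl⟩
    intro x
    obtain ⟨S, g, hg, rfl⟩ := hℳ.exists_sum x
    exact Submodule.sum_mem _ fun s _ => key s _ (hg s)
  · intro x hx
    refine constantCoeff_eq_zero_of_cover hdeg hℳ hact φ hφ2 ?_ hx
    intro s c y hy hc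
    simp only [hφ1] at hc
    let v : W s := ∑ a, c a • Module.finBasis K (W s) a
    have hv : ((v : ℳ s) : M) = ∑ a, c a • w ⟨s, a⟩ := by
      simp only [v, Submodule.coe_sum, Submodule.coe_smul]; rfl
    have h1 : (v : ℳ s) ∈ 𝔪 s := ⟨y, hy, by rw [hv, hc]⟩
    have h2 : (v : ℳ s) = 0 := by
      have := (hW s).disjoint.le_bot ⟨h1, v.2⟩
      simpa using this
    have h3 : v = 0 := Subtype.ext h2
    have h4 := Fintype.linearIndependent_iff.1 (Module.finBasis K (W s)).linearIndependent c h3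
    exact funext h4

/-- The free module may have infinite rank, but an element of degree `s` involves only the finitely
many basis vectors of degree at most `s`. -/
lemma finiteDimensional_termPiece {deg : Fin n → ℕ} (hdeg : ∀ k, 0 < deg k) (b : ℕ → ℕ) (s : ℕ) :
    FiniteDimensional K (termPiece (K := K) deg b s) := by
  have : ∀ t, Module.Finite K (weightedHomogeneousSubmodule K deg t) := fun t =>
    Module.Finite.iff_fg.2 (weightedHomogeneousSubmodule_fg K deg (fun k => (hdeg k).ne') t)
  let Φ : termPiece (K := K) deg b s →ₗ[K]
      ((i : Σ j : Fin (s + 1), Fin (b j)) → weightedHomogeneousSubmodule K deg (s - i.1)) :=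
    { toFun := fun x i => ⟨(x : (Σ j, Fin (b j)) →₀ MvPolynomial (Fin n) K) ⟨i.1, i.2⟩, by
        intro m hm
        have := x.2 ⟨i.1, i.2⟩ m (mem_support_iff.2 hm)
        dsimp only at this
        omega⟩
      map_add' := fun x y => rfl
      map_smul' := fun r x => rfl }
  refine Module.Finite.of_injective Φ ?_
  intro x y hxy
  ext1
  ext1 ⟨j, a⟩
  by_cases hj : j ≤ s
  · exact congrArg Subtype.val (congrFun hxy ⟨⟨j, by omega⟩, a⟩)
  · have key : ∀ z : termPiece (K := K) deg b s,
        (z : (Σ j, Fin (b j)) →₀ MvPolynomial (Fin n) K) ⟨j, a⟩ = 0 := by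
      intro z
      by_contra hne
      obtain ⟨m, hm⟩ := support_nonempty.2 hne
      have := z.2 ⟨j, a⟩ m hm
      dsimp only at this
      omega
    rw [key, key]

/-- A submodule of a graded module over a ring that contains the homogeneous parts of its
elements. -/
def IsHomogeneousSubmodule {R : Type*} [Semiring R] [Module R M] (ℳ : ℕ → Submodule K M)
    (N : Submodule R M) : Prop :=
  ∀ (S : Finset ℕ) (g : ℕ → M), (∀ s, g s ∈ ℳ s) → ∑ s ∈ S, g s ∈ N → ∀ s ∈ S, g s ∈ N

lemma finiteDimensional_comap {V W : Type*} [AddCommGroup V] [Module K V] [AddCommGroup W]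
    [Module K W] (f : V →ₗ[K] W) (hf : Function.Injective f) (p : Submodule K W)
    [FiniteDimensional K p] : FiniteDimensional K (p.comap f) := by
  refine Module.Finite.of_injective (f.restrict (p := p.comap f) (q := p) fun x hx => hx) ?_
  intro x y hxy
  exact Subtype.ext (hf (congrArg Subtype.val hxy))

lemma IsGradedAction.submodule {deg : Fin n → ℕ} {ℳ : ℕ → Submodule K M}
    (hact : IsGradedAction deg ℳ) (N : Submodule (MvPolynomial (Fin n) K) M) :
    IsGradedAction deg fun s => (ℳ s).comap (N.subtype.restrictScalars K) :=
  fun k s x hx => hact k s (x : M) hx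

lemma isHomogeneousSubmodule_ker {deg : Fin n → ℕ} {ℳ : ℕ → Submodule K M} {b : ℕ → ℕ}
    (φ : ((Σ j, Fin (b j)) →₀ MvPolynomial (Fin n) K) →ₗ[MvPolynomial (Fin n) K] M)
    (hℳ : IsGrading ℳ) (hact : IsGradedAction deg ℳ)
    (hφ : ∀ i, φ (Finsupp.single i 1) ∈ ℳ i.1) :
    IsHomogeneousSubmodule (termPiece (K := K) deg b) (LinearMap.ker φ) := by
  intro S g hg h s hs
  rw [LinearMap.mem_ker, map_sum] at h
  exact hℳ.eq_zero S (fun s => φ (g s)) (fun s => map_mem_of_mem_freePiece hact φ hφ (hg s)) h s hs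

lemma exists_minimal_cover_submodule [CharZero K] {deg : Fin n → ℕ} (hdeg : ∀ k, 0 < deg k)
    {ℳ : ℕ → Submodule K M} (hℳ : IsGrading ℳ) (hact : IsGradedAction deg ℳ)
    (hfin : ∀ s, FiniteDimensional K (ℳ s)) (N : Submodule (MvPolynomial (Fin n) K) M)
    (hN : IsHomogeneousSubmodule ℳ N) :
    ∃ (b : ℕ → ℕ) (φ : ((Σ j, Fin (b j)) →₀ MvPolynomial (Fin n) K)
      →ₗ[MvPolynomial (Fin n) K] M), LinearMap.range φ = N ∧
      (∀ i, φ (Finsupp.single i 1) ∈ ℳ i.1) ∧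
      ∀ x, φ x = 0 → ∀ i, constantCoeff (x i) = 0 := by
  obtain ⟨b, φ, hφ1, hφ2, hφ3⟩ := exists_minimal_cover hdeg (hℳ.submodule N hN)
    (hact.submodule N) (fun s =>
      finiteDimensional_comap (N.subtype.restrictScalars K) (fun x y h => Subtype.ext h) (ℳ s))
  refine ⟨b, N.subtype ∘ₗ φ, ?_, hφ2, ?_⟩
  · rw [LinearMap.range_comp, LinearMap.range_eq_top.2 hφ1, Submodule.map_top,
      Submodule.range_subtype]
  · intro x hx
    exact hφ3 x (Subtype.ext hx)

/-- A possible module of syzygies in a minimal graded free resolution. -/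
structure SyzygyModule (K : Type*) [Field K] {n : ℕ} (deg : Fin n → ℕ) where
  /-- The numbers of generators of the ambient free module. -/
  b : ℕ → ℕ
  /-- The module of syzygies. -/
  N : Submodule (MvPolynomial (Fin n) K) ((Σ j, Fin (b j)) →₀ MvPolynomial (Fin n) K)
  homogeneous : IsHomogeneousSubmodule (termPiece (K := K) deg b) N
  minimal : ∀ x ∈ N, ∀ i, constantCoeff (x i) = 0

lemma SyzygyModule.exists_next [CharZero K] {deg : Fin n → ℕ} (hdeg : ∀ k, 0 < deg k)
    (Z : SyzygyModule K deg) :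
    ∃ (Z' : SyzygyModule K deg) (d : ((Σ j, Fin (Z'.b j)) →₀ MvPolynomial (Fin n) K)
      →ₗ[MvPolynomial (Fin n) K] ((Σ j, Fin (Z.b j)) →₀ MvPolynomial (Fin n) K)),
      LinearMap.range d = Z.N ∧ LinearMap.ker d = Z'.N ∧
      ∀ i, d (Finsupp.single i 1) ∈ termPiece deg Z.b i.1 := by
  obtain ⟨b, φ, hφ1, hφ2, hφ3⟩ := exists_minimal_cover_submodule hdeg
    (isGrading_freePiece (K := K) deg (fun i : Σ j, Fin (Z.b j) => i.1))
    (isGradedAction_freePiece _ _) (finiteDimensional_termPiece (K := K) hdeg Z.b) Z.N Z.homogeneous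
  exact ⟨⟨b, LinearMap.ker φ, isHomogeneousSubmodule_ker φ (isGrading_freePiece _ _)
    (isGradedAction_freePiece _ _) hφ2, hφ3⟩, φ, hφ1, rfl, hφ2⟩

/-- Every graded module with finite-dimensional pieces over a positively graded polynomial ring has
a minimal graded free resolution. -/
theorem exists_minimalGradedFreeResolution [CharZero K] {deg : Fin n → ℕ} (hdeg : ∀ k, 0 < deg k)
    {ℳ : ℕ → Submodule K M} (hℳ : IsGrading ℳ) (hact : IsGradedAction deg ℳ)
    (hfin : ∀ s, FiniteDimensional K (ℳ s)) :
    ∃ β, Nonempty (MinimalGradedFreeResolution deg M ℳ β) := by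
  obtain ⟨b, φ, hφ1, hφ2, hφ3⟩ := exists_minimal_cover hdeg hℳ hact hfin
  choose next d hd1 hd2 hd3 using SyzygyModule.exists_next (K := K) (n := n) hdeg
  -- The ambient free module changes at every stage, so the recursion runs over syzygy modules
  -- bundled with it.
  let Z : ℕ → SyzygyModule K deg := fun i => Nat.rec
    ⟨b, LinearMap.ker φ, isHomogeneousSubmodule_ker φ hℳ hact hφ2, fun x hx => hφ3 x hx⟩
    (fun _ Y => next Y) i
  refine ⟨fun i => (Z i).b, ⟨
    { d := fun i => d (Z i)
      ε := φ
      surjective := hφ1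
      exact_zero := fun x => ?_
      exact_succ := fun i x => ?_
      ε_graded := hφ2
      d_graded := fun i b c p hp => hd3 (Z i) b c p hp
      minimal := fun i x c => (Z i).minimal _ (by rw [← hd1]; exact ⟨x, rfl⟩) c }⟩⟩
  · exact (SetLike.ext_iff.1 (hd1 (Z 0)) x).symm
  · exact (SetLike.ext_iff.1 ((hd2 (Z i)).trans (hd1 (Z (i + 1))).symm) x)

end Resolution

end SLInv
end

/-! ### Koszul homology of the Artinian reduction -/

noncomputable section
namespace SLInv

section Artinian

set_option linter.unusedSectionVars false

/-- The degrees of the eight generators of the Artinian reduction. -/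
def artDeg (k : Fin 8) : ℕ := if (k : ℕ) < 4 then 4 else 6

/-- The degrees of the basis `1`, `v_k`, `σ` of the Artinian reduction, with indices `inr false`,
`inl k`, `inr true`. -/
def basisDeg : Fin 8 ⊕ Bool → ℕ
  | Sum.inl k => artDeg k
  | Sum.inr false => 0
  | Sum.inr true => 10

/-- The pairing `k ↔ 7 - k` matches a generator of degree `4` with one of degree `6`, so its values
have the socle degree. -/
lemma artDeg_add_rev (k : Fin 8) : artDeg k + artDeg (Fin.rev k) = 10 := by
  revert k; decide

/-- The number of sets of `p` of the eight generators of total degree `j - e`. -/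
def degCount (p e j : ℕ) : ℕ :=
  (Finset.univ.filter fun T : Finset (Fin 8) => T.card = p ∧ ∑ k ∈ T, artDeg k + e = j).card

variable {K : Type*} [Field K]

lemma finrank_supported {Q : Type*} [Fintype Q] [DecidableEq Q] (Y : Finset Q)
    (S : Submodule K (Q → K)) (hS : ∀ f, f ∈ S ↔ ∀ q ∉ Y, f q = 0) :
    Module.finrank K S = Y.card := by
  let e : S ≃ₗ[K] (Y → K) :=
    { toFun := fun f q => f.1 q.1
      map_add' := fun f g => rfl
      map_smul' := fun r f => rfl
      invFun := fun g => ⟨fun q => if h : q ∈ Y then g ⟨q, h⟩ else 0, by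
        rw [hS]; intro q hq; rw [dif_neg hq]⟩
      left_inv := by
        rintro ⟨f, hf⟩
        ext q
        dsimp only
        split_ifs with h
        · rfl
        · exact ((hS f).1 hf q h).symm
      right_inv := by
        intro g
        ext q
        simp [q.2] }
  rw [e.finrank_eq]; simp

variable {N : Type*} [AddCommGroup N] [Module K N] [Module (MvPolynomial (Fin 8) K) N]
  [IsScalarTower K (MvPolynomial (Fin 8) K) N]

/-- The Artinian graded algebra with basis `1`, `v_k`, `σ` in which `v_k v_l` is `σ` if
`k + l = 7` and `0` otherwise, as a module over the polynomial ring in the `v_k`. -/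
structure IsArtinianReduction (bas : Module.Basis (Fin 8 ⊕ Bool) K N)
    (𝒩 : ℕ → Submodule K N) : Prop where
  smul_one : ∀ k, (X k : MvPolynomial (Fin 8) K) • bas (Sum.inr false) = bas (Sum.inl k)
  smul_gen : ∀ k l, (X k : MvPolynomial (Fin 8) K) • bas (Sum.inl l)
    = if l = Fin.rev k then bas (Sum.inr true) else 0
  smul_socle : ∀ k, (X k : MvPolynomial (Fin 8) K) • bas (Sum.inr true) = 0
  mem_piece : ∀ s x, x ∈ 𝒩 s ↔ ∀ e, basisDeg e ≠ s → bas.repr x e = 0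

namespace IsArtinianReduction

variable {bas : Module.Basis (Fin 8 ⊕ Bool) K N} {𝒩 : ℕ → Submodule K N}

lemma repr_smul (h : IsArtinianReduction bas 𝒩) (k : Fin 8) (x : N) :
    bas.repr ((X k : MvPolynomial (Fin 8) K) • x) (Sum.inr false) = 0 ∧
    (∀ l, bas.repr ((X k : MvPolynomial (Fin 8) K) • x) (Sum.inl l)
      = if l = k then bas.repr x (Sum.inr false) else 0) ∧
    bas.repr ((X k : MvPolynomial (Fin 8) K) • x) (Sum.inr true)
      = bas.repr x (Sum.inl (Fin.rev k)) := by
  have hx : (X k : MvPolynomial (Fin 8) K) • x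
      = bas.repr x (Sum.inr false) • bas (Sum.inl k)
        + bas.repr x (Sum.inl (Fin.rev k)) • bas (Sum.inr true) := by
    conv_lhs => rw [← bas.sum_repr x]
    rw [Finset.smul_sum, Fintype.sum_sum_type, Fintype.sum_bool]
    simp only [smul_comm (X k : MvPolynomial (Fin 8) K) (_ : K) (_ : N), h.smul_one, h.smul_gen,
      h.smul_socle, smul_zero, zero_add, smul_ite, Finset.sum_ite_eq', Finset.mem_univ, if_true]
    rw [add_comm]
  refine ⟨?_, fun l => ?_, ?_⟩
  · rw [hx]; simp
  · rw [hx]; simp [Finsupp.single_apply, eq_comm]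
  · rw [hx]; simp

lemma repr_koszulD_one (h : IsArtinianReduction bas 𝒩) (c : Finset (Fin 8) → N)
    (T : Finset (Fin 8)) : bas.repr (koszulD K N c T) (Sum.inr false) = 0 := by
  rw [koszulD_apply, map_sum, Finsupp.finsetSum_apply]
  exact Finset.sum_eq_zero fun k _ => (h.repr_smul k _).1

lemma repr_koszulD_gen (h : IsArtinianReduction bas 𝒩) (c : Finset (Fin 8) → N)
    (T : Finset (Fin 8)) (l : Fin 8) : bas.repr (koszulD K N c T) (Sum.inl l) =
      if l ∈ T then 0 else koszulSign l T • bas.repr (c (insert l T)) (Sum.inr false) := by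
  rw [koszulD_apply, map_sum, Finsupp.finsetSum_apply]
  simp only [fun k x => (h.repr_smul k x).2.1 l, Finset.sum_ite_eq, Finset.mem_univ, if_true]
  split_ifs <;> simp

lemma repr_koszulD_socle (h : IsArtinianReduction bas 𝒩) (c : Finset (Fin 8) → N)
    (T : Finset (Fin 8)) : bas.repr (koszulD K N c T) (Sum.inr true) =
      ∑ k, if k ∈ T then 0 else koszulSign k T • bas.repr (c (insert k T)) (Sum.inl k.rev) := by
  rw [koszulD_apply, map_sum, Finsupp.finsetSum_apply]
  refine Finset.sum_congr rfl fun k _ => ?_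
  rw [(h.repr_smul k _).2.2]
  split_ifs <;> simp

/-- Koszul chains in coordinates. -/
def coordEquiv (bas : Module.Basis (Fin 8 ⊕ Bool) K N) :
    (Finset (Fin 8) → N) ≃ₗ[K] (Finset (Fin 8) × (Fin 8 ⊕ Bool) → K) where
  toFun c q := bas.repr (c q.1) q.2
  map_add' c c' := by ext; simp
  map_smul' r c := by ext; simp
  invFun f T := ∑ e, f (T, e) • bas e
  left_inv c := by ext1 T; exact bas.sum_repr (c T)
  right_inv f := by
    ext ⟨T, e⟩
    exact congrFun (bas.repr_sum_self fun e => f (T, e)) e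

lemma mem_koszulChains_iff (h : IsArtinianReduction bas 𝒩) {p j : ℕ} {c : Finset (Fin 8) → N} :
    c ∈ koszulChains artDeg 𝒩 p j ↔ ∀ T e, ¬ (T.card = p ∧ ∑ k ∈ T, artDeg k + basisDeg e = j) →
      bas.repr (c T) e = 0 := by
  constructor
  · intro hc T e he
    by_cases hT : T.card = p
    · have h1 := (hc T).1
      unfold pieceAt at h1
      split_ifs at h1 with h2
      · exact (h.mem_piece _ _).1 h1 e (fun h3 => he ⟨hT, by omega⟩)
      · rw [(Submodule.mem_bot K).1 h1]; simp
    · rw [(hc T).2 hT]; simp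
  · intro hc T
    constructor
    · unfold pieceAt
      split_ifs with h2
      · exact (h.mem_piece _ _).2 fun e he => hc T e fun h3 => he (by omega)
      · rw [Submodule.mem_bot]
        apply bas.repr.injective
        ext e
        simpa using hc T e fun h3 => by omega
    · intro hT
      apply bas.repr.injective
      ext e
      simpa using hc T e fun h3 => hT h3.1

lemma finrank_chainSubspace {Y : Finset (Finset (Fin 8) × (Fin 8 ⊕ Bool))}
    (S : Submodule K (Finset (Fin 8) → N))
    (hS : ∀ c, c ∈ S ↔ ∀ T e, (T, e) ∉ Y → bas.repr (c T) e = 0) :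
    Module.finrank K S = Y.card := by
  rw [← LinearEquiv.finrank_map_eq (coordEquiv bas) S]
  refine finrank_supported Y _ fun f => ?_
  constructor
  · rintro ⟨c, hc, rfl⟩ ⟨T, e⟩ hq
    exact (hS c).1 hc T e hq
  · intro hf
    refine ⟨(coordEquiv bas).symm f, (hS _).2 fun T e hq => ?_, by simp⟩
    have := congrFun ((coordEquiv bas).apply_symm_apply f) (T, e)
    exact this.trans (hf _ hq)

lemma card_filter_prod (P : Finset (Fin 8) → Prop) [DecidablePred P] (E : Finset (Fin 8 ⊕ Bool))
    (j : ℕ) :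
    ((Finset.univ ×ˢ E).filter fun q : Finset (Fin 8) × (Fin 8 ⊕ Bool) =>
      P q.1 ∧ ∑ k ∈ q.1, artDeg k + basisDeg q.2 = j).card
      = ∑ e ∈ E, (Finset.univ.filter fun T : Finset (Fin 8) =>
        P T ∧ ∑ k ∈ T, artDeg k + basisDeg e = j).card := by
  rw [Finset.card_filter, Finset.sum_product_right]
  refine Finset.sum_congr rfl fun e _ => ?_
  rw [Finset.card_filter]

lemma sum_degCount (p j : ℕ) : ∑ e, degCount p (basisDeg e) j
    = degCount p 0 j + 4 * degCount p 4 j + 4 * degCount p 6 j + degCount p 10 j := by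
  rw [Fintype.sum_sum_type, Fintype.sum_bool, Fin.sum_univ_eight]
  simp only [basisDeg]
  have : artDeg 0 = 4 ∧ artDeg 1 = 4 ∧ artDeg 2 = 4 ∧ artDeg 3 = 4 ∧ artDeg 4 = 6 ∧ artDeg 5 = 6 ∧
    artDeg 6 = 6 ∧ artDeg 7 = 6 := by decide
  simp only [this]
  ring

lemma finrank_koszulChains (h : IsArtinianReduction bas 𝒩) (p j : ℕ) :
    Module.finrank K (koszulChains artDeg 𝒩 p j)
      = degCount p 0 j + 4 * degCount p 4 j + 4 * degCount p 6 j + degCount p 10 j := by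
  rw [finrank_chainSubspace (bas := bas) (Y := (Finset.univ ×ˢ Finset.univ).filter
    fun q : Finset (Fin 8) × (Fin 8 ⊕ Bool) =>
      q.1.card = p ∧ ∑ k ∈ q.1, artDeg k + basisDeg q.2 = j) _ (fun c => by
        rw [h.mem_koszulChains_iff]; simp), card_filter_prod (fun T => T.card = p)]
  exact sum_degCount p j

/-- For `l ∈ T`, the coefficient of `v_l` in the boundary at `T \ {l}` is, up to sign, the
coefficient of `1` in `c T`. So cycles of positive homological degree have values in the maximal
ideal. On such chains the boundary has only a socle coefficient, and this takes all values because
every `T` with `p < 8` elements omits an index. Rank-nullity gives the formula. -/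
lemma finrank_koszulCycles (h : IsArtinianReduction bas 𝒩) (p j : ℕ) (hp : p + 1 ≤ 8) :
    Module.finrank K (koszulCycles artDeg 𝒩 (p + 1) j) + degCount p 10 j
      = 4 * degCount (p + 1) 4 j + 4 * degCount (p + 1) 6 j + degCount (p + 1) 10 j := by
  classical
  let E : Finset (Fin 8 ⊕ Bool) := Finset.univ.erase (Sum.inr false)
  let S : Submodule K (Finset (Fin 8) → N) :=
    { carrier := {c | ∀ T e, ¬ (T.card = p + 1 ∧ ∑ k ∈ T, artDeg k + basisDeg e = j ∧
        e ≠ Sum.inr false) → bas.repr (c T) e = 0}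
      add_mem' := fun hc hc' T e hq => by simp [hc T e hq, hc' T e hq]
      zero_mem' := fun T e hq => by simp
      smul_mem' := fun r c hc T e hq => by simp [hc T e hq] }
  have hSdim : Module.finrank K S
      = 4 * degCount (p + 1) 4 j + 4 * degCount (p + 1) 6 j + degCount (p + 1) 10 j := by
    rw [finrank_chainSubspace (bas := bas) (Y := (Finset.univ ×ˢ E).filter
      fun q : Finset (Fin 8) × (Fin 8 ⊕ Bool) =>
        q.1.card = p + 1 ∧ ∑ k ∈ q.1, artDeg k + basisDeg q.2 = j) _ (fun c => by
          refine forall₂_congr fun T e => ?_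
          refine imp_congr_left (not_congr ?_)
          simp only [E, Finset.mem_filter, Finset.mem_product, Finset.mem_univ, Finset.mem_erase,
            true_and, and_true]
          tauto), card_filter_prod (fun T => T.card = p + 1)]
    change ∑ e ∈ E, degCount (p + 1) (basisDeg e) j = _
    have h1 : degCount (p + 1) 0 j + ∑ e ∈ E, degCount (p + 1) (basisDeg e) j
        = ∑ e, degCount (p + 1) (basisDeg e) j :=
      Finset.add_sum_erase Finset.univ (fun e => degCount (p + 1) (basisDeg e) j)
        (Finset.mem_univ (Sum.inr false))
    rw [sum_degCount] at h1
    omega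
  let Z2 : Finset (Finset (Fin 8)) := Finset.univ.filter fun T : Finset (Fin 8) =>
    T.card = p ∧ ∑ k ∈ T, artDeg k + 10 = j
  let Φ : S →ₗ[K] (Z2 → K) :=
    { toFun := fun c T => bas.repr (koszulD K N c.1 T.1) (Sum.inr true)
      map_add' := fun c c' => by ext; simp
      map_smul' := fun r c => by
        ext T
        have : koszulD K N (r • c.1) = r • koszulD K N c.1 := (koszulDK K N).map_smul r c.1
        simp [this] }
  have hker : (LinearMap.ker Φ).map S.subtype = koszulCycles artDeg 𝒩 (p + 1) j := by
    ext c
    constructor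
    · rintro ⟨⟨c, hc⟩, hc0, rfl⟩
      have hch : c ∈ koszulChains artDeg 𝒩 (p + 1) j :=
        h.mem_koszulChains_iff.2 fun T e hq => hc T e fun h3 => hq ⟨h3.1, h3.2.1⟩
      refine ⟨hch, ?_⟩
      rw [SetLike.mem_coe, LinearMap.mem_ker, koszulDK_apply]
      ext1 T
      apply bas.repr.injective
      ext e
      rcases e with l | b
      · change bas.repr (koszulD K N c T) _ = bas.repr 0 _
        rw [h.repr_koszulD_gen, hc (insert l T) (Sum.inr false) (by simp)]; simp
      · cases b
        · change bas.repr (koszulD K N c T) _ = bas.repr 0 _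
          rw [h.repr_koszulD_one]; simp
        · change bas.repr (koszulD K N c T) _ = bas.repr 0 _
          by_cases hT : T ∈ Z2
          · rw [map_zero]; exact congrFun hc0 ⟨T, hT⟩
          · rw [h.repr_koszulD_socle, Finset.sum_eq_zero]
            · simp
            · intro k _
              split_ifs with hk
              · rfl
              · rw [hc (insert k T) _ ?_, smul_zero]
                rintro ⟨h1, h2, _⟩
                apply hT
                rw [Finset.card_insert_of_notMem hk] at h1
                rw [Finset.sum_insert hk] at h2
                have h3 := artDeg_add_rev k
                simp only [basisDeg] at h2
                simp only [Z2, Finset.mem_filter, Finset.mem_univ, true_and]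
                omega
    · rintro ⟨hc, hd⟩
      rw [SetLike.mem_coe, LinearMap.mem_ker, koszulDK_apply] at hd
      have hS : c ∈ S := by
        intro T e hq
        by_cases he : e = Sum.inr false
        · subst he
          by_cases hT : T = ∅
          · rw [(hc T).2 (by subst hT; simp)]; simp
          · obtain ⟨l, hl⟩ := Finset.nonempty_iff_ne_empty.2 hT
            have h1 := h.repr_koszulD_gen c (T.erase l) l
            rw [hd, if_neg (Finset.notMem_erase l T), Finset.insert_erase hl] at h1
            have h2 := congrArg (fun z => koszulSign l (T.erase l) • z) h1
            simp only [smul_smul, koszulSign_mul_self, one_smul] at h2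
            rw [← h2]; simp
        · exact h.mem_koszulChains_iff.1 hc T e fun h3 => hq ⟨h3.1, h3.2, he⟩
      refine ⟨⟨c, hS⟩, ?_, rfl⟩
      rw [SetLike.mem_coe, LinearMap.mem_ker]
      ext T
      change bas.repr (koszulD K N c T.1) _ = _
      rw [hd]; simp
  -- For `k ∉ T`, the chain with the single value `± v_{7-k}` at `T ∪ {k}` has the boundary `σ` at
  -- `T` and no other, since `v_{7-k}` pairs only with `v_k`.
  have hsurj : LinearMap.range Φ = ⊤ := by
    rw [eq_top_iff, ← (Pi.basisFun K Z2).span_eq, Submodule.span_le]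
    rintro _ ⟨T, rfl⟩
    obtain ⟨T, hT⟩ := T
    have hT' : T.card = p ∧ ∑ k ∈ T, artDeg k + 10 = j := by simpa [Z2] using hT
    obtain ⟨k, hk⟩ : ∃ k, k ∉ T := by
      by_contra hall
      push Not at hall
      have : T = Finset.univ := Finset.eq_univ_iff_forall.2 hall
      rw [this] at hT'
      simp at hT'
      omega
    have hmem : (Pi.single (insert k T) (koszulSign k T • bas (Sum.inl k.rev)) :
        Finset (Fin 8) → N) ∈ S := by
      intro T' e hq
      by_cases hT1 : T' = insert k T
      · subst hT1
        rw [Pi.single_eq_same, map_zsmul, Finsupp.smul_apply, bas.repr_self, Finsupp.single_apply]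
        rw [if_neg, smul_zero]
        rintro rfl
        apply hq
        rw [Finset.card_insert_of_notMem hk, Finset.sum_insert hk]
        have h3 := artDeg_add_rev k
        simp only [basisDeg]
        refine ⟨by omega, by omega, by simp⟩
      · rw [Pi.single_eq_of_ne hT1]; simp
    refine ⟨⟨_, hmem⟩, ?_⟩
    ext ⟨T', hT1⟩
    change bas.repr (koszulD K N (Pi.single (insert k T) (koszulSign k T • bas (Sum.inl k.rev))) T') _
      = _
    rw [h.repr_koszulD_socle, Pi.basisFun_apply]
    by_cases hTT : T' = T
    · subst hTT
      rw [Pi.single_eq_same, Finset.sum_eq_single k]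
      · rw [if_neg hk, Pi.single_eq_same, map_zsmul, Finsupp.smul_apply, bas.repr_self,
          Finsupp.single_eq_same, smul_smul, koszulSign_mul_self, one_smul]
      · intro k' _ hkk
        split_ifs with hk'
        · rfl
        · rw [Pi.single_eq_of_ne]
          · simp
          · intro heq
            have : k' ∈ insert k T' := heq ▸ Finset.mem_insert_self k' T'
            rcases Finset.mem_insert.1 this with h4 | h4
            exacts [hkk h4, hk' h4]
      · simp
    · rw [Pi.single_eq_of_ne (by simpa using hTT), Finset.sum_eq_zero]
      intro k' _
      split_ifs with hk'
      · rfl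
      · by_cases heq : insert k' T' = insert k T
        · rw [heq, Pi.single_eq_same, map_zsmul, Finsupp.smul_apply, bas.repr_self,
            Finsupp.single_apply, if_neg, smul_zero, smul_zero]
          intro hrev
          have hkk : k = k' := Fin.rev_injective (Sum.inl_injective hrev)
          subst hkk
          apply hTT
          rw [← Finset.erase_insert hk', heq, Finset.erase_insert hk]
        · rw [Pi.single_eq_of_ne heq]; simp
  have hfd : FiniteDimensional K S := by
    have : FiniteDimensional K N := Module.Finite.of_basis bas
    infer_instance
  have hrn := LinearMap.finrank_range_add_finrank_ker Φ
  rw [hsurj, finrank_top, hSdim] at hrn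
  rw [← hker, Submodule.finrank_map_subtype_eq, ← hrn, add_comm]
  rw [Module.finrank_fintype_fun_eq_card, Fintype.card_coe]
  rfl

lemma finrank_koszulCycles_zero (h : IsArtinianReduction bas 𝒩) (j : ℕ) :
    Module.finrank K (koszulCycles artDeg 𝒩 0 j)
      = degCount 0 0 j + 4 * degCount 0 4 j + 4 * degCount 0 6 j + degCount 0 10 j := by
  rw [← h.finrank_koszulChains, koszulCycles, inf_eq_left.2]
  intro c hc
  rw [LinearMap.mem_ker, koszulDK_apply]
  ext1 T
  rw [koszulD_apply, Finset.sum_eq_zero]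
  · rfl
  · intro k _
    split_ifs
    · simp
    · rw [(hc _).2 (by simp)]; simp

/-- Rank-nullity for the differential on the chains of degree `p + 1`, whose image is the space of
boundaries in degree `p`. -/
lemma koszulDim_add [CharZero K] (h : IsArtinianReduction bas 𝒩) (p j : ℕ) :
    koszulDim artDeg 𝒩 p j + Module.finrank K (koszulChains artDeg 𝒩 (p + 1) j)
      = Module.finrank K (koszulCycles artDeg 𝒩 p j)
        + Module.finrank K (koszulCycles artDeg 𝒩 (p + 1) j) := by
  have : FiniteDimensional K N := Module.Finite.of_basis bas
  have hact : IsGradedAction artDeg 𝒩 := by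
    intro k s x hx
    rw [h.mem_piece] at hx ⊢
    obtain ⟨h1, h2, h3⟩ := h.repr_smul k x
    rintro (l | b) he
    · rw [h2]
      split_ifs with hl
      · subst hl
        exact hx _ fun h0 => he (by simp only [basisDeg] at h0 ⊢; omega)
      · rfl
    · cases b
      · exact h1
      · rw [h3]
        have h4 := artDeg_add_rev k
        exact hx _ fun h0 => he (by simp only [basisDeg] at h0 ⊢; omega)
  have hle : koszulBoundaries artDeg 𝒩 p j ≤ koszulCycles artDeg 𝒩 p j := by
    rintro _ ⟨c, hc, rfl⟩
    exact ⟨koszulD_mem_chains hact hc, by simp [koszulD_koszulD]⟩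
  have h1 := Submodule.finrank_quotient_add_finrank
    ((koszulBoundaries artDeg 𝒩 p j).submoduleOf (koszulCycles artDeg 𝒩 p j))
  have h2 : Module.finrank K
      ((koszulBoundaries artDeg 𝒩 p j).submoduleOf (koszulCycles artDeg 𝒩 p j))
      = Module.finrank K (koszulBoundaries artDeg 𝒩 p j) :=
    (Submodule.submoduleOfEquivOfLe hle).finrank_eq
  have h3 := LinearMap.finrank_range_add_finrank_ker
    ((koszulDK K N).domRestrict (koszulChains artDeg 𝒩 (p + 1) j))
  have h4 : LinearMap.range ((koszulDK K N).domRestrict (koszulChains artDeg 𝒩 (p + 1) j))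
      = koszulBoundaries artDeg 𝒩 p j := LinearMap.range_domRestrict _ _
  have h5 : (LinearMap.ker ((koszulDK K N).domRestrict (koszulChains artDeg 𝒩 (p + 1) j))).map
      (koszulChains artDeg 𝒩 (p + 1) j).subtype = koszulCycles artDeg 𝒩 (p + 1) j := by
    ext c
    constructor
    · rintro ⟨⟨c, hc⟩, h0, rfl⟩
      exact ⟨hc, h0⟩
    · rintro ⟨hc, h0⟩
      exact ⟨⟨c, hc⟩, h0, rfl⟩
  rw [h4, ← Submodule.finrank_map_subtype_eq, h5] at h3
  rw [koszulDim]
  omega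

end IsArtinianReduction

/-- A closed form of `degCount`. -/
def degCountFormula (p e j : ℕ) : ℕ :=
  if e + 4 * p ≤ j ∧ 2 * ((j - e - 4 * p) / 2) = j - e - 4 * p ∧ (j - e - 4 * p) / 2 ≤ p then
    Nat.choose 4 (p - (j - e - 4 * p) / 2) * Nat.choose 4 ((j - e - 4 * p) / 2) else 0

lemma card_filter_card_eq (a b : ℕ) :
    (Finset.univ.filter fun T : Finset (Fin 8) => (T.filter fun k : Fin 8 => (k : ℕ) < 4).card = a ∧
      (T.filter fun k : Fin 8 => ¬ (k : ℕ) < 4).card = b).card = Nat.choose 4 a * Nat.choose 4 b := by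
  have h4 : ∀ T : Finset (Fin 8), (T.filter fun k : Fin 8 => (k : ℕ) < 4).card ≤ 4 ∧
      (T.filter fun k : Fin 8 => ¬ (k : ℕ) < 4).card ≤ 4 := fun T =>
    ⟨(Finset.card_le_card (Finset.filter_subset_filter _ (Finset.subset_univ T))).trans
      (by decide), (Finset.card_le_card
        (Finset.filter_subset_filter _ (Finset.subset_univ T))).trans (by decide)⟩
  by_cases hab : a ≤ 4 ∧ b ≤ 4
  · have key : ∀ a b : Fin 5, (Finset.univ.filter fun T : Finset (Fin 8) =>
        (T.filter fun k : Fin 8 => (k : ℕ) < 4).card = a ∧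
        (T.filter fun k : Fin 8 => ¬ (k : ℕ) < 4).card = b).card
        = Nat.choose 4 a * Nat.choose 4 b := by decide +kernel
    exact key ⟨a, by omega⟩ ⟨b, by omega⟩
  · rw [Finset.card_eq_zero.2, eq_comm, Nat.mul_eq_zero]
    · rcases not_and_or.1 hab with h | h
      · exact Or.inl (Nat.choose_eq_zero_of_lt (by omega))
      · exact Or.inr (Nat.choose_eq_zero_of_lt (by omega))
    · refine Finset.filter_eq_empty_iff.2 fun T _ hT => hab ?_
      have := h4 T
      omega

/-- A set of `p` indices, `b` of them of degree `6`, has total degree `4 p + 2 b`. So `b = (j - e -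
4 p) / 2` is forced. -/
lemma degCount_eq (p e j : ℕ) : degCount p e j = degCountFormula p e j := by
  have hsum : ∀ T : Finset (Fin 8), ∑ k ∈ T, artDeg k
      = 4 * (T.filter fun k : Fin 8 => (k : ℕ) < 4).card + 6 * (T.filter fun k : Fin 8 => ¬ (k : ℕ) < 4).card := by
    intro T
    simp only [artDeg]
    rw [Finset.sum_ite]
    simp [mul_comm]
  have hcard : ∀ T : Finset (Fin 8), T.card = (T.filter fun k : Fin 8 => (k : ℕ) < 4).card
      + (T.filter fun k : Fin 8 => ¬ (k : ℕ) < 4).card := fun T =>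
    (Finset.card_filter_add_card_filter_not _).symm
  unfold degCount degCountFormula
  split_ifs with h
  · rw [← card_filter_card_eq]
    congr 1
    refine Finset.filter_congr fun T _ => ?_
    rw [hsum, hcard]
    omega
  · rw [Finset.card_eq_zero]
    refine Finset.filter_eq_empty_iff.2 fun T _ hT => h ?_
    rw [hsum, hcard] at hT
    omega

lemma bettiTable_eq_zero {p j : ℕ} (h : 8 < p ∨ 50 < j) : bettiTable p j = 0 := by
  unfold bettiTable
  split <;> first | rfl | omega

/-- With `d_p(e)` for `degCount p e j`, the counts of cycles and chains give `4 d_p(4) + 4 d_p(6) -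
d_{p+1}(0) - d_{p-1}(10)` for `1 ≤ p ≤ 7`. The ends `p = 0` and `p = 8` are treated apart. What
remains is a finite check against the table. -/
lemma IsArtinianReduction.koszulDim_eq [CharZero K] {bas : Module.Basis (Fin 8 ⊕ Bool) K N}
    {𝒩 : ℕ → Submodule K N} (h : IsArtinianReduction bas 𝒩) (p j : ℕ) :
    koszulDim artDeg 𝒩 p j = bettiTable p j := by
  have : FiniteDimensional K N := Module.Finite.of_basis bas
  have hadd := h.koszulDim_add p j
  have hz : ∀ p, 8 < p → ∀ e j, degCount p e j = 0 := by
    intro p hp e j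
    refine Finset.card_eq_zero.2 (Finset.filter_eq_empty_iff.2 fun T _ hT => ?_)
    have := Finset.card_le_univ T
    simp at this
    omega
  have hcyc : ∀ p, 8 < p → Module.finrank K (koszulCycles artDeg 𝒩 p j) = 0 := by
    intro p hp
    have h1 : Module.finrank K (koszulCycles artDeg 𝒩 p j)
      ≤ Module.finrank K (koszulChains artDeg 𝒩 p j) := Submodule.finrank_mono inf_le_left
    rw [h.finrank_koszulChains] at h1
    simp only [hz p hp] at h1
    omega
  rw [h.finrank_koszulChains] at hadd
  by_cases hp : 8 < p
  · rw [bettiTable_eq_zero (Or.inl hp)]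
    rw [hcyc p hp, hcyc (p + 1) (by omega)] at hadd
    omega
  -- A nonzero value of the closed form needs `j ≤ 6 p + e ≤ 64`. The bound admits `p = 9` because
  -- chains of degree `p + 1` enter as well.
  have hfar : ∀ p e j, 64 < j → p ≤ 9 → e ≤ 10 → degCount p e j = 0 := by
    intro p e j hj hp he
    rw [degCount_eq, degCountFormula, if_neg]
    omega
  rcases Nat.lt_or_ge 64 j with hj | hj
  · rw [bettiTable_eq_zero (Or.inr (by omega))]
    have h0 : ∀ p, p ≤ 9 → Module.finrank K (koszulCycles artDeg 𝒩 p j) = 0 := by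
      intro p hp
      have h1 : Module.finrank K (koszulCycles artDeg 𝒩 p j)
        ≤ Module.finrank K (koszulChains artDeg 𝒩 p j) := Submodule.finrank_mono inf_le_left
      rw [h.finrank_koszulChains, hfar p 0 j hj hp (by omega), hfar p 4 j hj hp (by omega),
        hfar p 6 j hj hp (by omega), hfar p 10 j hj hp (by omega)] at h1
      omega
    rw [h0 p (by omega), h0 (p + 1) (by omega)] at hadd
    omega
  by_cases hp8 : p = 8
  · subst hp8
    have h1 := h.finrank_koszulCycles 7 j (by omega)
    simp only [Nat.reduceAdd] at h1 hadd
    rw [hcyc 9 (by omega)] at hadd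
    have key : ∀ j < 65, bettiTable 8 j + degCountFormula 7 10 j
        = 4 * degCountFormula 8 4 j + 4 * degCountFormula 8 6 j + degCountFormula 8 10 j := by
      decide +kernel
    have h2 := key j (by omega)
    simp only [← degCount_eq] at h2
    simp only [hz 9 (by omega)] at hadd
    omega
  have h2 := h.finrank_koszulCycles p j (by omega)
  cases p with
  | zero =>
    rw [h.finrank_koszulCycles_zero] at hadd
    simp only [Nat.zero_add] at h2 hadd
    have key : ∀ j < 65, bettiTable 0 j + degCountFormula 1 0 j
        = degCountFormula 0 0 j + 4 * degCountFormula 0 4 j + 4 * degCountFormula 0 6 j := by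
      decide +kernel
    have h3 := key j (by omega)
    simp only [← degCount_eq] at h3
    omega
  | succ p =>
    have h1 := h.finrank_koszulCycles p j (by omega)
    have key : ∀ p < 7, ∀ j < 65, bettiTable (p + 1) j + degCountFormula (p + 1 + 1) 0 j
        + degCountFormula p 10 j
        = 4 * degCountFormula (p + 1) 4 j + 4 * degCountFormula (p + 1) 6 j := by
      decide +kernel
    have h3 := key p (by omega) j (by omega)
    simp only [← degCount_eq] at h3
    omega

end Artinian

end SLInv
end

/-! ### Reduction of a resolution modulo a regular sequence of variables -/

noncomputable section
namespace SLInv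

section Reduction

set_option linter.unusedSectionVars false

variable {K : Type*} [Field K]

lemma isWeightedHomogeneous_aeval {σ τ : Type*} {w : σ → ℕ} {w' : τ → ℕ}
    {g : σ → MvPolynomial τ K} (hg : ∀ i, (g i).IsWeightedHomogeneous w' (w i))
    {p : MvPolynomial σ K} {d : ℕ} (hp : p.IsWeightedHomogeneous w d) :
    (aeval g p).IsWeightedHomogeneous w' d := by
  rw [as_sum p, map_sum]
  refine IsWeightedHomogeneous.sum _ _ _ fun m hm => ?_
  have hd := hp (mem_support_iff.1 hm)
  rw [aeval_monomial, algebraMap_eq, ← hd, Finsupp.weight_apply]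
  refine IsWeightedHomogeneous.C_mul ?_ _
  rw [Finsupp.prod, Finsupp.sum]
  exact IsWeightedHomogeneous.prod _ _ _ fun i _ => (hg i).pow (m i)

variable {a n : ℕ}

/-- The ideal generated by the first `k` of `a` variables. -/
def firstVars (K : Type*) [Field K] (a n k : ℕ) : Ideal (MvPolynomial (Fin (a + n)) K) :=
  Ideal.span (X '' {i : Fin (a + n) | (i : ℕ) < a ∧ (i : ℕ) < k})

lemma firstVars_zero : firstVars K a n 0 = ⊥ := by
  simp [firstVars]

lemma firstVars_succ (i : Fin a) :
    firstVars K a n (i + 1) = firstVars K a n i ⊔ Ideal.span {X (Fin.castAdd n i)} := by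
  rw [firstVars, firstVars, ← Ideal.span_union, ← Set.image_singleton, ← Set.image_union]
  congr 2
  ext j
  simp only [Set.mem_ofPred_eq, Set.mem_union, Set.mem_singleton_iff, Fin.ext_iff, Fin.val_castAdd]
  have := i.2
  omega

lemma mem_firstVars {k : ℕ} {p : MvPolynomial (Fin (a + n)) K} : p ∈ firstVars K a n k ↔
    ∀ m ∈ p.support, ∃ i : Fin (a + n), ((i : ℕ) < a ∧ (i : ℕ) < k) ∧ m i ≠ 0 := by
  rw [firstVars, mem_ideal_span_X_image]; rfl

/-- Membership is a condition on the exponents at places before `i`, and multiplication by the `i`th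
variable does not change these. So the variables form a regular sequence. -/
lemma mem_firstVars_of_X_mul_mem (i : Fin a) {p : MvPolynomial (Fin (a + n)) K}
    (h : X (Fin.castAdd n i) * p ∈ firstVars K a n i) : p ∈ firstVars K a n i := by
  rw [mem_firstVars] at h ⊢
  intro m hm
  obtain ⟨j, hj, hj0⟩ := h (Finsupp.single (Fin.castAdd n i) 1 + m) (by
    rw [support_X_mul]; exact Finset.mem_map.2 ⟨m, hm, rfl⟩)
  refine ⟨j, hj, ?_⟩
  rw [Finsupp.add_apply, Finsupp.single_apply, if_neg, zero_add] at hj0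
  · exact hj0
  · rintro rfl
    simp at hj

lemma mem_ideal_smul_top_finsupp {R ι : Type*} [CommRing R] {I : Ideal R} {x : ι →₀ R} :
    x ∈ I • (⊤ : Submodule R (ι →₀ R)) ↔ ∀ i, x i ∈ I := by
  constructor
  · intro hx i
    refine Submodule.smul_induction_on hx (fun r hr y _ => ?_) fun y z hy hz => ?_
    · exact I.mul_mem_right _ hr
    · exact I.add_mem hy hz
  · intro hx
    rw [← Finsupp.sum_single x]
    refine Submodule.sum_mem _ fun i _ => ?_
    rw [show Finsupp.single i (x i) = x i • Finsupp.single i (1 : R) by simp]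
    exact Submodule.smul_mem_smul (hx i) trivial

lemma mem_firstVars_succ_smul_top {M : Type*} [AddCommGroup M]
    [Module (MvPolynomial (Fin (a + n)) K) M] (i : Fin a) {x : M} :
    x ∈ firstVars K a n (i + 1) • (⊤ : Submodule (MvPolynomial (Fin (a + n)) K) M) ↔
      ∃ u ∈ firstVars K a n i • (⊤ : Submodule (MvPolynomial (Fin (a + n)) K) M), ∃ v,
        x = u + (X (Fin.castAdd n i) : MvPolynomial (Fin (a + n)) K) • v := by
  rw [firstVars_succ, Submodule.sup_smul, Submodule.mem_sup]
  simp only [Submodule.ideal_span_singleton_smul]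
  constructor
  · rintro ⟨u, hu, z, hz, rfl⟩
    obtain ⟨v, _, rfl⟩ := (Submodule.mem_smul_pointwise_iff_exists _ _ _).1 hz
    exact ⟨u, hu, v, rfl⟩
  · rintro ⟨u, hu, v, rfl⟩
    exact ⟨u, hu, _, (Submodule.mem_smul_pointwise_iff_exists _ _ _).2 ⟨v, trivial, rfl⟩, rfl⟩

/-- If `A → B → C` is exact, also modulo an ideal `I`, and `x` is regular on `C / I C`, then
exactness at `B` is preserved modulo `(I, x)`. -/
lemma exists_of_mem_smul_top_step {A B C D : Type*} [AddCommGroup A] [AddCommGroup B]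
    [AddCommGroup C] [AddCommGroup D]
    [Module (MvPolynomial (Fin (a + n)) K) A] [Module (MvPolynomial (Fin (a + n)) K) B]
    [Module (MvPolynomial (Fin (a + n)) K) C] [Module (MvPolynomial (Fin (a + n)) K) D] (i : Fin a)
    (f : A →ₗ[MvPolynomial (Fin (a + n)) K] B) (g : B →ₗ[MvPolynomial (Fin (a + n)) K] C)
    (h : C →ₗ[MvPolynomial (Fin (a + n)) K] D) (hgh : ∀ x, h (g x) = 0)
    (hD : ∀ x : D, (X (Fin.castAdd n i) : MvPolynomial (Fin (a + n)) K) • x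
      ∈ firstVars K a n i • (⊤ : Submodule (MvPolynomial (Fin (a + n)) K) D) →
      x ∈ firstVars K a n i • (⊤ : Submodule (MvPolynomial (Fin (a + n)) K) D))
    (hB : ∀ x : B, g x ∈ firstVars K a n i • (⊤ : Submodule (MvPolynomial (Fin (a + n)) K) C) →
      ∃ y, x - f y ∈ firstVars K a n i • (⊤ : Submodule (MvPolynomial (Fin (a + n)) K) B))
    (hC : ∀ x : C, h x ∈ firstVars K a n i • (⊤ : Submodule (MvPolynomial (Fin (a + n)) K) D) →
      ∃ y, x - g y ∈ firstVars K a n i • (⊤ : Submodule (MvPolynomial (Fin (a + n)) K) C))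
    (x : B)
    (hx : g x ∈ firstVars K a n (i + 1) • (⊤ : Submodule (MvPolynomial (Fin (a + n)) K) C)) :
    ∃ y, x - f y ∈ firstVars K a n (i + 1) • (⊤ : Submodule (MvPolynomial (Fin (a + n)) K) B) := by
  obtain ⟨u, hu, v, huv⟩ := (mem_firstVars_succ_smul_top i).1 hx
  -- Applying `h` to `g x = u + X i • v` kills the left side, so `X i • h v` lies in the ideal times
  -- `D`, and regularity on `D` removes `X i`.
  have h1 : h v ∈ firstVars K a n i • (⊤ : Submodule (MvPolynomial (Fin (a + n)) K) D) := by
    apply hD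
    have h2 := hgh x
    rw [huv, map_add, map_smul] at h2
    rw [eq_neg_of_add_eq_zero_right h2]
    refine neg_mem ?_
    have h3 := Submodule.mem_map_of_mem (f := h) hu
    rw [Submodule.map_smul''] at h3
    exact Submodule.smul_mono le_rfl le_top h3
  obtain ⟨w, hw⟩ := hC v h1
  obtain ⟨y, hy⟩ := hB (x - (X (Fin.castAdd n i) : MvPolynomial (Fin (a + n)) K) • w) (by
    rw [map_sub, map_smul, huv, add_sub_assoc, ← smul_sub]
    exact add_mem hu (Submodule.smul_mem _ _ hw))
  refine ⟨y, (mem_firstVars_succ_smul_top i).2 ⟨_, hy, w, by abel⟩⟩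

namespace MinimalGradedFreeResolution

variable {M : Type*} [AddCommGroup M] [Module K M] [Module (MvPolynomial (Fin (a + n)) K) M]
  {deg : Fin (a + n) → ℕ} {ℳ : ℕ → Submodule K M} {β : ℕ → ℕ → ℕ}

/-- A resolution stays exact modulo a regular sequence of variables. -/
lemma exact_mod_firstVars (r : MinimalGradedFreeResolution deg M ℳ β)
    (hreg : ∀ (i : Fin a) (x : M), (X (Fin.castAdd n i) : MvPolynomial (Fin (a + n)) K) • x
      ∈ firstVars K a n i • (⊤ : Submodule (MvPolynomial (Fin (a + n)) K) M) →
      x ∈ firstVars K a n i • (⊤ : Submodule (MvPolynomial (Fin (a + n)) K) M))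
    (k : ℕ) (hk : k ≤ a) :
    (∀ x, r.ε x ∈ firstVars K a n k • (⊤ : Submodule (MvPolynomial (Fin (a + n)) K) M) →
      ∃ y, x - r.d 0 y ∈ firstVars K a n k • (⊤ : Submodule (MvPolynomial (Fin (a + n)) K) (FreeTerm K (a + n) β 0))) ∧
    ∀ i x, r.d i x ∈ firstVars K a n k • (⊤ : Submodule (MvPolynomial (Fin (a + n)) K) (FreeTerm K (a + n) β i)) →
      ∃ y, x - r.d (i + 1) y ∈
        firstVars K a n k • (⊤ : Submodule (MvPolynomial (Fin (a + n)) K) (FreeTerm K (a + n) β (i + 1))) := by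
  induction k with
  | zero =>
    simp only [firstVars_zero, Submodule.bot_smul, Submodule.mem_bot]
    refine ⟨fun x hx => ?_, fun i x hx => ?_⟩
    · obtain ⟨y, rfl⟩ := (r.exact_zero x).1 hx
      exact ⟨y, sub_self _⟩
    · obtain ⟨y, rfl⟩ := (r.exact_succ i x).1 hx
      exact ⟨y, sub_self _⟩
  | succ k ih =>
    obtain ⟨ih0, ih1⟩ := ih (by omega)
    have hfree : ∀ i (x : FreeTerm K (a + n) β i),
        (X (Fin.castAdd n ⟨k, by omega⟩) : MvPolynomial (Fin (a + n)) K) • x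
        ∈ firstVars K a n k • (⊤ : Submodule (MvPolynomial (Fin (a + n)) K) (FreeTerm K (a + n) β i)) →
        x ∈ firstVars K a n k • (⊤ : Submodule (MvPolynomial (Fin (a + n)) K) (FreeTerm K (a + n) β i)) := by
      intro i x hx
      rw [mem_ideal_smul_top_finsupp] at hx ⊢
      exact fun b => mem_firstVars_of_X_mul_mem ⟨k, by omega⟩ (hx b)
    refine ⟨fun x hx => ?_, fun i => ?_⟩
    -- At `F_0` exactness is right exactness of the reduction, and regularity is not needed.
    · obtain ⟨u, hu, v, huv⟩ := (mem_firstVars_succ_smul_top ⟨k, by omega⟩).1 hx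
      obtain ⟨w, rfl⟩ := r.surjective v
      obtain ⟨y, hy⟩ := ih0
        (x - (X (Fin.castAdd n ⟨k, by omega⟩) : MvPolynomial (Fin (a + n)) K) • w) (by
          rw [map_sub, map_smul, huv, add_sub_cancel_right]; exact hu)
      exact ⟨y, (mem_firstVars_succ_smul_top ⟨k, by omega⟩).2 ⟨_, hy, w, by abel⟩⟩
    · cases i with
      -- At `F_1` the module two places to the right is `M` itself, and only here does regularity on
      -- `M` enter. Further left it is free.
      | zero =>
        exact exists_of_mem_smul_top_step ⟨k, by omega⟩ (r.d 1) (r.d 0) r.ε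
          (fun x => (r.exact_zero _).2 ⟨x, rfl⟩) (hreg ⟨k, by omega⟩) (ih1 0) ih0
      | succ i =>
        exact exists_of_mem_smul_top_step ⟨k, by omega⟩ (r.d (i + 2)) (r.d (i + 1)) (r.d i)
          (fun x => (r.exact_succ i _).2 ⟨x, rfl⟩) (hfree i) (ih1 (i + 1)) (ih1 i)

end MinimalGradedFreeResolution

variable (K a n) in
/-- The homomorphism that sends the first `a` variables to `0`. -/
def killFirst : MvPolynomial (Fin (a + n)) K →ₐ[K] MvPolynomial (Fin n) K :=
  aeval (Fin.addCases (fun _ => 0) X)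

@[simp] lemma killFirst_X_castAdd (i : Fin a) : killFirst K a n (X (Fin.castAdd n i)) = 0 := by
  simp [killFirst]

@[simp] lemma killFirst_X_natAdd (k : Fin n) : killFirst K a n (X (Fin.natAdd a k)) = X k := by
  simp [killFirst]

lemma killFirst_rename (p : MvPolynomial (Fin n) K) :
    killFirst K a n (rename (Fin.natAdd a) p) = p := by
  rw [killFirst, aeval_rename]
  have : (Fin.addCases (fun _ => (0 : MvPolynomial (Fin n) K)) X) ∘ Fin.natAdd a = X := by
    ext1 k; simp
  rw [this, aeval_X_left_apply]

lemma sub_rename_killFirst_mem (p : MvPolynomial (Fin (a + n)) K) :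
    p - rename (Fin.natAdd a) (killFirst K a n p) ∈ firstVars K a n a := by
  induction p using MvPolynomial.induction_on with
  | C r => simp [killFirst]
  | add p q hp hq =>
    rw [map_add, map_add, add_sub_add_comm]
    exact add_mem hp hq
  | mul_X p i hp =>
    rw [map_mul, map_mul]
    refine Fin.addCases (fun i => ?_) (fun k => ?_) i
    · simp only [killFirst_X_castAdd, map_zero, mul_zero, sub_zero]
      refine Ideal.mul_mem_left _ _ (Ideal.subset_span ⟨_, ?_, rfl⟩)
      simp
    · rw [killFirst_X_natAdd, rename_X, ← sub_mul]
      exact Ideal.mul_mem_right _ _ hp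

lemma killFirst_eq_zero_iff {p : MvPolynomial (Fin (a + n)) K} :
    killFirst K a n p = 0 ↔ p ∈ firstVars K a n a := by
  constructor
  · intro h
    simpa [h] using sub_rename_killFirst_mem p
  · intro h
    have : firstVars K a n a ≤ RingHom.ker (killFirst K a n).toRingHom := by
      rw [firstVars, Ideal.span_le]
      rintro _ ⟨i, ⟨hi, _⟩, rfl⟩
      have : i = Fin.castAdd n ⟨i, hi⟩ := rfl
      rw [this]
      exact killFirst_X_castAdd _
    exact this h

lemma constantCoeff_killFirst (p : MvPolynomial (Fin (a + n)) K) :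
    constantCoeff (killFirst K a n p) = constantCoeff p := by
  have : (constantCoeff (σ := Fin n) (R := K)).comp (killFirst K a n).toRingHom
      = constantCoeff := by
    refine MvPolynomial.ringHom_ext (fun r => ?_) fun i => ?_
    · simp [killFirst]
    · refine Fin.addCases (fun i => ?_) (fun k => ?_) i <;> simp
  exact RingHom.congr_fun this p

/-- Reduction of the coefficients of the elements of a free module. -/
def killFirstFinsupp (K : Type*) [Field K] (a n : ℕ) (ι : Type*) :
    (ι →₀ MvPolynomial (Fin (a + n)) K) →+ (ι →₀ MvPolynomial (Fin n) K) :=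
  Finsupp.mapRange.addMonoidHom (killFirst K a n : _ →+ _)

lemma killFirstFinsupp_apply {ι : Type*} (x : ι →₀ MvPolynomial (Fin (a + n)) K) (i : ι) :
    killFirstFinsupp K a n ι x i = killFirst K a n (x i) := rfl

lemma killFirstFinsupp_surjective (ι : Type*) :
    Function.Surjective (killFirstFinsupp K a n ι) := by
  intro y
  refine ⟨y.mapRange (rename (Fin.natAdd a)) (map_zero _), ?_⟩
  ext1 i
  rw [killFirstFinsupp_apply, Finsupp.mapRange_apply, killFirst_rename]

lemma killFirstFinsupp_eq_zero_iff {ι : Type*} {x : ι →₀ MvPolynomial (Fin (a + n)) K} :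
    killFirstFinsupp K a n ι x = 0 ↔
      x ∈ firstVars K a n a • (⊤ : Submodule (MvPolynomial (Fin (a + n)) K) _) := by
  rw [mem_ideal_smul_top_finsupp, DFunLike.ext_iff]
  exact forall_congr' fun i => killFirst_eq_zero_iff

lemma linearCombination_killFirstFinsupp {ι M N : Type*} [AddCommGroup M]
    [Module (MvPolynomial (Fin (a + n)) K) M] [AddCommGroup N] [Module (MvPolynomial (Fin n) K) N]
    (π : M →+ N) (hπ : ∀ (p : MvPolynomial (Fin (a + n)) K) x, π (p • x) = killFirst K a n p • π x)
    (f : (ι →₀ MvPolynomial (Fin (a + n)) K) →ₗ[MvPolynomial (Fin (a + n)) K] M)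
    (x : ι →₀ MvPolynomial (Fin (a + n)) K) :
    Finsupp.linearCombination (MvPolynomial (Fin n) K) (fun b => π (f (Finsupp.single b 1)))
      (killFirstFinsupp K a n ι x) = π (f x) := by
  induction x using Finsupp.induction_linear with
  | zero => simp
  | add x y hx hy => simp only [map_add, hx, hy]
  | single b p =>
    have h1 : killFirstFinsupp K a n ι (Finsupp.single b p) = Finsupp.single b (killFirst K a n p) :=
      Finsupp.mapRange_single (hf := map_zero _)
    rw [h1, Finsupp.linearCombination_single, ← hπ, ← map_smul, Finsupp.smul_single, smul_eq_mul,
      mul_one]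

namespace MinimalGradedFreeResolution

variable {M : Type*} [AddCommGroup M] [Module K M] [Module (MvPolynomial (Fin (a + n)) K) M]
  {N : Type*} [AddCommGroup N] [Module K N] [Module (MvPolynomial (Fin n) K) N]
  {deg : Fin (a + n) → ℕ} {ℳ : ℕ → Submodule K M} {𝒩 : ℕ → Submodule K N} {β : ℕ → ℕ → ℕ}

/-- The reduction of a minimal graded free resolution modulo a regular sequence of variables. -/
theorem reduce (r : MinimalGradedFreeResolution deg M ℳ β)
    (hreg : ∀ (i : Fin a) (x : M), (X (Fin.castAdd n i) : MvPolynomial (Fin (a + n)) K) • x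
      ∈ firstVars K a n i • (⊤ : Submodule (MvPolynomial (Fin (a + n)) K) M) →
      x ∈ firstVars K a n i • (⊤ : Submodule (MvPolynomial (Fin (a + n)) K) M))
    (π : M →+ N) (hπ : ∀ (p : MvPolynomial (Fin (a + n)) K) x, π (p • x) = killFirst K a n p • π x)
    (hsurj : Function.Surjective π)
    (hker : ∀ x, π x = 0 →
      x ∈ firstVars K a n a • (⊤ : Submodule (MvPolynomial (Fin (a + n)) K) M))
    (hgr : ∀ s, ∀ x ∈ ℳ s, π x ∈ 𝒩 s) :
    Nonempty (MinimalGradedFreeResolution (fun k => deg (Fin.natAdd a k)) N 𝒩 β) := by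
  obtain ⟨h0, h1⟩ := r.exact_mod_firstVars hreg a le_rfl
  let ρ := fun i => killFirstFinsupp K a n (Σ j, Fin (β i j))
  have hρ : ∀ i (p : MvPolynomial (Fin (a + n)) K) x, ρ i (p • x) = killFirst K a n p • ρ i x := by
    intro i p x
    ext1 b
    exact map_mul (killFirst K a n) p (x b)
  let d' := fun i => Finsupp.linearCombination (MvPolynomial (Fin n) K)
    (fun b => ρ i (r.d i (Finsupp.single b 1)))
  let ε' := Finsupp.linearCombination (MvPolynomial (Fin n) K)
    (fun b => π (r.ε (Finsupp.single b 1)))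
  have hd : ∀ i x, d' i (ρ (i + 1) x) = ρ i (r.d i x) := fun i x =>
    linearCombination_killFirstFinsupp (ρ i) (hρ i) (r.d i) x
  have hε : ∀ x, ε' (ρ 0 x) = π (r.ε x) := fun x => linearCombination_killFirstFinsupp π hπ r.ε x
  have hρs : ∀ i, Function.Surjective (ρ i) := fun i => killFirstFinsupp_surjective _
  refine ⟨
    { d := d'
      ε := ε'
      surjective := fun y => ?_
      exact_zero := fun x => ⟨fun hx => ?_, ?_⟩
      exact_succ := fun i x => ⟨fun hx => ?_, ?_⟩
      ε_graded := fun b => ?_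
      d_graded := fun i b c p hp => ?_
      minimal := fun i x c => ?_ }⟩
  · obtain ⟨x, rfl⟩ := hsurj y
    obtain ⟨z, rfl⟩ := r.surjective x
    exact ⟨ρ 0 z, hε z⟩
  · obtain ⟨x, rfl⟩ := hρs 0 x
    rw [hε] at hx
    obtain ⟨y, hy⟩ := h0 x (hker _ hx)
    refine ⟨ρ 1 y, ?_⟩
    rw [hd, eq_comm, ← sub_eq_zero, ← map_sub]
    exact killFirstFinsupp_eq_zero_iff.2 hy
  · rintro ⟨y, rfl⟩
    obtain ⟨y, rfl⟩ := hρs 1 y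
    rw [hd, hε, (r.exact_zero _).2 ⟨y, rfl⟩, map_zero]
  · obtain ⟨x, rfl⟩ := hρs (i + 1) x
    rw [hd] at hx
    obtain ⟨y, hy⟩ := h1 i x (killFirstFinsupp_eq_zero_iff.1 hx)
    refine ⟨ρ (i + 2) y, ?_⟩
    rw [hd, eq_comm, ← sub_eq_zero, ← map_sub]
    exact killFirstFinsupp_eq_zero_iff.2 hy
  · rintro ⟨y, rfl⟩
    obtain ⟨y, rfl⟩ := hρs (i + 2) y
    rw [hd, hd, (r.exact_succ i _).2 ⟨y, rfl⟩, map_zero]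
  · simp only [ε', Finsupp.linearCombination_single, one_smul]
    exact hgr _ _ (r.ε_graded b)
  · simp only [d', Finsupp.linearCombination_single, one_smul] at hp
    have h2 : (r.d i (Finsupp.single b 1) c).IsWeightedHomogeneous deg (b.1 - c.1) := by
      intro m hm
      have := r.d_graded i b c m (mem_support_iff.2 hm)
      omega
    have h3 := isWeightedHomogeneous_aeval (w' := fun k => deg (Fin.natAdd a k))
      (g := Fin.addCases (fun _ => (0 : MvPolynomial (Fin n) K)) X)
      (fun i => by
        refine Fin.addCases (fun i => ?_) (fun k => ?_) i
        · rw [Fin.addCases_left]; exact isWeightedHomogeneous_zero _ _ _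
        · rw [Fin.addCases_right]
          exact isWeightedHomogeneous_X K (fun k => deg (Fin.natAdd a k)) k) h2
    have h4 := h3 (mem_support_iff.1 hp)
    -- A monomial of the original entry shows `c.1 ≤ b.1`, which the truncated subtraction in `h2`
    -- conceals.
    obtain ⟨m, hm⟩ : ∃ m, m ∈ (r.d i (Finsupp.single b 1) c).support := by
      refine support_nonempty.2 fun h0 => ?_
      rw [killFirstFinsupp_apply, h0, map_zero] at hp
      simp at hp
    have h5 := r.d_graded i b c m hm
    omega
  · obtain ⟨x, rfl⟩ := hρs (i + 1) x
    rw [hd, killFirstFinsupp_apply, constantCoeff_killFirst]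
    exact r.minimal i x c

end MinimalGradedFreeResolution

end Reduction

end SLInv
end

/-! ### Projective dimension from a minimal resolution -/

noncomputable section
namespace SLInv

section ProjectiveDimension

open CategoryTheory

universe u

lemma hasProjectiveDimensionLT_iff_of_exact {R A B C : Type u} [CommRing R] [AddCommGroup A]
    [Module R A] [AddCommGroup B] [Module R B] [AddCommGroup C] [Module R C]
    [Module.Projective R B] (f : A →ₗ[R] B) (g : B →ₗ[R] C) (hf : Function.Injective f)
    (hg : Function.Surjective g) (hfg : Function.Exact f g) (n : ℕ) :
    HasProjectiveDimensionLT (ModuleCat.of R C) (n + 2) ↔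
      HasProjectiveDimensionLT (ModuleCat.of R A) (n + 1) :=
  (ModuleCat.shortComplex_shortExact
    (ModuleCat.shortComplexOfCompEqZero f g hfg.linearMap_comp_eq_zero)
    hfg hf hg).hasProjectiveDimensionLT_X₃_iff n
    ((IsProjective.iff_projective B).1 inferInstance)

variable {K : Type u} [Field K] {m : ℕ} {deg : Fin m → ℕ} {M : Type u} [AddCommGroup M]
  [Module K M] [Module (MvPolynomial (Fin m) K) M] {ℳ : ℕ → Submodule K M} {β : ℕ → ℕ → ℕ}

lemma exact_subtype_range_rangeRestrict {R A B C : Type*} [CommRing R] [AddCommGroup A]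
    [Module R A] [AddCommGroup B] [Module R B] [AddCommGroup C] [Module R C]
    (f : A →ₗ[R] B) (g : B →ₗ[R] C) (hfg : Function.Exact f g) :
    Function.Exact (LinearMap.range f).subtype g.rangeRestrict := by
  intro x
  rw [Submodule.coe_subtype, Subtype.range_coe, ← Subtype.coe_inj]
  exact hfg x

namespace MinimalGradedFreeResolution

/-- The sequences `0 → im d_{i+1} → F_{i+1} → im d_i → 0` have a projective middle term, so each
syzygy module lowers the bound by one. -/
lemma hasProjectiveDimensionLT_iff (r : MinimalGradedFreeResolution deg M ℳ β) (i n : ℕ) :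
    HasProjectiveDimensionLT (ModuleCat.of (MvPolynomial (Fin m) K) M) (n + i + 2) ↔
    HasProjectiveDimensionLT
      (ModuleCat.of (MvPolynomial (Fin m) K) (LinearMap.range (r.d i))) (n + 1) := by
  induction i generalizing n with
  | zero =>
    refine hasProjectiveDimensionLT_iff_of_exact (LinearMap.range (r.d 0)).subtype r.ε
      Subtype.val_injective r.surjective ?_ n
    intro x
    rw [Submodule.coe_subtype, Subtype.range_coe]
    exact r.exact_zero x
  | succ i ih =>
    have h := ih (n + 1)
    rw [show n + 1 + i + 2 = n + (i + 1) + 2 by ring] at h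
    rw [h]
    exact hasProjectiveDimensionLT_iff_of_exact (LinearMap.range (r.d (i + 1))).subtype
      (r.d i).rangeRestrict Subtype.val_injective (r.d i).surjective_rangeRestrict
      (exact_subtype_range_rangeRestrict _ _ (r.exact_succ i)) n

lemma constantCoeff_map_eq_zero {ι κ : Type*}
    (f : (ι →₀ MvPolynomial (Fin m) K) →ₗ[MvPolynomial (Fin m) K] (κ →₀ MvPolynomial (Fin m) K))
    {x : ι →₀ MvPolynomial (Fin m) K} (hx : ∀ c, constantCoeff (x c) = 0) (b : κ) :
    constantCoeff (f x b) = 0 := by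
  conv_lhs => rw [← Finsupp.sum_single x, Finsupp.sum, map_sum, Finsupp.finsetSum_apply, map_sum]
  refine Finset.sum_eq_zero fun c _ => ?_
  rw [show Finsupp.single c (x c) = x c • Finsupp.single c 1 by simp, map_smul,
    Finsupp.smul_apply, smul_eq_mul, map_mul, hx, zero_mul]

/-- A minimal graded free resolution of length `i + 2` shows that the projective dimension
is `i + 2`. -/
theorem projectiveDimension_eq (r : MinimalGradedFreeResolution deg M ℳ β) (i j : ℕ)
    (h0 : ∀ j, β (i + 3) j = 0) (h1 : β (i + 2) j ≠ 0) :
    projectiveDimension (ModuleCat.of (MvPolynomial (Fin m) K) M) = (i + 2 : ℕ) := by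
  have hinj : Function.Injective (r.d (i + 1)) := by
    rw [injective_iff_map_eq_zero]
    intro x hx
    obtain ⟨y, rfl⟩ := (r.exact_succ (i + 1) x).1 hx
    have : y = 0 := by
      ext b
      exact absurd b.2.2 (by simp [h0])
    rw [this, map_zero]
  refine le_antisymm ((projectiveDimension_le_iff _ _).2 ?_) ((projectiveDimension_ge_iff _ _).2 ?_)
  · rw [HasProjectiveDimensionLE, show i + 2 + 1 = 0 + (i + 1) + 2 by ring,
      r.hasProjectiveDimensionLT_iff (i + 1) 0]
    have := Module.Projective.of_equiv (LinearEquiv.ofInjective (r.d (i + 1)) hinj)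
    have := (IsProjective.iff_projective
      (R := MvPolynomial (Fin m) K) (LinearMap.range (r.d (i + 1)))).1 this
    exact projective_iff_hasProjectiveDimensionLT_one.1 this
  -- A smaller projective dimension would make `im d_i` projective. Then `d_{i+1}` has a left
  -- inverse `ψ`. But by minimality `ψ ∘ d_{i+1}` has no constant terms, so it cannot fix a basis
  -- vector of `F_{i+2}`.
  · intro h
    rw [show i + 2 = 0 + i + 2 by ring, r.hasProjectiveDimensionLT_iff i 0] at h
    have h2 := (IsProjective.iff_projective
      (R := MvPolynomial (Fin m) K) (LinearMap.range (r.d i))).2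
        (projective_iff_hasProjectiveDimensionLT_one.2 h)
    obtain ⟨s, hs⟩ := Module.projective_lifting_property (r.d i).rangeRestrict LinearMap.id
      (r.d i).surjective_rangeRestrict
    have hs' : ∀ x, r.d i (s ((r.d i).rangeRestrict x)) = r.d i x := fun x =>
      congrArg Subtype.val (LinearMap.congr_fun hs ((r.d i).rangeRestrict x))
    obtain ⟨ψ, hψ⟩ := Module.projective_lifting_property (r.d (i + 1)).rangeRestrict
      ((LinearMap.id - s ∘ₗ (r.d i).rangeRestrict).codRestrict (LinearMap.range (r.d (i + 1)))
        (fun x => (r.exact_succ i _).1 (by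
          simp only [LinearMap.sub_apply, LinearMap.comp_apply, map_sub, hs']
          exact sub_self _)))
      (r.d (i + 1)).surjective_rangeRestrict
    have hψ' : ∀ x, ψ (r.d (i + 1) x) = x := by
      intro x
      apply hinj
      have h3 := congrArg Subtype.val (LinearMap.congr_fun hψ (r.d (i + 1) x))
      have h4 : (r.d i).rangeRestrict (r.d (i + 1) x) = 0 :=
        Subtype.ext ((r.exact_succ i _).2 ⟨x, rfl⟩)
      refine h3.trans ?_
      change r.d (i + 1) x - s ((r.d i).rangeRestrict (r.d (i + 1) x)) = _
      rw [h4, map_zero, sub_zero]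
    let b : Σ j : ℕ, Fin (β (i + 2) j) := ⟨j, ⟨0, Nat.pos_of_ne_zero h1⟩⟩
    have h5 := constantCoeff_map_eq_zero ψ (r.minimal (i + 1) (Finsupp.single b 1)) b
    rw [hψ', Finsupp.single_eq_same, map_one] at h5
    exact one_ne_zero h5

end MinimalGradedFreeResolution

end ProjectiveDimension

end SLInv
end

/-! ### Transport along isomorphisms of graded polynomial rings -/

noncomputable section
namespace SLInv

section Transport

set_option linter.unusedSectionVars false

variable {K : Type*} [Field K]

lemma isGrading_weightedHomogeneousSubmodule {σ : Type*} (w : σ → ℕ) :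
    IsGrading (weightedHomogeneousSubmodule K w) := by
  classical
  constructor
  · intro p
    refine ⟨(weightedHomogeneousComponent_finsupp (w := w) p).toFinset,
      fun s => weightedHomogeneousComponent w s p,
      fun s => weightedHomogeneousComponent_mem w p s, ?_⟩
    conv_lhs => rw [← sum_weightedHomogeneousComponent w p]
    rw [finsum_eq_sum _ (weightedHomogeneousComponent_finsupp p)]
  · intro S g hg h s hs
    have h2 := congrArg (weightedHomogeneousComponent w s) h
    rw [map_sum, map_zero, Finset.sum_eq_single s, (hg s).weightedHomogeneousComponent_same] at h2
    · exact h2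
    · intro t _ hts
      exact IsWeightedHomogeneous.weightedHomogeneousComponent_ne (m := t) s (hg t) hts.symm
    · exact fun h => absurd hs h

/-- The kernels of the powers of `f` stabilize at some `n`. An element of `ker f` has the form `f^n
y`, and then `y ∈ ker f^(n+1) = ker f^n`. -/
lemma RingHom.injective_of_surjective_of_isNoetherianRing {R : Type*} [CommRing R]
    [IsNoetherianRing R] (f : R →+* R) (hf : Function.Surjective f) : Function.Injective f := by
  have hmono : Monotone fun n : ℕ => RingHom.ker (f ^ n) := by
    refine monotone_nat_of_le_succ fun n x hx => ?_
    rw [RingHom.mem_ker] at hx ⊢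
    rw [pow_succ', RingHom.mul_def, RingHom.comp_apply, hx, map_zero]
  obtain ⟨n, hn⟩ := monotone_stabilizes_iff_noetherian.2 ‹IsNoetherianRing R› ⟨_, hmono⟩
  rw [injective_iff_map_eq_zero]
  intro x hx
  have hs : Function.Surjective (f ^ n) := by
    rw [RingHom.coe_pow]; exact hf.iterate n
  obtain ⟨y, rfl⟩ := hs x
  have h1 : y ∈ RingHom.ker (f ^ (n + 1)) := by
    rw [RingHom.mem_ker, pow_succ', RingHom.mul_def, RingHom.comp_apply, hx]
  have h2 : RingHom.ker (f ^ n) = RingHom.ker (f ^ (n + 1)) := hn (n + 1) (Nat.le_succ n)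
  rw [← h2] at h1
  exact h1

/-- An isomorphism of graded polynomial rings. -/
structure IsGradedEquiv {m n : ℕ} (deg : Fin m → ℕ) (e : Fin n → ℕ)
    (Θ : MvPolynomial (Fin m) K ≃ₐ[K] MvPolynomial (Fin n) K) : Prop where
  pos : ∀ i, 0 < deg i
  pos' : ∀ j, 0 < e j
  map_X : ∀ i, (Θ (X i)).IsWeightedHomogeneous e (deg i)
  symm_map_X : ∀ j, (Θ.symm (X j)).IsWeightedHomogeneous deg (e j)

lemma constantCoeff_eq_zero_of_isWeightedHomogeneous {σ : Type*} {w : σ → ℕ}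
    {p : MvPolynomial σ K} {d : ℕ} (hp : p.IsWeightedHomogeneous w d) (hd : 0 < d) :
    constantCoeff p = 0 := by
  by_contra h
  have := hp (d := 0) h
  rw [map_zero] at this
  omega

lemma isWeightedHomogeneous_map {σ τ : Type*} {w : σ → ℕ} {w' : τ → ℕ}
    (Θ : MvPolynomial σ K →ₐ[K] MvPolynomial τ K)
    (hX : ∀ i, (Θ (X i)).IsWeightedHomogeneous w' (w i)) {p : MvPolynomial σ K} {d : ℕ}
    (hp : p.IsWeightedHomogeneous w d) : (Θ p).IsWeightedHomogeneous w' d := by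
  have h : aeval (fun i => Θ (X i)) = Θ := by ext i; simp
  rw [← h]
  exact isWeightedHomogeneous_aeval hX hp

lemma constantCoeff_map {σ τ : Type*} (Θ : MvPolynomial σ K →ₐ[K] MvPolynomial τ K)
    (h : ∀ i, constantCoeff (Θ (X i)) = 0) (p : MvPolynomial σ K) :
    constantCoeff (Θ p) = constantCoeff p := by
  have : (constantCoeff (σ := τ) (R := K)).comp Θ.toRingHom = constantCoeff := by
    refine MvPolynomial.ringHom_ext (fun r => ?_) fun i => ?_
    · have := Θ.commutes r
      rw [algebraMap_eq, algebraMap_eq] at this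
      simp [this]
    · simpa using h i
  exact RingHom.congr_fun this p

namespace IsGradedEquiv

variable {m n : ℕ} {deg : Fin m → ℕ} {e : Fin n → ℕ}
  {Θ : MvPolynomial (Fin m) K ≃ₐ[K] MvPolynomial (Fin n) K}

lemma symm (h : IsGradedEquiv deg e Θ) : IsGradedEquiv e deg Θ.symm :=
  ⟨h.pos', h.pos, h.symm_map_X, fun j => h.map_X j⟩

lemma map (h : IsGradedEquiv deg e Θ) {p : MvPolynomial (Fin m) K} {d : ℕ}
    (hp : p.IsWeightedHomogeneous deg d) : (Θ p).IsWeightedHomogeneous e d :=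
  isWeightedHomogeneous_map Θ.toAlgHom h.map_X hp

lemma constantCoeff (h : IsGradedEquiv deg e Θ) (p : MvPolynomial (Fin m) K) :
    constantCoeff (Θ p) = MvPolynomial.constantCoeff p :=
  constantCoeff_map Θ.toAlgHom (fun i =>
    constantCoeff_eq_zero_of_isWeightedHomogeneous (h.map_X i) (h.pos i)) p

/-- The inverse preserves degrees too, since a homogeneous element has a homogeneous preimage and
preimages are unique. -/
lemma of_bijective (hpos : ∀ i, 0 < deg i) (hpos' : ∀ j, 0 < e j)
    (hX : ∀ i, (Θ (X i)).IsWeightedHomogeneous e (deg i)) : IsGradedEquiv deg e Θ := by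
  refine ⟨hpos, hpos', hX, fun j => ?_⟩
  obtain ⟨y, hy, h⟩ := IsGrading.exists_mem_of_map_mem
    (isGrading_weightedHomogeneousSubmodule (K := K) deg)
    (isGrading_weightedHomogeneousSubmodule (K := K) e) Θ.toLinearMap
    (fun s x hx => isWeightedHomogeneous_map Θ.toAlgHom hX hx) (j := e j) (x := Θ.symm (X j)) (by
      simpa using isWeightedHomogeneous_X K e j)
  rw [← Θ.injective h]
  exact hy

end IsGradedEquiv

/-- Transport of a minimal graded free resolution along an isomorphism of graded polynomial
rings. -/
theorem MinimalGradedFreeResolution.transport {m n : ℕ} {deg : Fin m → ℕ} {e : Fin n → ℕ}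
    {Θ : MvPolynomial (Fin m) K ≃ₐ[K] MvPolynomial (Fin n) K} (h : IsGradedEquiv deg e Θ)
    {M N : Type*} [AddCommGroup M] [Module K M] [Module (MvPolynomial (Fin m) K) M]
    [AddCommGroup N] [Module K N] [Module (MvPolynomial (Fin n) K) N]
    {ℳ : ℕ → Submodule K M} {𝒩 : ℕ → Submodule K N} {β : ℕ → ℕ → ℕ}
    (φ : N ≃+ M) (hφ : ∀ (p : MvPolynomial (Fin n) K) x, φ (p • x) = Θ.symm p • φ x)
    (hφ' : ∀ s, ∀ x ∈ 𝒩 s, φ x ∈ ℳ s) (r : MinimalGradedFreeResolution e N 𝒩 β) :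
    Nonempty (MinimalGradedFreeResolution deg M ℳ β) := by
  let U : ∀ i, FreeTerm K m β i ≃+ FreeTerm K n β i := fun i =>
    Finsupp.mapRange.addEquiv Θ.toAddEquiv
  have hU : ∀ i x c, U i x c = Θ (x c) := fun i x c => rfl
  have hU' : ∀ i x c, (U i).symm x c = Θ.symm (x c) := fun i x c => rfl
  have hUs : ∀ i (p : MvPolynomial (Fin m) K) x, U i (p • x) = Θ p • U i x := by
    intro i p x
    ext1 c
    simp [hU]
  have hUs' : ∀ i (p : MvPolynomial (Fin n) K) x, (U i).symm (p • x) = Θ.symm p • (U i).symm x := by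
    intro i p x
    ext1 c
    simp [hU']
  have hU1 : ∀ i b, U i (Finsupp.single b 1) = Finsupp.single b 1 := by
    intro i b
    have : U i (Finsupp.single b 1) = Finsupp.single b (Θ 1) :=
      Finsupp.mapRange_single (hf := map_zero Θ)
    rw [this, map_one]
  refine ⟨{
    d := fun i => { toFun := fun x => (U i).symm (r.d i (U (i + 1) x))
                    map_add' := fun x y => by simp
                    map_smul' := fun p x => by simp [hUs, hUs'] }
    ε := { toFun := fun x => φ (r.ε (U 0 x))
           map_add' := fun x y => by simp
           map_smul' := fun p x => by simp [hUs, hφ] }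
    surjective := φ.surjective.comp (r.surjective.comp (U 0).surjective)
    exact_zero := ?_
    exact_succ := ?_
    ε_graded := ?_
    d_graded := ?_
    minimal := ?_ }⟩
  · intro x
    change φ (r.ε (U 0 x)) = 0 ↔ x ∈ Set.range fun y => (U 0).symm (r.d 0 (U 1 y))
    rw [map_eq_zero_iff φ φ.injective, r.exact_zero]
    constructor
    · rintro ⟨y, hy⟩
      exact ⟨(U 1).symm y, by simp [hy]⟩
    · rintro ⟨y, rfl⟩
      exact ⟨U 1 y, by simp⟩
  · intro i x
    change (U i).symm (r.d i (U (i + 1) x)) = 0 ↔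
      x ∈ Set.range fun y => (U (i + 1)).symm (r.d (i + 1) (U (i + 2) y))
    rw [map_eq_zero_iff (U i).symm (U i).symm.injective, r.exact_succ]
    constructor
    · rintro ⟨y, hy⟩
      exact ⟨(U (i + 2)).symm y, by simp [hy]⟩
    · rintro ⟨y, rfl⟩
      exact ⟨U (i + 2) y, by simp⟩
  · intro b
    change φ (r.ε (U 0 (Finsupp.single b 1))) ∈ _
    rw [hU1]
    exact hφ' _ _ (r.ε_graded b)
  · intro i b c p hp
    change p ∈ ((U i).symm (r.d i (U (i + 1) (Finsupp.single b 1))) c).support at hp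
    rw [hU1, hU'] at hp
    set q := r.d i (Finsupp.single b 1) c with hq
    have hq0 : q ≠ 0 := by
      rintro h0
      simp [h0] at hp
    obtain ⟨p0, hp0⟩ := Finset.nonempty_of_ne_empty (mt support_eq_empty.1 hq0)
    have h0 := r.d_graded i b c p0 hp0
    have hq1 : q.IsWeightedHomogeneous e (b.1 - c.1) := by
      intro m hm
      have := r.d_graded i b c m (mem_support_iff.2 hm)
      omega
    have := h.symm.map hq1 (mem_support_iff.1 hp)
    omega
  · intro i x c
    change MvPolynomial.constantCoeff ((U i).symm (r.d i (U (i + 1) x)) c) = 0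
    rw [hU', h.symm.constantCoeff, r.minimal]

/-! ### Minimal generating systems of connected graded algebras -/

/-- A graded algebra over `K` with `K` as its piece of degree `0`. -/
structure IsConnectedGradedAlgebra {S : Type*} [CommRing S] [Algebra K S]
    (𝒮 : ℕ → Submodule K S) : Prop where
  isGrading : IsGrading 𝒮
  one_mem : (1 : S) ∈ 𝒮 0
  mul_mem : ∀ {s t x y}, x ∈ 𝒮 s → y ∈ 𝒮 t → x * y ∈ 𝒮 (s + t)
  eq_algebraMap : ∀ x ∈ 𝒮 0, ∃ c, x = algebraMap K S c

namespace IsConnectedGradedAlgebra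

variable {S : Type*} [CommRing S] [Algebra K S] {𝒮 : ℕ → Submodule K S}

lemma pow_mem (h𝒮 : IsConnectedGradedAlgebra 𝒮) {s x} (hx : x ∈ 𝒮 s) (k : ℕ) :
    x ^ k ∈ 𝒮 (k * s) := by
  induction k with
  | zero => simpa using h𝒮.one_mem
  | succ k ih => rw [pow_succ, Nat.succ_mul]; exact h𝒮.mul_mem ih hx

lemma prod_mem (h𝒮 : IsConnectedGradedAlgebra 𝒮) {ι : Type*} (T : Finset ι) (x : ι → S)
    (s : ι → ℕ) (hx : ∀ i ∈ T, x i ∈ 𝒮 (s i)) : ∏ i ∈ T, x i ∈ 𝒮 (∑ i ∈ T, s i) := by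
  classical
  induction T using Finset.induction_on with
  | empty => simpa using h𝒮.one_mem
  | insert i T hi ih =>
    rw [Finset.prod_insert hi, Finset.sum_insert hi]
    exact h𝒮.mul_mem (hx i (Finset.mem_insert_self i T))
      (ih fun j hj => hx j (Finset.mem_insert_of_mem hj))

lemma aeval_mem (h𝒮 : IsConnectedGradedAlgebra 𝒮) {σ : Type*} {f : σ → S} {deg : σ → ℕ}
    (hf : ∀ i, f i ∈ 𝒮 (deg i)) {p : MvPolynomial σ K} {d : ℕ}
    (hp : p.IsWeightedHomogeneous deg d) : aeval f p ∈ 𝒮 d := by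
  rw [as_sum p, map_sum]
  refine Submodule.sum_mem _ fun m hm => ?_
  have hd := hp (mem_support_iff.1 hm)
  rw [aeval_monomial, ← Algebra.smul_def, ← hd, Finsupp.weight_apply, Finsupp.prod, Finsupp.sum]
  exact Submodule.smul_mem _ _
    (h𝒮.prod_mem _ _ _ fun i _ => h𝒮.pow_mem (hf i) (m i))

variable {m n : ℕ}

/-- A minimal system of homogeneous generators. -/
structure IsMinimalSystem (𝒮 : ℕ → Submodule K S) (f : Fin m → S) (deg : Fin m → ℕ) : Prop where
  homogeneous : ∀ i, f i ∈ 𝒮 (deg i)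
  generates : Algebra.adjoin K (Set.range f) = ⊤
  minimal : ∀ i, f i ∉ Algebra.adjoin K (f '' {i}ᶜ)

/-- An element of degree `0` is a scalar and lies in every subalgebra, so it would be superfluous as
a generator. -/
lemma IsMinimalSystem.pos {f : Fin m → S} {deg : Fin m → ℕ} (hf : IsMinimalSystem 𝒮 f deg)
    (h𝒮 : IsConnectedGradedAlgebra 𝒮) (i : Fin m) : 0 < deg i := by
  by_contra h
  have h0 := hf.homogeneous i
  rw [show deg i = 0 by omega] at h0
  obtain ⟨c, hc⟩ := h𝒮.eq_algebraMap _ h0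
  exact hf.minimal i (hc ▸ Subalgebra.algebraMap_mem _ c)

lemma exists_lift (h𝒮 : IsConnectedGradedAlgebra 𝒮) {f : Fin m → S} {deg : Fin m → ℕ}
    (hf : IsMinimalSystem 𝒮 f deg) {s : ℕ} {x : S} (hx : x ∈ 𝒮 s) :
    ∃ p : MvPolynomial (Fin m) K, p.IsWeightedHomogeneous deg s ∧ aeval f p = x := by
  have h1 : x ∈ Algebra.adjoin K (Set.range f) := hf.generates ▸ trivial
  rw [Algebra.adjoin_range_eq_range_aeval] at h1
  obtain ⟨q, rfl⟩ := h1
  exact IsGrading.exists_mem_of_map_mem (isGrading_weightedHomogeneousSubmodule (K := K) deg)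
    h𝒮.isGrading (aeval f).toLinearMap (fun s p hp => h𝒮.aeval_mem hf.homogeneous hp) hx

lemma weight_lt_of_ne_single {deg : Fin m → ℕ} (hdeg : ∀ i, 0 < deg i) {μ : Fin m →₀ ℕ}
    {i : Fin m} (hi : μ i ≠ 0) (h : μ ≠ Finsupp.single i 1) : deg i < Finsupp.weight deg μ := by
  have h1 : μ = Finsupp.single i 1 + (μ - Finsupp.single i 1) := by
    rw [add_tsub_cancel_of_le]
    rw [Finsupp.single_le_iff]; omega
  have h2 : μ - Finsupp.single i 1 ≠ 0 := by
    intro h0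
    rw [h0, add_zero] at h1
    exact h h1
  obtain ⟨j, hj⟩ := Finsupp.ne_iff.1 h2
  rw [h1, map_add, Finsupp.weight_single, one_smul]
  have h3 := Finsupp.le_weight deg (hdeg j).ne' (μ - Finsupp.single i 1)
  have h4 : (μ - Finsupp.single i 1 : Fin m →₀ ℕ) j ≠ 0 := hj
  omega

/-- A relation among minimal generators has no linear part. -/
lemma coeff_single_eq_zero (h𝒮 : IsConnectedGradedAlgebra 𝒮) {f : Fin m → S} {deg : Fin m → ℕ}
    (hf : IsMinimalSystem 𝒮 f deg) {s : ℕ} {p : MvPolynomial (Fin m) K}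
    (hp : p.IsWeightedHomogeneous deg s) (h0 : aeval f p = 0) (i : Fin m) :
    coeff (Finsupp.single i 1) p = 0 := by
  by_contra hc
  set c := coeff (Finsupp.single i 1) p with hcdef
  have hs : deg i = s := by simpa [Finsupp.weight_single] using hp hc
  -- A monomial divisible by `X i` but different from it has weight above `deg i`. The rest of `p`
  -- therefore avoids `X i`, and the relation would express `f i` through the other generators.
  have h1 : aeval f (p - C c * X i) ∈ Algebra.adjoin K (f '' {i}ᶜ) := by
    rw [as_sum (p - C c * X i), map_sum]
    refine Subalgebra.sum_mem _ fun μ hμ => ?_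
    rw [aeval_monomial, ← Algebra.smul_def]
    refine Subalgebra.smul_mem _ (Subalgebra.prod_mem _ fun j hj => Subalgebra.pow_mem _
      (Algebra.subset_adjoin (Set.mem_image_of_mem f ?_)) _) _
    rintro rfl
    have hμj : μ j ≠ 0 := Finsupp.mem_support_iff.1 hj
    rw [mem_support_iff, coeff_sub, coeff_C_mul, coeff_X] at hμ
    by_cases hμ1 : Finsupp.single j 1 = μ
    · rw [if_pos hμ1, ← hμ1, mul_one, hcdef, sub_self] at hμ
      exact hμ rfl
    · rw [if_neg hμ1, mul_zero, sub_zero] at hμ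
      have := weight_lt_of_ne_single (hf.pos h𝒮) hμj (Ne.symm hμ1)
      have := hp hμ
      omega
  rw [map_sub, h0, zero_sub, map_mul, aeval_C, aeval_X, ← Algebra.smul_def] at h1
  have h2 := Subalgebra.smul_mem _ (Subalgebra.neg_mem _ h1) c⁻¹
  rw [neg_neg, smul_smul, inv_mul_cancel₀ hc, one_smul] at h2
  exact hf.minimal i h2

/-- `Ψ (X i) - X i` is a relation among minimal generators. Having no linear part, it involves only
variables of degree below `deg i`, so induction on the degree puts each `X i` into the range. -/
lemma surjective_of_aeval_comp (h𝒮 : IsConnectedGradedAlgebra 𝒮) {f : Fin m → S}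
    {deg : Fin m → ℕ} (hf : IsMinimalSystem 𝒮 f deg)
    (Ψ : MvPolynomial (Fin m) K →ₐ[K] MvPolynomial (Fin m) K)
    (hΨ : ∀ i, (Ψ (X i)).IsWeightedHomogeneous deg (deg i))
    (hΨf : ∀ p, aeval f (Ψ p) = aeval f p) : Function.Surjective Ψ := by
  have key : ∀ (s : ℕ) (i : Fin m), deg i = s → X i ∈ Ψ.range := by
    intro s
    induction s using Nat.strong_induction_on with
    | _ s ih =>
      intro i hi
      have hk : (Ψ (X i) - X i).IsWeightedHomogeneous deg (deg i) :=
        Submodule.sub_mem (weightedHomogeneousSubmodule K deg (deg i)) (hΨ i)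
          (isWeightedHomogeneous_X K deg i)
      have hk0 : aeval f (Ψ (X i) - X i) = 0 := by rw [map_sub, hΨf, sub_self]
      have h1 : Ψ (X i) - X i ∈ Ψ.range := by
        rw [as_sum (Ψ (X i) - X i)]
        refine Subalgebra.sum_mem _ fun μ hμ => ?_
        rw [monomial_eq, Finsupp.prod, ← algebraMap_eq, ← Algebra.smul_def]
        refine Subalgebra.smul_mem _ (Subalgebra.prod_mem _ fun j hj => Subalgebra.pow_mem _
          (ih (deg j) ?_ j rfl) _) _
        have hμ' := mem_support_iff.1 hμ
        rw [← hi, ← hk hμ']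
        refine weight_lt_of_ne_single (hf.pos h𝒮) (Finsupp.mem_support_iff.1 hj) ?_
        rintro rfl
        exact hμ' (h𝒮.coeff_single_eq_zero hf hk hk0 j)
      have := Subalgebra.sub_mem _ (⟨X i, rfl⟩ : Ψ (X i) ∈ Ψ.range) h1
      rwa [sub_sub_cancel] at this
  rw [← AlgHom.range_eq_top, ← top_le_iff, ← MvPolynomial.adjoin_range_X, Algebra.adjoin_le_iff]
  rintro _ ⟨i, rfl⟩
  exact key _ i rfl

/-- Two minimal systems of homogeneous generators differ by an isomorphism of graded polynomial
rings. -/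
theorem exists_isGradedEquiv (h𝒮 : IsConnectedGradedAlgebra 𝒮) {f : Fin m → S} {deg : Fin m → ℕ}
    (hf : IsMinimalSystem 𝒮 f deg) {g : Fin n → S} {e : Fin n → ℕ} (hg : IsMinimalSystem 𝒮 g e) :
    ∃ Θ : MvPolynomial (Fin m) K ≃ₐ[K] MvPolynomial (Fin n) K,
      IsGradedEquiv deg e Θ ∧ ∀ p, aeval g (Θ p) = aeval f p := by
  choose p hp hpf using fun i => h𝒮.exists_lift hg (hf.homogeneous i)
  choose q hq hqg using fun j => h𝒮.exists_lift hf (hg.homogeneous j)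
  have hpf' : ∀ r : MvPolynomial (Fin m) K, aeval g (aeval p r) = aeval f r := by
    intro r
    have : (aeval (R := K) g).comp (aeval p) = aeval f := by ext i; simp [hpf]
    exact AlgHom.congr_fun this r
  have hqg' : ∀ r : MvPolynomial (Fin n) K, aeval f (aeval q r) = aeval g r := by
    intro r
    have : (aeval (R := K) f).comp (aeval q) = aeval g := by ext i; simp [hqg]
    exact AlgHom.congr_fun this r
  have h1 := h𝒮.surjective_of_aeval_comp hf ((aeval (R := K) q).comp (aeval (R := K) p))
    (fun i => by simpa using isWeightedHomogeneous_aeval hq (hp i))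
    (fun r => by rw [AlgHom.comp_apply, hqg', hpf'])
  have h2 := h𝒮.surjective_of_aeval_comp hg ((aeval (R := K) p).comp (aeval (R := K) q))
    (fun i => by simpa using isWeightedHomogeneous_aeval hp (hq i))
    (fun r => by rw [AlgHom.comp_apply, hpf', hqg'])
  -- Lifting `f` through `g` and back gives a surjective endomorphism of a Noetherian ring, which is
  -- injective.
  have hinj : Function.Injective (aeval (R := K) p) :=
    Function.Injective.of_comp (f := aeval (R := K) q)
      (RingHom.injective_of_surjective_of_isNoetherianRing
        ((aeval (R := K) q).comp (aeval (R := K) p)).toRingHom h1)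
  have hsurj : Function.Surjective (aeval (R := K) p) := Function.Surjective.of_comp h2
  exact ⟨AlgEquiv.ofBijective (aeval (R := K) p) ⟨hinj, hsurj⟩,
    IsGradedEquiv.of_bijective (hf.pos h𝒮) (hg.pos h𝒮) (fun i => by simpa using hp i), hpf'⟩

end IsConnectedGradedAlgebra

end Transport

end SLInv
end

/-! ### Covariants of a binary cubic and their transformation laws -/

noncomputable section
namespace SLInv

section Covariants

variable {R : Type*} [CommRing R]

/-- The coefficients of the Hessian of a cubic form with normalized coefficients `c`; `η` stands
for `1 / 2`. -/
def hessian (η : R) (c : Fin 4 → R) : Fin 3 → R :=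
  ![c 0 * c 2 - c 1 ^ 2, η * (c 0 * c 3 - c 1 * c 2), c 1 * c 3 - c 2 ^ 2]

/-- The normalized coefficients of the cubic covariant of a cubic form. -/
def cubicCovariant (c : Fin 4 → R) : Fin 4 → R :=
  ![c 0 ^ 2 * c 3 - 3 * c 0 * c 1 * c 2 + 2 * c 1 ^ 3,
    c 0 * c 1 * c 3 - 2 * c 0 * c 2 ^ 2 + c 1 ^ 2 * c 2,
    -(c 0 * c 2 * c 3 - 2 * c 3 * c 1 ^ 2 + c 2 ^ 2 * c 1),
    -(c 3 ^ 2 * c 0 - 3 * c 3 * c 2 * c 1 + 2 * c 2 ^ 3)]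

/-- The discriminant of a cubic form. -/
def discriminant (c : Fin 4 → R) : R :=
  c 0 ^ 2 * c 3 ^ 2 - 6 * c 0 * c 1 * c 2 * c 3 + 4 * c 0 * c 2 ^ 3 + 4 * c 1 ^ 3 * c 3
    - 3 * c 1 ^ 2 * c 2 ^ 2

/-- The normalized coefficients of a cubic form in the basis `(p 0, p 1)`, `(p 2, p 3)`. -/
def polarCubic (p : Fin 4 → R) (c : Fin 4 → R) : Fin 4 → R :=
  ![c 0 * p 0 ^ 3 + 3 * c 1 * p 0 ^ 2 * p 1 + 3 * c 2 * p 0 * p 1 ^ 2 + c 3 * p 1 ^ 3,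
    c 0 * p 0 ^ 2 * p 2 + c 1 * (p 0 ^ 2 * p 3 + 2 * p 0 * p 1 * p 2)
      + c 2 * (p 1 ^ 2 * p 2 + 2 * p 0 * p 1 * p 3) + c 3 * p 1 ^ 2 * p 3,
    c 0 * p 0 * p 2 ^ 2 + c 1 * (p 1 * p 2 ^ 2 + 2 * p 0 * p 2 * p 3)
      + c 2 * (p 0 * p 3 ^ 2 + 2 * p 1 * p 2 * p 3) + c 3 * p 1 * p 3 ^ 2,
    c 0 * p 2 ^ 3 + 3 * c 1 * p 2 ^ 2 * p 3 + 3 * c 2 * p 2 * p 3 ^ 2 + c 3 * p 3 ^ 3]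

/-- The normalized coefficients of a quadratic form in the basis `(p 0, p 1)`, `(p 2, p 3)`. -/
def polarQuadratic (p : Fin 4 → R) (h : Fin 3 → R) : Fin 3 → R :=
  ![h 0 * p 0 ^ 2 + 2 * h 1 * p 0 * p 1 + h 2 * p 1 ^ 2,
    h 0 * p 0 * p 2 + h 1 * (p 0 * p 3 + p 1 * p 2) + h 2 * p 1 * p 3,
    h 0 * p 2 ^ 2 + 2 * h 1 * p 2 * p 3 + h 2 * p 3 ^ 2]

/-- The Hessian is a quadratic covariant of weight `2`, whence the square of the determinant.
Stating this with `2 η = 1` over any commutative ring makes it available for polynomial rings and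
fraction fields alike. -/
lemma hessian_polarCubic {η : R} (hη : 2 * η = 1) (p c : Fin 4 → R) (i : Fin 3) :
    hessian η (polarCubic p c) i
      = (p 0 * p 3 - p 1 * p 2) ^ 2 * polarQuadratic p (hessian η c) i := by
  fin_cases i
  · simp [hessian, polarCubic, polarQuadratic]
    linear_combination (-(p 0 * p 3 - p 1 * p 2) ^ 2 * (c 0 * c 3 - c 1 * c 2) * p 0 * p 1) * hη
  · simp [hessian, polarCubic, polarQuadratic]
    linear_combination ((p 0 * p 3 - p 1 * p 2) ^ 2 * ((c 0 * c 2 - c 1 ^ 2) * p 0 * p 2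
      + (c 1 * c 3 - c 2 ^ 2) * p 1 * p 3)) * hη
  · simp [hessian, polarCubic, polarQuadratic]
    linear_combination (-(p 0 * p 3 - p 1 * p 2) ^ 2 * (c 0 * c 3 - c 1 * c 2) * p 2 * p 3) * hη

lemma cubicCovariant_polarCubic (p c : Fin 4 → R) (i : Fin 4) :
    cubicCovariant (polarCubic p c) i
      = (p 0 * p 3 - p 1 * p 2) ^ 3 * polarCubic p (cubicCovariant c) i := by
  fin_cases i
  · simp [cubicCovariant, polarCubic]
    ring
  · simp [cubicCovariant, polarCubic]
    ring
  · simp [cubicCovariant, polarCubic]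
    ring
  · simp [cubicCovariant, polarCubic]
    ring

/-- The discriminant of the cubic is, up to a factor, that of its Hessian. Its transformation law,
of weight `6`, then follows without expanding the discriminant of a transformed cubic. -/
lemma discriminant_eq {η : R} (hη : 2 * η = 1) (c : Fin 4 → R) :
    discriminant c = 4 * (hessian η c 1 ^ 2 - hessian η c 0 * hessian η c 2) := by
  simp [hessian, discriminant]
  linear_combination (-(2 * η + 1) * (c 0 * c 3 - c 1 * c 2) ^ 2) * hη

lemma discriminant_polarCubic {η : R} (hη : 2 * η = 1) (p c : Fin 4 → R) :
    discriminant (polarCubic p c) = (p 0 * p 3 - p 1 * p 2) ^ 6 * discriminant c := by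
  rw [discriminant_eq hη, discriminant_eq hη, hessian_polarCubic hη, hessian_polarCubic hη,
    hessian_polarCubic hη]
  generalize hessian η c = h
  simp [polarQuadratic]
  ring

/-- The action of a matrix on the coordinates of two linear forms and a cubic form. -/
def actCoord (g : Fin 4 → R) (z : Fin 8 → R) : Fin 8 → R :=
  ![z 0 * g 0 + z 1 * g 1, z 0 * g 2 + z 1 * g 3, z 2 * g 0 + z 3 * g 1, z 2 * g 2 + z 3 * g 3,
    z 4 * g 0 ^ 3 + z 5 * g 0 ^ 2 * g 1 + z 6 * g 0 * g 1 ^ 2 + z 7 * g 1 ^ 3,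
    3 * z 4 * g 0 ^ 2 * g 2 + z 5 * (g 0 ^ 2 * g 3 + 2 * g 0 * g 1 * g 2)
      + z 6 * (g 1 ^ 2 * g 2 + 2 * g 0 * g 1 * g 3) + 3 * z 7 * g 1 ^ 2 * g 3,
    3 * z 4 * g 0 * g 2 ^ 2 + z 5 * (g 1 * g 2 ^ 2 + 2 * g 0 * g 2 * g 3)
      + z 6 * (g 0 * g 3 ^ 2 + 2 * g 1 * g 2 * g 3) + 3 * z 7 * g 1 * g 3 ^ 2,
    z 4 * g 2 ^ 3 + z 5 * g 2 ^ 2 * g 3 + z 6 * g 2 * g 3 ^ 2 + z 7 * g 3 ^ 3]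

/-- The zeros `(-a₁, a₀)` and `(-b₁, b₀)` of the two linear forms. -/
def zeros (z : Fin 8 → R) : Fin 4 → R := ![-z 1, z 0, -z 3, z 2]

/-- The normalized coefficients of the cubic form; `θ` stands for `1 / 3`. -/
def cubicCoeff (θ : R) (z : Fin 8 → R) : Fin 4 → R := ![z 4, θ * z 5, θ * z 6, z 7]

/-- The determinant of the two linear forms. -/
def detForm (z : Fin 8 → R) : R := z 0 * z 3 - z 1 * z 2

lemma detForm_actCoord (g : Fin 4 → R) (z : Fin 8 → R) :
    detForm (actCoord g z) = (g 0 * g 3 - g 1 * g 2) * detForm z := by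
  simp [detForm, actCoord]
  ring

lemma cubicCoeff_actCoord {θ : R} (hθ : 3 * θ = 1) (g : Fin 4 → R) (z : Fin 8 → R) :
    cubicCoeff θ (actCoord g z) = polarCubic g (cubicCoeff θ z) := by
  ext i
  fin_cases i
  · simp [cubicCoeff, actCoord, polarCubic]
    linear_combination (-z 5 * g 0 ^ 2 * g 1 - z 6 * g 0 * g 1 ^ 2) * hθ
  · simp [cubicCoeff, actCoord, polarCubic]
    linear_combination (z 4 * g 0 ^ 2 * g 2 + z 7 * g 1 ^ 2 * g 3) * hθ
  · simp [cubicCoeff, actCoord, polarCubic]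
    linear_combination (z 4 * g 0 * g 2 ^ 2 + z 7 * g 1 * g 3 ^ 2) * hθ
  · simp [cubicCoeff, actCoord, polarCubic]
    linear_combination (-z 5 * g 2 ^ 2 * g 3 - z 6 * g 2 * g 3 ^ 2) * hθ

/-- Changes of basis compose by matrix multiplication, and the zeros of the transformed linear
forms, multiplied by `g`, are `det g` times the old zeros. Cubics are homogeneous of degree `3`. -/
lemma polarCubic_zeros_polarCubic (g c : Fin 4 → R) (z : Fin 8 → R)  :
    polarCubic (zeros (actCoord g z)) (polarCubic g c)
      = (g 0 * g 3 - g 1 * g 2) ^ 3 • polarCubic (zeros z) c := by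
  have h : ∀ p q : Fin 4 → R, polarCubic p (polarCubic q c) =
      polarCubic ![p 0 * q 0 + p 1 * q 2, p 0 * q 1 + p 1 * q 3,
        p 2 * q 0 + p 3 * q 2, p 2 * q 1 + p 3 * q 3] c := by
    intro p q
    ext i
    fin_cases i <;> simp [polarCubic] <;> ring
  rw [h]
  ext i
  fin_cases i <;> simp [polarCubic, zeros, actCoord] <;> ring

end Covariants

end SLInv
end

/-! ### The thirteen generators and their normal form -/

noncomputable section
namespace SLInv

section Generators

variable {R : Type*} [CommRing R]

/-- Five algebraically independent invariants, as functions of the coordinates; `η`, `θ` stand for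
`1 / 2`, `1 / 3`. -/
def genY (η θ : R) (z : Fin 8 → R) : Fin 5 → R :=
  ![η * detForm z, discriminant (cubicCoeff θ z),
    polarQuadratic (zeros z) (hessian η (cubicCoeff θ z)) 2,
    polarCubic (zeros z) (cubicCoeff θ z) 0,
    polarCubic (zeros z) (cubicCoeff θ z) 3
      + polarQuadratic (zeros z) (hessian η (cubicCoeff θ z)) 0]

/-- The remaining generating invariants, as functions of the coordinates. -/
def genV (η θ : R) (z : Fin 8 → R) : Fin 8 → R :=
  ![-polarCubic (zeros z) (cubicCoeff θ z) 1, -polarCubic (zeros z) (cubicCoeff θ z) 2,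
    polarQuadratic (zeros z) (hessian η (cubicCoeff θ z)) 0,
    polarQuadratic (zeros z) (hessian η (cubicCoeff θ z)) 1,
    polarCubic (zeros z) (cubicCovariant (cubicCoeff θ z)) 0,
    polarCubic (zeros z) (cubicCovariant (cubicCoeff θ z)) 1,
    polarCubic (zeros z) (cubicCovariant (cubicCoeff θ z)) 2,
    polarCubic (zeros z) (cubicCovariant (cubicCoeff θ z)) 3]

lemma map_genY {R' : Type*} [CommRing R'] (ψ : R →+* R') (η θ : R) (z : Fin 8 → R) (i : Fin 5) :
    ψ (genY η θ z i) = genY (ψ η) (ψ θ) (ψ ∘ z) i := by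
  fin_cases i <;> simp [genY, detForm, discriminant, cubicCoeff, polarQuadratic, hessian,
    polarCubic, zeros, map_ofNat]

lemma map_genV {R' : Type*} [CommRing R'] (ψ : R →+* R') (η θ : R) (z : Fin 8 → R) (i : Fin 8) :
    ψ (genV η θ z i) = genV (ψ η) (ψ θ) (ψ ∘ z) i := by
  fin_cases i <;> simp [genV, cubicCoeff, polarQuadratic, hessian, cubicCovariant,
    polarCubic, zeros, map_ofNat]

/-- The values of the first five invariants at the linear forms `-y`, `t x` and the cubic form
with normalized coefficients `c`. -/
def normalY (η t : R) (c : Fin 4 → R) : Fin 5 → R :=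
  ![η * t, discriminant c, t ^ 2 * hessian η c 2, c 0, t ^ 3 * c 3 + hessian η c 0]

/-- The values of the other invariants at the linear forms `-y`, `t x` and the cubic form
with normalized coefficients `c`. -/
def normalV (η t : R) (c : Fin 4 → R) : Fin 8 → R :=
  ![-(t * c 1), -(t ^ 2 * c 2), hessian η c 0, t * hessian η c 1, cubicCovariant c 0,
    t * cubicCovariant c 1, t ^ 2 * cubicCovariant c 2, t ^ 3 * cubicCovariant c 3]

/-- In terms of the zeros the cubic has coefficients `t^i c_i`. By covariance, and after cancelling
powers of `t`, all generators become functions of `t` and `c` alone. Both their invariance and their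
multiplication table rest on this. -/
lemma gen_eq_normal [IsDomain R] {η θ : R} (hη : 2 * η = 1) {z : Fin 8 → R}
    (hz : detForm z ≠ 0) {c : Fin 4 → R} (hc : ∀ i : Fin 4,
      polarCubic (zeros z) (cubicCoeff θ z) i = detForm z ^ (i : ℕ) * c i) :
    genY η θ z = normalY η (detForm z) c ∧ genV η θ z = normalV η (detForm z) c := by
  set t := detForm z with ht
  have hdet : zeros z 0 * zeros z 3 - zeros z 1 * zeros z 2 = t := by
    simp [zeros, ht, detForm]; ring
  have hf : polarCubic (zeros z) (cubicCoeff θ z) = fun i : Fin 4 => t ^ (i : ℕ) * c i :=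
    funext hc
  have hH : ∀ i : Fin 3, polarQuadratic (zeros z) (hessian η (cubicCoeff θ z)) i
      = t ^ (i : ℕ) * hessian η c i := by
    intro i
    apply mul_left_cancel₀ (pow_ne_zero 2 hz)
    have h := hessian_polarCubic hη (zeros z) (cubicCoeff θ z) i
    rw [hdet, hf] at h
    rw [← h]
    fin_cases i <;> simp [hessian] <;> ring
  have hT : ∀ i : Fin 4, polarCubic (zeros z) (cubicCovariant (cubicCoeff θ z)) i
      = t ^ (i : ℕ) * cubicCovariant c i := by
    intro i
    apply mul_left_cancel₀ (pow_ne_zero 3 hz)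
    have h := cubicCovariant_polarCubic (zeros z) (cubicCoeff θ z) i
    rw [hdet, hf] at h
    rw [← h]
    fin_cases i <;> simp [cubicCovariant] <;> ring
  have hD : discriminant (cubicCoeff θ z) = discriminant c := by
    apply mul_left_cancel₀ (pow_ne_zero 6 hz)
    have h := discriminant_polarCubic hη (zeros z) (cubicCoeff θ z)
    rw [hdet, hf] at h
    rw [← h]
    simp [discriminant]
    ring
  constructor
  · ext i
    fin_cases i <;> simp [genY, normalY, hH, hD, hc, ht]
  · ext i
    fin_cases i <;> simp [genV, normalV, hH, hT, hc]

end Generators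

end SLInv
end

/-! ### The multiplication table -/

noncomputable section
namespace SLInv

section Table

set_option linter.unusedSectionVars false

variable {K L : Type*} [Field K] [Field L] [CharZero L] [Algebra K L]

/-- The product `v i * v j` is, up to the socle generator, a combination of `1` and of the `v k`
with the coefficients `c₀` and `c k` in the ideal generated by the `y k`. -/
def IsMulEntry {A : Type*} [CommRing A] [Algebra K A] (y : Fin 5 → A)
    (v : Fin 8 → A) (i j : Fin 8) (c₀ : MvPolynomial (Fin 5) K)
    (c : Fin 8 → MvPolynomial (Fin 5) K) : Prop :=
  constantCoeff c₀ = 0 ∧ (∀ k, constantCoeff (c k) = 0) ∧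
    v i * v j = (if j = Fin.rev i then v 2 * v 5 else 0) + aeval y c₀
      + ∑ k, aeval y (c k) * v k

/-- This and the next seven lemmas list the products `v_i v_j` with `i ≤ j`. Each witness is
homogeneous of degree `8`, `10` or `12` when the five variables have degrees `2, 4, 4, 4, 4`. Each
entry is an identity in `t` and the coefficients of the cubic. -/
lemma exists_isMulEntry_row_a (t : L) (c : Fin 4 → L) {j : Fin 8} (hj : 0 ≤ j) :
    ∃ (c₀ : MvPolynomial (Fin 5) K) (c' : Fin 8 → MvPolynomial (Fin 5) K),
      IsMulEntry (normalY 2⁻¹ t c) (normalV 2⁻¹ t c) 0 j c₀ c' := by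
  fin_cases j
  on_goal 1 => refine ⟨0, ![0, -X 3, -4 * X 0 ^ 2, 0, 0, 0, 0, 0], ?_⟩
  on_goal 2 => refine ⟨X 3 * X 4, ![0, 0, -X 3, -8 * X 0 ^ 2, 0, 0, 0, 0], ?_⟩
  on_goal 3 => refine ⟨0, ![0, 0, 0, -X 3, X 0, 0, 0, 0], ?_⟩
  on_goal 4 => refine ⟨-X 2 * X 3, ![0, 0, 0, 0, 0, X 0, 0, 0], ?_⟩
  on_goal 5 => refine ⟨0, ![-4 * X 0 * X 2, 0, -4 * X 0 * X 4, 0, 0, -X 3, -8 * X 0 ^ 2, 0], ?_⟩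
  on_goal 6 => refine ⟨0, ![0, -4 * X 0 * X 2, 0, -4 * X 0 * X 4, 0, 0, -X 3, -4 * X 0 ^ 2], ?_⟩
  on_goal 7 => refine ⟨-8 * X 0 ^ 3 * X 1, ![0, 0, -4 * X 0 * X 2, 0, 0, 0, 0, -X 3], ?_⟩
  on_goal 8 => refine ⟨0, ![0, 0, 0, 8 * X 0 * X 2, 0, -X 4, 0, 0], ?_⟩
  all_goals
    refine ⟨by simp, by simp [Fin.forall_fin_succ], ?_⟩
    simp [Fin.sum_univ_succ, normalV, normalY, hessian, cubicCovariant, discriminant, Fin.rev]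
    ring

lemma exists_isMulEntry_row_b (t : L) (c : Fin 4 → L) {j : Fin 8} (hj : 1 ≤ j) :
    ∃ (c₀ : MvPolynomial (Fin 5) K) (c' : Fin 8 → MvPolynomial (Fin 5) K),
      IsMulEntry (normalY 2⁻¹ t c) (normalV 2⁻¹ t c) 1 j c₀ c' := by
  fin_cases j
  iterate 1 exact absurd hj (by decide)
  on_goal 1 => refine ⟨-4 * X 0 ^ 2 * X 2, ![-X 4, 0, 0, -X 3, X 0, 0, 0, 0], ?_⟩
  on_goal 2 => refine ⟨-X 2 * X 3, ![0, 0, 0, 0, 0, 2 * X 0, 0, 0], ?_⟩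
  on_goal 3 => refine ⟨0, ![X 2, 0, 0, 0, 0, 0, X 0, 0], ?_⟩
  on_goal 4 => refine ⟨0, ![0, -8 * X 0 * X 2, 0, -8 * X 0 * X 4, 0, 0, -X 3, -8 * X 0 ^ 2], ?_⟩
  on_goal 5 => refine ⟨-8 * X 0 ^ 3 * X 1, ![0, 0, -8 * X 0 * X 2, 0, 0, 0, 0, -X 3], ?_⟩
  on_goal 6 => refine ⟨0, ![0, 0, 0, 4 * X 0 * X 2, 0, -X 4, 0, 0], ?_⟩
  on_goal 7 => refine ⟨4 * X 0 * X 2 ^ 2, ![2 * X 0 * X 1, 0, 0, 0, X 2, 0, -X 4, 0], ?_⟩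
  all_goals
    refine ⟨by simp, by simp [Fin.forall_fin_succ], ?_⟩
    simp [Fin.sum_univ_succ, normalV, normalY, hessian, cubicCovariant, discriminant, Fin.rev]
    ring

lemma exists_isMulEntry_row_c (t : L) (c : Fin 4 → L) {j : Fin 8} (hj : 2 ≤ j) :
    ∃ (c₀ : MvPolynomial (Fin 5) K) (c' : Fin 8 → MvPolynomial (Fin 5) K),
      IsMulEntry (normalY 2⁻¹ t c) (normalV 2⁻¹ t c) 2 j c₀ c' := by
  fin_cases j
  iterate 2 exact absurd hj (by decide)
  on_goal 1 => refine ⟨0, ![X 2, 0, X 4, 0, 0, 0, 2 * X 0, 0], ?_⟩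
  on_goal 2 => refine ⟨0, ![0, X 2, 0, X 4, 0, 0, 0, X 0], ?_⟩
  on_goal 3 => refine ⟨-16 * X 0 ^ 3 * X 1, ![0, 0, -12 * X 0 * X 2, 0, X 4, 0, 0, -X 3], ?_⟩
  on_goal 4 => refine ⟨0, ![0, 0, 0, 0, 0, 0, 0, 0], ?_⟩
  on_goal 5 => refine ⟨0, ![2 * X 0 * X 1, 0, 0, 0, X 2, 0, 0, 0], ?_⟩
  on_goal 6 => refine ⟨0, ![0, 2 * X 0 * X 1, 0, 0, 0, X 2, 0, 0], ?_⟩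
  all_goals
    refine ⟨by simp, by simp [Fin.forall_fin_succ], ?_⟩
    simp [Fin.sum_univ_succ, normalV, normalY, hessian, cubicCovariant, discriminant, Fin.rev] <;>
    ring

lemma exists_isMulEntry_row_d (t : L) (c : Fin 4 → L) {j : Fin 8} (hj : 3 ≤ j) :
    ∃ (c₀ : MvPolynomial (Fin 5) K) (c' : Fin 8 → MvPolynomial (Fin 5) K),
      IsMulEntry (normalY 2⁻¹ t c) (normalV 2⁻¹ t c) 3 j c₀ c' := by
  fin_cases j
  iterate 3 exact absurd hj (by decide)
  on_goal 1 => refine ⟨X 0 ^ 2 * X 1, ![0, 0, X 2, 0, 0, 0, 0, 0], ?_⟩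
  on_goal 2 => refine ⟨X 0 * X 1 * X 3, ![0, 0, 0, 0, 0, 0, 0, 0], ?_⟩
  on_goal 3 => refine ⟨0, ![X 0 * X 1, 0, 0, 0, X 2, 0, 0, 0], ?_⟩
  on_goal 4 => refine ⟨0, ![0, X 0 * X 1, 0, 0, 0, X 2, 0, 0], ?_⟩
  on_goal 5 => refine ⟨-X 0 * X 1 * X 4, ![0, 0, X 0 * X 1, 0, 0, 0, X 2, 0], ?_⟩
  all_goals
    refine ⟨by simp, by simp [Fin.forall_fin_succ], ?_⟩
    simp [Fin.sum_univ_succ, normalV, normalY, hessian, cubicCovariant, discriminant, Fin.rev]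
    ring

lemma exists_isMulEntry_row_e (t : L) (c : Fin 4 → L) {j : Fin 8} (hj : 4 ≤ j) :
    ∃ (c₀ : MvPolynomial (Fin 5) K) (c' : Fin 8 → MvPolynomial (Fin 5) K),
      IsMulEntry (normalY 2⁻¹ t c) (normalV 2⁻¹ t c) 4 j c₀ c' := by
  fin_cases j
  iterate 4 exact absurd hj (by decide)
  on_goal 1 => refine ⟨X 1 * X 3 ^ 2, ![-16 * X 0 ^ 2 * X 1 - 4 * X 2 * X 4, 0, -4 * X 4 ^ 2,
      4 * X 2 * X 3, -12 * X 0 * X 2, 0, -8 * X 0 * X 4, 0], ?_⟩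
  on_goal 2 => refine ⟨4 * X 2 ^ 2 * X 3, ![-X 1 * X 3, -8 * X 0 ^ 2 * X 1 - 4 * X 2 * X 4, 0,
      -4 * X 4 ^ 2, 0, -12 * X 0 * X 2, 0, -4 * X 0 * X 4], ?_⟩
  on_goal 3 => refine ⟨0, ![-4 * X 2 ^ 2, -X 1 * X 3, -8 * X 0 ^ 2 * X 1 - 4 * X 2 * X 4, 0, 0,
      0, -8 * X 0 * X 2, 0], ?_⟩
  on_goal 4 => refine ⟨X 1 * X 3 * X 4, ![0, -4 * X 2 ^ 2, -X 1 * X 3, -16 * X 0 ^ 2 * X 1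
      - 4 * X 2 * X 4, 0, 0, 0, -4 * X 0 * X 2], ?_⟩
  all_goals
    refine ⟨by simp, by simp [Fin.forall_fin_succ], ?_⟩
    simp [Fin.sum_univ_succ, normalV, normalY, hessian, cubicCovariant, discriminant, Fin.rev]
    ring

lemma exists_isMulEntry_row_f (t : L) (c : Fin 4 → L) {j : Fin 8} (hj : 5 ≤ j) :
    ∃ (c₀ : MvPolynomial (Fin 5) K) (c' : Fin 8 → MvPolynomial (Fin 5) K),
      IsMulEntry (normalY 2⁻¹ t c) (normalV 2⁻¹ t c) 5 j c₀ c' := by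
  fin_cases j
  iterate 5 exact absurd hj (by decide)
  on_goal 1 => refine ⟨0, ![-4 * X 2 ^ 2, -X 1 * X 3, -4 * X 0 ^ 2 * X 1 - 4 * X 2 * X 4, 0, 0,
      0, -8 * X 0 * X 2, 0], ?_⟩
  on_goal 2 => refine ⟨X 1 * X 3 * X 4, ![0, -4 * X 2 ^ 2, -X 1 * X 3, -8 * X 0 ^ 2 * X 1
      - 4 * X 2 * X 4, 0, 0, 0, -4 * X 0 * X 2], ?_⟩
  on_goal 3 => refine ⟨-8 * X 0 ^ 2 * X 1 * X 2, ![-X 1 * X 4, 0, -4 * X 2 ^ 2, -X 1 * X 3,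
      X 0 * X 1, 0, 0, 0], ?_⟩
  all_goals
    refine ⟨by simp, by simp [Fin.forall_fin_succ], ?_⟩
    simp [Fin.sum_univ_succ, normalV, normalY, hessian, cubicCovariant, discriminant, Fin.rev]
    ring

lemma exists_isMulEntry_row_g (t : L) (c : Fin 4 → L) {j : Fin 8} (hj : 6 ≤ j) :
    ∃ (c₀ : MvPolynomial (Fin 5) K) (c' : Fin 8 → MvPolynomial (Fin 5) K),
      IsMulEntry (normalY 2⁻¹ t c) (normalV 2⁻¹ t c) 6 j c₀ c' := by
  fin_cases j
  iterate 6 exact absurd hj (by decide)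
  on_goal 1 => refine ⟨-4 * X 0 ^ 2 * X 1 * X 2, ![-X 1 * X 4, 0, -4 * X 2 ^ 2, -X 1 * X 3,
      X 0 * X 1, 0, 0, 0], ?_⟩
  on_goal 2 => refine ⟨-X 1 * X 2 * X 3, ![0, -X 1 * X 4, 0, -4 * X 2 ^ 2, 0, 2 * X 0 * X 1, 0,
      0], ?_⟩
  all_goals
    refine ⟨by simp, by simp [Fin.forall_fin_succ], ?_⟩
    simp [Fin.sum_univ_succ, normalV, normalY, hessian, cubicCovariant, discriminant, Fin.rev]
    ring

lemma exists_isMulEntry_row_h (t : L) (c : Fin 4 → L) {j : Fin 8} (hj : 7 ≤ j) :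
    ∃ (c₀ : MvPolynomial (Fin 5) K) (c' : Fin 8 → MvPolynomial (Fin 5) K),
      IsMulEntry (normalY 2⁻¹ t c) (normalV 2⁻¹ t c) 7 j c₀ c' := by
  fin_cases j
  iterate 7 exact absurd hj (by decide)
  on_goal 1 => refine ⟨-4 * X 2 ^ 3 + X 1 * X 4 ^ 2, ![X 1 * X 2, 0, -X 1 * X 4, 0, 0, 0,
      2 * X 0 * X 1, 0], ?_⟩
  all_goals
    refine ⟨by simp, by simp [Fin.forall_fin_succ], ?_⟩
    simp [Fin.sum_univ_succ, normalV, normalY, hessian, cubicCovariant, discriminant, Fin.rev]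
    ring

/-- The multiplication table of the generating invariants. -/
lemma exists_isMulEntry_normal (t : L) (c : Fin 4 → L) (i j : Fin 8) :
    ∃ (c₀ : MvPolynomial (Fin 5) K) (c' : Fin 8 → MvPolynomial (Fin 5) K),
      IsMulEntry (normalY 2⁻¹ t c) (normalV 2⁻¹ t c) i j c₀ c' := by
  have key : ∀ i j : Fin 8, i ≤ j →
      ∃ (c₀ : MvPolynomial (Fin 5) K) (c' : Fin 8 → MvPolynomial (Fin 5) K),
        IsMulEntry (normalY 2⁻¹ t c) (normalV 2⁻¹ t c) i j c₀ c' := by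
    intro i j hij
    fin_cases i
    exacts [exists_isMulEntry_row_a t c hij, exists_isMulEntry_row_b t c hij,
      exists_isMulEntry_row_c t c hij, exists_isMulEntry_row_d t c hij,
      exists_isMulEntry_row_e t c hij, exists_isMulEntry_row_f t c hij,
      exists_isMulEntry_row_g t c hij, exists_isMulEntry_row_h t c hij]
  rcases le_total i j with hij | hij
  · exact key i j hij
  · obtain ⟨c₀, c', h0, h1, h2⟩ := key j i hij
    refine ⟨c₀, c', h0, h1, ?_⟩
    rw [mul_comm, h2]
    simp only [← Fin.rev_eq_iff, eq_comm (a := j)]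

lemma IsMulEntry.of_injective {A B : Type*} [CommRing A] [Algebra K A] [CommRing B] [Algebra K B]
    {y : Fin 5 → A} {v : Fin 8 → A} (ι : A →ₐ[K] B) (hι : Function.Injective ι) {i j : Fin 8}
    {c₀ : MvPolynomial (Fin 5) K} {c : Fin 8 → MvPolynomial (Fin 5) K}
    (h : IsMulEntry (fun k => ι (y k)) (fun k => ι (v k)) i j c₀ c) : IsMulEntry y v i j c₀ c := by
  refine ⟨h.1, h.2.1, hι ?_⟩
  have h2 := h.2.2
  have hy : ∀ p : MvPolynomial (Fin 5) K, ι (aeval y p) = aeval (fun k => ι (y k)) p := fun p =>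
    comp_aeval_apply y ι p
  rw [map_mul, h2, map_add, map_add, map_sum]
  congr 1
  · congr 1
    · split_ifs <;> simp
    · exact (hy _).symm
  · exact Finset.sum_congr rfl fun k _ => by rw [map_mul, hy]

end Table

end SLInv
end

/-! ### Coordinates and the action of `SL₂` -/

noncomputable section
namespace SLInv

section Coordinates

set_option linter.unusedSectionVars false

variable {K : Type*} [Field K]

lemma formCoeff_binaryForm {e : ℕ} (c : Fin (e + 1) → K) : formCoeff e (binaryForm c) = c := by
  ext i
  have h : ∀ j : Fin (e + 1), C (c j) * X 0 ^ (e - (j : ℕ)) * X 1 ^ (j : ℕ) =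
      monomial (Finsupp.single (0 : Fin 2) (e - (j : ℕ)) + Finsupp.single 1 (j : ℕ)) (c j) := by
    intro j
    rw [monomial_add_single, monomial_eq, Finsupp.prod_single_index (by rw [pow_zero])]
  simp only [formCoeff, binaryForm, h, coeff_sum, coeff_monomial]
  rw [Finset.sum_eq_single i]
  · rw [if_pos rfl]
  · intro j _ hj
    rw [if_neg]
    intro h
    have := DFunLike.congr_fun h 1
    simp at this
    exact hj (Fin.ext this)
  · simp

lemma slAct_one (g : Matrix.SpecialLinearGroup (Fin 2) K) (c : Fin 2 → K) :
    slAct (e := 1) g c = ![c 0 * g.1 0 0 + c 1 * g.1 0 1, c 0 * g.1 1 0 + c 1 * g.1 1 1] := by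
  rw [slAct, ← formCoeff_binaryForm
    (e := 1) ![c 0 * g.1 0 0 + c 1 * g.1 0 1, c 0 * g.1 1 0 + c 1 * g.1 1 1]]
  congr 1
  simp [binaryForm, Fin.sum_univ_two]
  ring

lemma slAct_three (g : Matrix.SpecialLinearGroup (Fin 2) K) (a b : Fin 2 → K) (c : Fin 4 → K) :
    slAct (e := 3) g c = fun i => actCoord ![g.1 0 0, g.1 0 1, g.1 1 0, g.1 1 1]
      ![a 0, a 1, b 0, b 1, c 0, c 1, c 2, c 3] (Fin.natAdd 4 i) := by
  rw [slAct, ← formCoeff_binaryForm (e := 3) (fun i => actCoord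
    ![g.1 0 0, g.1 0 1, g.1 1 0, g.1 1 1] ![a 0, a 1, b 0, b 1, c 0, c 1, c 2, c 3]
      (Fin.natAdd 4 i))]
  congr 1
  simp [binaryForm, Fin.sum_univ_succ, actCoord, Fin.natAdd, map_ofNat]
  ring

/-- The coordinates of two linear forms and a cubic form as a vector. -/
def coords {R : Type*} (x : Coord ![1, 1, 3] → R) : Fin 8 → R :=
  ![x ⟨0, (0 : Fin 2)⟩, x ⟨0, (1 : Fin 2)⟩, x ⟨1, (0 : Fin 2)⟩, x ⟨1, (1 : Fin 2)⟩,
    x ⟨2, (0 : Fin 4)⟩, x ⟨2, (1 : Fin 4)⟩, x ⟨2, (2 : Fin 4)⟩, x ⟨2, (3 : Fin 4)⟩]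

/-- The point with given coordinates. -/
def ofCoords {R : Type*} (z : Fin 8 → R) : Coord ![1, 1, 3] → R :=
  fun q => z (Fin.ofNat 8 (2 * (q.1 : ℕ) + (q.2 : ℕ)))

lemma coords_ofCoords {R : Type*} (z : Fin 8 → R) : coords (ofCoords z) = z := by
  ext k
  fin_cases k <;> rfl

lemma ofCoords_coords {R : Type*} (x : Coord ![1, 1, 3] → R) : ofCoords (coords x) = x := by
  ext ⟨i, j⟩
  fin_cases i
  · change Fin 2 at j
    fin_cases j <;> rfl
  · change Fin 2 at j
    fin_cases j <;> rfl
  · change Fin 4 at j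
    fin_cases j <;> rfl

lemma comp_coords {R R' : Type*} (ψ : R → R') (x : Coord ![1, 1, 3] → R) :
    ψ ∘ coords x = coords (ψ ∘ x) := by
  ext k
  fin_cases k <;> rfl

/-- The vector of the entries of a matrix. -/
def matrixEntries (g : Matrix.SpecialLinearGroup (Fin 2) K) : Fin 4 → K :=
  ![g.1 0 0, g.1 0 1, g.1 1 0, g.1 1 1]

/-- The action of a matrix on a point. -/
def actPoint (g : Matrix.SpecialLinearGroup (Fin 2) K) (x : Coord ![1, 1, 3] → K) :
    Coord ![1, 1, 3] → K :=
  fun q => slAct g (fun j => x ⟨q.1, j⟩) q.2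

lemma coords_actPoint (g : Matrix.SpecialLinearGroup (Fin 2) K) (x : Coord ![1, 1, 3] → K) :
    coords (actPoint g x) = actCoord (matrixEntries g) (coords x) := by
  have h0 := fun j : Fin 2 => congrFun (slAct_one g (fun j => x ⟨0, j⟩)) j
  have h1 := fun j : Fin 2 => congrFun (slAct_one g (fun j => x ⟨1, j⟩)) j
  have h2 := fun j : Fin 4 => congrFun
    (slAct_three g (fun j => x ⟨0, j⟩) (fun j => x ⟨1, j⟩) (fun j => x ⟨2, j⟩)) j
  ext k
  fin_cases k
  exacts [h0 0, h0 1, h1 0, h1 1, h2 0, h2 1, h2 2, h2 3]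

lemma mem_invariants_iff {P : MvPolynomial (Coord ![1, 1, 3]) K} :
    P ∈ invariants K ![1, 1, 3] ↔ ∀ g x, eval (actPoint g x) P = eval x P :=
  ⟨fun h g x => h g fun i j => x ⟨i, j⟩, fun h g v => h g fun q => v q.1 q.2⟩

end Coordinates

/-! ### Invariance of the generators -/

section Invariance

set_option linter.unusedSectionVars false

variable (K : Type*) [Field K]

/-- The first five generating invariants. -/
def polyY (i : Fin 5) : MvPolynomial (Coord ![1, 1, 3]) K := genY (C 2⁻¹) (C 3⁻¹) (coords X) i

/-- The other generating invariants. -/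
def polyV (i : Fin 8) : MvPolynomial (Coord ![1, 1, 3]) K := genV (C 2⁻¹) (C 3⁻¹) (coords X) i

variable {K}

lemma aeval_polyY {A : Type*} [CommRing A] [Algebra K A] (x : Coord ![1, 1, 3] → A) (i : Fin 5) :
    aeval x (polyY K i) = genY (algebraMap K A 2⁻¹) (algebraMap K A 3⁻¹) (coords x) i := by
  have h := map_genY (aeval (R := K) x).toRingHom (C 2⁻¹) (C 3⁻¹) (coords X) i
  have h2 : (aeval (R := K) x).toRingHom ∘ coords X = coords x := by
    rw [comp_coords]
    congr 1
    ext q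
    simp
  rw [h2] at h
  simpa [polyY] using h

lemma aeval_polyV {A : Type*} [CommRing A] [Algebra K A] (x : Coord ![1, 1, 3] → A) (i : Fin 8) :
    aeval x (polyV K i) = genV (algebraMap K A 2⁻¹) (algebraMap K A 3⁻¹) (coords x) i := by
  have h := map_genV (aeval (R := K) x).toRingHom (C 2⁻¹) (C 3⁻¹) (coords X) i
  have h2 : (aeval (R := K) x).toRingHom ∘ coords X = coords x := by
    rw [comp_coords]
    congr 1
    ext q
    simp
  rw [h2] at h
  simpa [polyV] using h

variable [CharZero K]

/-- The invariants in normal form, over a field. -/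
lemma exists_gen_eq_normal {L : Type*} [Field L] [CharZero L] (z : Fin 8 → L)
    (hz : detForm z ≠ 0) :
    genY 2⁻¹ 3⁻¹ z = normalY 2⁻¹ (detForm z)
      (fun i => polarCubic (zeros z) (cubicCoeff 3⁻¹ z) i / detForm z ^ (i : ℕ)) ∧
    genV 2⁻¹ 3⁻¹ z = normalV 2⁻¹ (detForm z)
      (fun i => polarCubic (zeros z) (cubicCoeff 3⁻¹ z) i / detForm z ^ (i : ℕ)) :=
  gen_eq_normal (by simp) hz fun i => (mul_div_cancel₀ _ (pow_ne_zero _ hz)).symm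

lemma map_actCoord {R R' : Type*} [CommRing R] [CommRing R'] (ψ : R →+* R') (g : Fin 4 → R)
    (z : Fin 8 → R) : ψ ∘ actCoord g z = actCoord (ψ ∘ g) (ψ ∘ z) := by
  ext k
  fin_cases k <;> simp [actCoord, map_ofNat]

/-- The determinant of the linear forms and the cubic written in terms of their zeros do not change
under `SL₂`, and the generators depend on nothing else. -/
lemma gen_actCoord {L : Type*} [Field L] [CharZero L] (g : Fin 4 → L)
    (hg : g 0 * g 3 - g 1 * g 2 = 1) (z : Fin 8 → L) (hz : detForm z ≠ 0) :
    genY 2⁻¹ 3⁻¹ (actCoord g z) = genY 2⁻¹ 3⁻¹ z ∧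
      genV 2⁻¹ 3⁻¹ (actCoord g z) = genV 2⁻¹ 3⁻¹ z := by
  have h1 : detForm (actCoord g z) = detForm z := by rw [detForm_actCoord, hg, one_mul]
  have h2 : polarCubic (zeros (actCoord g z)) (cubicCoeff 3⁻¹ (actCoord g z))
      = polarCubic (zeros z) (cubicCoeff 3⁻¹ z) := by
    rw [cubicCoeff_actCoord (by simp), polarCubic_zeros_polarCubic, hg, one_pow, one_smul]
  obtain ⟨h3, h4⟩ := exists_gen_eq_normal z hz
  obtain ⟨h5, h6⟩ := exists_gen_eq_normal (actCoord g z) (h1 ▸ hz)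
  rw [h1, h2] at h5 h6
  exact ⟨h5.trans h3.symm, h6.trans h4.symm⟩

lemma detForm_coords_X_ne_zero :
    detForm (coords (X : Coord ![1, 1, 3] → MvPolynomial (Coord ![1, 1, 3]) K)) ≠ 0 := by
  intro h
  let z : Coord ![1, 1, 3] → K := fun q => if (q.1 : ℕ) = (q.2 : ℕ) then 1 else 0
  have := congrArg (eval z) h
  simp [detForm, coords, z] at this

instance charZero_fractionRing :
    CharZero (FractionRing (MvPolynomial (Coord ![1, 1, 3]) K)) :=
  charZero_of_injective_algebraMap
    (R := MvPolynomial (Coord ![1, 1, 3]) K) (IsFractionRing.injective _ _)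

variable (K) in
/-- The embedding of the polynomial functions into the rational functions. -/
def toFractions : MvPolynomial (Coord ![1, 1, 3]) K →ₐ[K]
    FractionRing (MvPolynomial (Coord ![1, 1, 3]) K) :=
  IsScalarTower.toAlgHom K _ _

lemma toFractions_injective : Function.Injective (toFractions K) :=
  IsFractionRing.injective (MvPolynomial (Coord ![1, 1, 3]) K) _

lemma toFractions_C_inv (n : ℕ) [n.AtLeastTwo] :
    toFractions K (C (OfNat.ofNat n : K)⁻¹) = (OfNat.ofNat n)⁻¹ := by
  rw [← algebraMap_eq, AlgHom.commutes, map_inv₀, map_ofNat]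

lemma toFractions_genY (z : Fin 8 → MvPolynomial (Coord ![1, 1, 3]) K) (i : Fin 5) :
    toFractions K (genY (C 2⁻¹) (C 3⁻¹) z i) = genY 2⁻¹ 3⁻¹ (toFractions K ∘ z) i := by
  have h := map_genY (toFractions K).toRingHom (C 2⁻¹) (C 3⁻¹) z i
  rw [← toFractions_C_inv 2, ← toFractions_C_inv 3]
  exact h

lemma toFractions_genV (z : Fin 8 → MvPolynomial (Coord ![1, 1, 3]) K) (i : Fin 8) :
    toFractions K (genV (C 2⁻¹) (C 3⁻¹) z i) = genV 2⁻¹ 3⁻¹ (toFractions K ∘ z) i := by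
  have h := map_genV (toFractions K).toRingHom (C 2⁻¹) (C 3⁻¹) z i
  rw [← toFractions_C_inv 2, ← toFractions_C_inv 3]
  exact h

lemma detForm_toFractions_ne_zero : detForm (toFractions K ∘ coords X) ≠ 0 := by
  have h := (map_ne_zero_iff _ (toFractions_injective (K := K))).2
    (detForm_coords_X_ne_zero (K := K))
  simpa [detForm] using h

/-- At the generic point the determinant is nonzero, so invariance over the fraction field descends
to an identity of polynomials. -/
lemma gen_actCoord_coords_X (g : Fin 4 → K) (hg : g 0 * g 3 - g 1 * g 2 = 1) :
    (∀ i, genY (C 2⁻¹) (C 3⁻¹) (actCoord (C ∘ g) (coords X)) i = polyY K i) ∧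
      ∀ i, genV (C 2⁻¹) (C 3⁻¹) (actCoord (C ∘ g) (coords X)) i = polyV K i := by
  obtain ⟨h1, h2⟩ := gen_actCoord (toFractions K ∘ C ∘ g) (by
    have := congrArg (toFractions K ∘ C) hg
    simpa using this) (toFractions K ∘ coords X) detForm_toFractions_ne_zero
  have h3 := map_actCoord (toFractions K).toRingHom (C ∘ g) (coords X)
  constructor
  · intro i
    apply toFractions_injective
    rw [polyY, toFractions_genY, toFractions_genY, ← h1]
    exact congrArg (fun z => genY 2⁻¹ 3⁻¹ z i) h3
  · intro i
    apply toFractions_injective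
    rw [polyV, toFractions_genV, toFractions_genV, ← h2]
    exact congrArg (fun z => genV 2⁻¹ 3⁻¹ z i) h3

lemma mem_invariants_of_aeval_ofCoords {P : MvPolynomial (Coord ![1, 1, 3]) K}
    (hP : ∀ g : Fin 4 → K, g 0 * g 3 - g 1 * g 2 = 1 →
      aeval (ofCoords (actCoord (C ∘ g) (coords X))) P = P) : P ∈ invariants K ![1, 1, 3] := by
  rw [mem_invariants_iff]
  intro g x
  have h1 := hP (matrixEntries g) (by
    have := g.2
    rw [Matrix.det_fin_two] at this
    simpa [matrixEntries] using this)
  have h2 := congrArg (eval x) h1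
  rw [← h2]
  change _ = aeval x (aeval (R := K) _ P)
  rw [comp_aeval_apply]
  suffices h : actPoint g x = fun q =>
      aeval x (ofCoords (actCoord (C ∘ matrixEntries g) (coords X)) q) by
    rw [h]; rfl
  ext1 q
  rw [← ofCoords_coords (actPoint g x), coords_actPoint]
  have h4 := map_actCoord (aeval (R := K) x).toRingHom (C ∘ matrixEntries g) (coords X)
  rw [comp_coords] at h4
  have h5 : (aeval (R := K) x).toRingHom ∘ C ∘ matrixEntries g = matrixEntries g := by
    ext i; simp
  have h6 : (aeval (R := K) x).toRingHom ∘ X = x := by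
    ext i; simp
  rw [h5, h6] at h4
  exact (congrFun h4 _).symm

lemma polyY_mem_invariants (i : Fin 5) : polyY K i ∈ invariants K ![1, 1, 3] :=
  mem_invariants_of_aeval_ofCoords fun g hg => by
    rw [aeval_polyY, coords_ofCoords]
    exact (gen_actCoord_coords_X g hg).1 i

lemma polyV_mem_invariants (i : Fin 8) : polyV K i ∈ invariants K ![1, 1, 3] :=
  mem_invariants_of_aeval_ofCoords fun g hg => by
    rw [aeval_polyV, coords_ofCoords]
    exact (gen_actCoord_coords_X g hg).2 i

end Invariance

end SLInv
end

/-! ### Generation up to powers of the determinant -/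

noncomputable section
namespace SLInv

section Saturation

set_option linter.unusedSectionVars false

variable (K : Type*) [Field K] [CharZero K]

/-- The algebra generated by the explicit invariants. -/
def genAlgebra : Subalgebra K (MvPolynomial (Coord ![1, 1, 3]) K) :=
  Algebra.adjoin K (Set.range (polyY K) ∪ Set.range (polyV K))

variable {K}

lemma polyY_mem_genAlgebra (i : Fin 5) : polyY K i ∈ genAlgebra K :=
  Algebra.subset_adjoin (Or.inl ⟨i, rfl⟩)

lemma polyV_mem_genAlgebra (i : Fin 8) : polyV K i ∈ genAlgebra K :=
  Algebra.subset_adjoin (Or.inr ⟨i, rfl⟩)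

/-- The coordinates of the normal form of a point. -/
def normalCoords (z : Fin 8 → K) : Fin 8 → K :=
  ![0, -1, detForm z, 0, polarCubic (zeros z) (cubicCoeff 3⁻¹ z) 0,
    3 * polarCubic (zeros z) (cubicCoeff 3⁻¹ z) 1 / detForm z,
    3 * polarCubic (zeros z) (cubicCoeff 3⁻¹ z) 2 / detForm z ^ 2,
    polarCubic (zeros z) (cubicCoeff 3⁻¹ z) 3 / detForm z ^ 3]

lemma exists_actPoint_eq (x : Coord ![1, 1, 3] → K) (hx : detForm (coords x) ≠ 0) :
    ∃ g, actPoint g x = ofCoords (normalCoords (coords x)) := by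
  set z := coords x with hz
  -- The rows are the zeros of the linear forms, the second divided by their determinant to reach
  -- determinant `1`. This moves the forms to `-y` and `t x`.
  let A : Matrix (Fin 2) (Fin 2) K := !![-z 1, z 0; -z 3 / detForm z, z 2 / detForm z]
  have hA : A.det = 1 := by
    have hd : z 0 * z 3 - z 1 * z 2 ≠ 0 := hx
    rw [Matrix.det_fin_two]
    simp only [A, detForm, Matrix.of_apply, Matrix.cons_val', Matrix.cons_val_zero,
      Matrix.cons_val_one, Matrix.cons_val_fin_one]
    field_simp
    ring
  let g : Matrix.SpecialLinearGroup (Fin 2) K := ⟨A, hA⟩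
  have hg : matrixEntries g = ![-z 1, z 0, -z 3 / detForm z, z 2 / detForm z] := rfl
  refine ⟨g, ?_⟩
  rw [← ofCoords_coords (actPoint g x), coords_actPoint, ← hz, hg]
  congr 1
  have h3 : (3 : K) ≠ 0 := by norm_num
  have hd : detForm z = z 0 * z 3 - z 1 * z 2 := rfl
  ext k
  fin_cases k
  · simp [actCoord, normalCoords]
    ring
  · simp [actCoord, normalCoords]
    field_simp
    rw [hd]; ring
  · simp [actCoord, normalCoords]
    rw [hd]; ring
  · simp [actCoord, normalCoords]
    field_simp
    ring
  · simp [actCoord, normalCoords, polarCubic, zeros, cubicCoeff]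
  · simp [actCoord, normalCoords, polarCubic, zeros, cubicCoeff]
    field_simp
  · simp [actCoord, normalCoords, polarCubic, zeros, cubicCoeff]
    field_simp
  · simp [actCoord, normalCoords, polarCubic, zeros, cubicCoeff]
    field_simp

/-- The normal coordinates have at most the denominator `t^3` with `t = 2 y_0`, whence the exponent.
The last one is `(y_4 - v_2) / t^3`, because `y_4` is the sum of the needed cubic coefficient and
`v_2`. -/
lemma exists_normalCoords_eq (k : Fin 8) : ∃ Q ∈ genAlgebra K, ∀ x : Coord ![1, 1, 3] → K,
    detForm (coords x) ≠ 0 →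
      eval x (polyY K 0) ^ 3 * normalCoords (coords x) k = eval x Q := by
  have hY : ∀ x i, eval x (polyY K i) = genY 2⁻¹ 3⁻¹ (coords x) i := fun x i =>
    aeval_polyY (K := K) x i
  have hV : ∀ x i, eval x (polyV K i) = genV 2⁻¹ 3⁻¹ (coords x) i := fun x i =>
    aeval_polyV (K := K) x i
  have my := fun i => polyY_mem_genAlgebra (K := K) i
  have mv := fun i => polyV_mem_genAlgebra (K := K) i
  have mC := fun r : K => Subalgebra.algebraMap_mem (genAlgebra K) r
  fin_cases k
  · exact ⟨0, zero_mem _, fun x hx => by simp [normalCoords]⟩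
  · refine ⟨-polyY K 0 ^ 3, neg_mem (pow_mem (my 0) 3), fun x hx => ?_⟩
    simp [normalCoords]
  · refine ⟨C 2 * polyY K 0 ^ 4, mul_mem (mC _) (pow_mem (my 0) 4), fun x hx => ?_⟩
    simp [normalCoords, hY, genY]
    ring
  · exact ⟨0, zero_mem _, fun x hx => by simp [normalCoords]⟩
  · refine ⟨polyY K 0 ^ 3 * polyY K 3, mul_mem (pow_mem (my 0) 3) (my 3), fun x hx => ?_⟩
    simp [normalCoords, hY, genY]
  · refine ⟨C (-3 / 2) * (polyY K 0 ^ 2 * polyV K 0),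
      mul_mem (mC _) (mul_mem (pow_mem (my 0) 2) (mv 0)), fun x hx => ?_⟩
    simp [normalCoords, hY, hV, genY, genV]
    field_simp
  · refine ⟨C (-3 / 4) * (polyY K 0 * polyV K 1),
      mul_mem (mC _) (mul_mem (my 0) (mv 1)), fun x hx => ?_⟩
    simp [normalCoords, hY, hV, genY, genV]
    field_simp
    ring
  · refine ⟨C (1 / 8) * (polyY K 4 - polyV K 2),
      mul_mem (mC _) (sub_mem (my 4) (mv 2)), fun x hx => ?_⟩
    simp [normalCoords, hY, hV, genY, genV]
    field_simp
    ring

lemma exists_eval_normalCoords_eq (P : MvPolynomial (Coord ![1, 1, 3]) K) :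
    ∃ N : ℕ, ∃ Q ∈ genAlgebra K, ∀ x : Coord ![1, 1, 3] → K, detForm (coords x) ≠ 0 →
      eval x (polyY K 0) ^ N * eval (ofCoords (normalCoords (coords x))) P = eval x Q := by
  have my := polyY_mem_genAlgebra (K := K) 0
  induction P using MvPolynomial.induction_on with
  | C r => exact ⟨0, C r, Subalgebra.algebraMap_mem _ r, fun x _ => by simp⟩
  | add p q hp hq =>
    obtain ⟨N, Q, hQ, h⟩ := hp
    obtain ⟨N', Q', hQ', h'⟩ := hq
    refine ⟨N + N', polyY K 0 ^ N' * Q + polyY K 0 ^ N * Q',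
      add_mem (mul_mem (pow_mem my _) hQ) (mul_mem (pow_mem my _) hQ'), fun x hx => ?_⟩
    simp only [map_add, map_mul, map_pow, ← h x hx, ← h' x hx]
    ring
  | mul_X p q hp =>
    obtain ⟨N, Q, hQ, h⟩ := hp
    obtain ⟨Q', hQ', h'⟩ := exists_normalCoords_eq (K := K)
      (Fin.ofNat 8 (2 * (q.1 : ℕ) + (q.2 : ℕ)))
    refine ⟨N + 3, Q * Q', mul_mem hQ hQ', fun x hx => ?_⟩
    simp only [map_mul, eval_X, ← h x hx, ← h' x hx]
    rw [ofCoords]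
    ring

/-- Up to a power of the determinant of the linear forms, every invariant is a polynomial in the
generators. -/
lemma exists_pow_mul_mem_genAlgebra {P : MvPolynomial (Coord ![1, 1, 3]) K}
    (hP : P ∈ invariants K ![1, 1, 3]) : ∃ N : ℕ, polyY K 0 ^ N * P ∈ genAlgebra K := by
  obtain ⟨N, Q, hQ, h⟩ := exists_eval_normalCoords_eq P
  refine ⟨N, ?_⟩
  suffices h2 : polyY K 0 ^ N * P = Q by rwa [h2]
  -- The extra factor makes the identity trivial where the determinant vanishes. Elsewhere the
  -- invariant `P` may be evaluated at the normal form of the point.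
  apply mul_left_cancel₀ (detForm_coords_X_ne_zero (K := K))
  apply MvPolynomial.funext
  intro x
  have h3 : eval x (detForm (coords X)) = detForm (coords x) := by
    simp [detForm, coords]
  rw [map_mul (eval x) _ (_ * _), map_mul (eval x) _ Q, h3]
  by_cases hx : detForm (coords x) = 0
  · rw [hx, zero_mul, zero_mul]
  · obtain ⟨g, hg⟩ := exists_actPoint_eq x hx
    rw [← h x hx, ← hg, mem_invariants_iff.1 hP g x, map_mul, map_pow]

end Saturation

/-! ### Degrees of the generators -/

section Homogeneous

variable {K : Type*} [Field K] [CharZero K]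

/-- Scaling by `2` alone separates the degrees, because the powers of `2` are distinct in
characteristic 0. -/
lemma isHomogeneous_of_eval_two_mul {σ : Type*} {P : MvPolynomial σ K} {d : ℕ}
    (h : ∀ x : σ → K, eval (fun i => 2 * x i) P = 2 ^ d * eval x P) : P.IsHomogeneous d := by
  classical
  have h1 : ∑ m ∈ P.support, monomial m (2 ^ m.degree * coeff m P) = C (2 ^ d) * P := by
    apply MvPolynomial.funext
    intro x
    rw [map_mul, eval_C, ← h x, map_sum, eval_eq]
    refine Finset.sum_congr rfl fun m _ => ?_
    rw [eval_monomial, Finsupp.prod, Finset.prod_congr rfl fun i _ => mul_pow 2 (x i) (m i),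
      Finset.prod_mul_distrib, Finset.prod_pow_eq_pow_sum, Finsupp.degree_apply]
    ring
  rw [← mem_homogeneousSubmodule]
  intro m hm
  have h2 := congrArg (coeff m) h1
  simp only [coeff_sum, coeff_C_mul, coeff_monomial] at h2
  rw [Finset.sum_ite_eq' P.support m, if_pos (mem_support_iff.2 hm)] at h2
  have h3 := mul_right_cancel₀ hm h2
  have h4 : m.degree = d := Nat.pow_right_injective le_rfl (by exact_mod_cast h3)
  rwa [Finsupp.degree_eq_weight_one] at h4

/-- The degrees of the first five generating invariants. -/
def degY : Fin 5 → ℕ := ![2, 4, 4, 4, 4]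

lemma polyY_isHomogeneous (i : Fin 5) : (polyY K i).IsHomogeneous (degY i) := by
  refine isHomogeneous_of_eval_two_mul fun x => ?_
  have h1 := aeval_polyY (K := K) x i
  have h2 := aeval_polyY (K := K) (fun q => 2 * x q) i
  rw [show coords (fun q => 2 * x q) = fun k => 2 * coords x k from
    (comp_coords (fun r => 2 * r) x).symm] at h2
  refine (h2.trans ?_).trans (congrArg (2 ^ degY i * ·) h1.symm)
  generalize coords x = z
  fin_cases i <;> simp [genY, degY, detForm, discriminant, cubicCoeff, polarQuadratic, hessian,
    polarCubic, zeros] <;> ring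

lemma polyV_isHomogeneous (i : Fin 8) : (polyV K i).IsHomogeneous (artDeg i) := by
  refine isHomogeneous_of_eval_two_mul fun x => ?_
  have h1 := aeval_polyV (K := K) x i
  have h2 := aeval_polyV (K := K) (fun q => 2 * x q) i
  rw [show coords (fun q => 2 * x q) = fun k => 2 * coords x k from
    (comp_coords (fun r => 2 * r) x).symm] at h2
  refine (h2.trans ?_).trans (congrArg (2 ^ artDeg i * ·) h1.symm)
  generalize coords x = z
  fin_cases i <;> simp [genV, artDeg, cubicCoeff, polarQuadratic, hessian, cubicCovariant,
    polarCubic, zeros] <;> ring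

end Homogeneous

end SLInv
end

/-! ### Combinations of the basis elements form a ring -/

noncomputable section
namespace SLInv

section Combinations

set_option linter.unusedSectionVars false

variable {K : Type*} [Field K] {A : Type*} [CommRing A] [Algebra K A]

/-- Linear combinations of the `b e` with polynomials in the `y i` as coefficients. -/
def polyComb {ι σ : Type*} (y : σ → A) (b : ι → A) :
    (ι →₀ MvPolynomial σ K) →ₗ[K] A :=
  Finsupp.lsum K fun e => (LinearMap.mulRight K (b e)).comp (aeval y).toLinearMap

section

variable {ι σ : Type*} {y : σ → A} {b : ι → A}

@[simp] lemma polyComb_single (e : ι) (p : MvPolynomial (σ) K) :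
    polyComb y b (Finsupp.single e p) = aeval y p * b e := by
  simp [polyComb]

lemma polyComb_apply [Fintype ι] (c : ι →₀ MvPolynomial (σ) K) :
    polyComb y b c = ∑ e, aeval y (c e) * b e := by
  rw [polyComb, Finsupp.lsum_apply, Finsupp.sum_fintype]
  · rfl
  · simp

lemma polyComb_smul (p : MvPolynomial (σ) K) (c : ι →₀ MvPolynomial (σ) K) :
    polyComb y b (p • c) = aeval y p * polyComb y b c := by
  induction c using Finsupp.induction_linear with
  | zero => simp
  | add c d hc hd => rw [smul_add, map_add, map_add, hc, hd, mul_add]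
  | single e q => rw [Finsupp.smul_single, polyComb_single, polyComb_single, smul_eq_mul, map_mul,
      mul_assoc]

lemma map_polyComb {A' : Type*} [CommRing A'] [Algebra K A'] (ψ : A →ₐ[K] A')
    (c : ι →₀ MvPolynomial (σ) K) :
    ψ (polyComb y b c) = polyComb (fun i => ψ (y i)) (fun e => ψ (b e)) c := by
  induction c using Finsupp.induction_linear with
  | zero => simp
  | add c d hc hd => rw [map_add, map_add, map_add, hc, hd]
  | single e q => rw [polyComb_single, polyComb_single, map_mul, comp_aeval_apply]

end

variable {ι : Type*} {y : Fin 5 → A} {b : ι → A}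

/-- The combinations with coefficients without constant term. -/
def positiveComb (K : Type*) [Field K] [Algebra K A] (y : Fin 5 → A) (b : ι → A) :
    Submodule K A :=
  Submodule.map (polyComb y b)
    { carrier := {c : ι →₀ MvPolynomial (Fin 5) K | ∀ e, constantCoeff (c e) = 0}
      add_mem' := fun {c d} hc hd e => by
        rw [Finsupp.add_apply, map_add, hc e, hd e, add_zero]
      zero_mem' := fun e => by simp
      smul_mem' := fun r c hc e => by
        rw [Finsupp.smul_apply, constantCoeff_smul, hc e, smul_zero] }

lemma mem_positiveComb {x : A} : x ∈ positiveComb K y b ↔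
    ∃ c : ι →₀ MvPolynomial (Fin 5) K, (∀ e, constantCoeff (c e) = 0) ∧ polyComb y b c = x :=
  Iff.rfl

lemma positiveComb_le : positiveComb K y b ≤ LinearMap.range (polyComb (K := K) y b) := by
  rintro _ ⟨c, _, rfl⟩
  exact ⟨c, rfl⟩

lemma aeval_mul_mem_range (p : MvPolynomial (Fin 5) K) {x : A}
    (hx : x ∈ LinearMap.range (polyComb (K := K) y b)) :
    aeval y p * x ∈ LinearMap.range (polyComb (K := K) y b) := by
  obtain ⟨c, rfl⟩ := hx
  exact ⟨p • c, polyComb_smul p c⟩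

lemma aeval_mul_mem_positiveComb {p : MvPolynomial (Fin 5) K} (hp : constantCoeff p = 0) {x : A}
    (hx : x ∈ LinearMap.range (polyComb (K := K) y b)) :
    aeval y p * x ∈ positiveComb K y b := by
  obtain ⟨c, rfl⟩ := hx
  refine mem_positiveComb.2 ⟨p • c, fun e => ?_, polyComb_smul p c⟩
  rw [Finsupp.smul_apply, smul_eq_mul, map_mul, hp, zero_mul]

lemma mem_range_polyComb (e : ι) : b e ∈ LinearMap.range (polyComb (K := K) y b) :=
  ⟨Finsupp.single e 1, by simp⟩

/-- The elements `1`, `v k` and `v 2 * v 5`. -/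
def tableBasis (v : Fin 8 → A) : Fin 8 ⊕ Bool → A :=
  Sum.elim v fun s => if s then v 2 * v 5 else 1

variable {v : Fin 8 → A}

variable (K) in
/-- The products of the `v k` are given by a multiplication table. -/
def HasMulTable (y : Fin 5 → A) (v : Fin 8 → A) : Prop :=
  ∀ i j, ∃ (c₀ : MvPolynomial (Fin 5) K) (c : Fin 8 → MvPolynomial (Fin 5) K),
    IsMulEntry y v i j c₀ c

lemma mem_range_tableBasis (k : Fin 8) :
    v k ∈ LinearMap.range (polyComb (K := K) y (tableBasis v)) :=
  mem_range_polyComb (b := tableBasis v) (Sum.inl k)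

lemma one_mem_range_tableBasis :
    1 ∈ LinearMap.range (polyComb (K := K) y (tableBasis v)) := by
  simpa [tableBasis] using mem_range_polyComb (K := K) (y := y) (b := tableBasis v) (Sum.inr false)

lemma socle_mem_range_tableBasis :
    v 2 * v 5 ∈ LinearMap.range (polyComb (K := K) y (tableBasis v)) := by
  simpa [tableBasis] using mem_range_polyComb (K := K) (y := y) (b := tableBasis v) (Sum.inr true)

lemma HasMulTable.mul_sub_mem (h : HasMulTable K y v) (i j : Fin 8) :
    v i * v j - (if j = Fin.rev i then v 2 * v 5 else 0) ∈ positiveComb K y (tableBasis v) := by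
  obtain ⟨c₀, c, h0, h1, h2⟩ := h i j
  rw [h2, add_assoc, add_sub_cancel_left]
  refine add_mem ?_ (sum_mem fun k _ => aeval_mul_mem_positiveComb (h1 k) (mem_range_tableBasis k))
  simpa using aeval_mul_mem_positiveComb h0 (one_mem_range_tableBasis (K := K) (y := y) (v := v))

lemma HasMulTable.mul_mem (h : HasMulTable K y v) (i j : Fin 8) :
    v i * v j ∈ LinearMap.range (polyComb (K := K) y (tableBasis v)) := by
  have h1 := positiveComb_le (h.mul_sub_mem i j)
  have h2 : (if j = Fin.rev i then v 2 * v 5 else 0) ∈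
      LinearMap.range (polyComb (K := K) y (tableBasis v)) := by
    split_ifs
    exacts [socle_mem_range_tableBasis, zero_mem _]
  simpa using add_mem h1 h2

/-- The product is bracketed so that `v_k` first meets a factor with which it does not pair: `v_2`
if `k = 2`, and `v_5` otherwise. The inner product then already has coefficients without constant
term. -/
lemma HasMulTable.socle_mul_mem (h : HasMulTable K y v) (k : Fin 8) :
    v 2 * v 5 * v k ∈ positiveComb K y (tableBasis v) := by
  have key : ∀ i j : Fin 8, k ≠ Fin.rev j →
      v i * (v j * v k) ∈ positiveComb K y (tableBasis v) := by
    intro i j hk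
    obtain ⟨c₀, c, h0, h1, h2⟩ := h j k
    rw [h2, if_neg hk, zero_add, mul_add, Finset.mul_sum, mul_comm (v i)]
    refine add_mem (aeval_mul_mem_positiveComb h0 (mem_range_tableBasis i))
      (sum_mem fun l _ => ?_)
    rw [mul_left_comm]
    exact aeval_mul_mem_positiveComb (h1 l) (h.mul_mem i l)
  by_cases hk : k = 2
  · rw [mul_comm (v 2), mul_assoc]
    exact key 5 2 (by rw [hk]; decide)
  · rw [mul_assoc]
    exact key 2 5 hk

lemma HasMulTable.mul_comb_mem (h : HasMulTable K y v) (k : Fin 8) {x : A}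
    (hx : x ∈ LinearMap.range (polyComb (K := K) y (tableBasis v))) :
    v k * x ∈ LinearMap.range (polyComb (K := K) y (tableBasis v)) := by
  obtain ⟨c, rfl⟩ := hx
  rw [polyComb_apply, Finset.mul_sum]
  refine sum_mem fun e _ => ?_
  rw [mul_left_comm]
  refine aeval_mul_mem_range _ ?_
  rcases e with l | _ | _
  · exact h.mul_mem k l
  · simpa [tableBasis] using mem_range_tableBasis k
  · simpa [tableBasis, mul_comm] using positiveComb_le (h.socle_mul_mem k)

/-- The span contains `1` and is stable under multiplication by every generator. -/
lemma HasMulTable.adjoin_le (h : HasMulTable K y v) {x : A}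
    (hx : x ∈ Algebra.adjoin K (Set.range y ∪ Set.range v)) :
    x ∈ LinearMap.range (polyComb (K := K) y (tableBasis v)) := by
  have key : ∀ z ∈ LinearMap.range (polyComb (K := K) y (tableBasis v)),
      x * z ∈ LinearMap.range (polyComb (K := K) y (tableBasis v)) := by
    induction hx using Algebra.adjoin_induction with
    | mem x hx =>
      intro z hz
      rcases hx with ⟨i, rfl⟩ | ⟨k, rfl⟩
      · simpa using aeval_mul_mem_range (X i) hz
      · exact h.mul_comb_mem k hz
    | algebraMap r =>
      intro z hz
      rw [← Algebra.smul_def]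
      exact Submodule.smul_mem _ r hz
    | add x x' _ _ hx hx' =>
      intro z hz
      rw [add_mul]
      exact add_mem (hx z hz) (hx' z hz)
    | mul x x' _ _ hx hx' =>
      intro z hz
      rw [mul_assoc]
      exact hx _ (hx' z hz)
  simpa using key 1 one_mem_range_tableBasis

end Combinations

section PolynomialTable

variable {K : Type*} [Field K] [CharZero K]

/-- The entries are identities between polynomials, so the fraction field suffices. There the
determinant is invertible and the normal form applies. -/
lemma hasMulTable_poly : HasMulTable K (polyY K) (polyV K) := by
  intro i j
  obtain ⟨h1, h2⟩ := exists_gen_eq_normal (toFractions K ∘ coords X) detForm_toFractions_ne_zero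
  obtain ⟨c₀, c, h⟩ := exists_isMulEntry_normal (K := K) (detForm (toFractions K ∘ coords X))
    (fun i => polarCubic (zeros (toFractions K ∘ coords X))
      (cubicCoeff 3⁻¹ (toFractions K ∘ coords X)) i / detForm (toFractions K ∘ coords X) ^ (i : ℕ))
    i j
  refine ⟨c₀, c, IsMulEntry.of_injective (toFractions K) toFractions_injective ?_⟩
  rw [← h1, ← h2] at h
  have hY : (fun k => toFractions K (polyY K k)) = genY 2⁻¹ 3⁻¹ (toFractions K ∘ coords X) :=
    _root_.funext fun k => toFractions_genY _ k
  have hV : (fun k => toFractions K (polyV K k)) = genV 2⁻¹ 3⁻¹ (toFractions K ∘ coords X) :=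
    _root_.funext fun k => toFractions_genV _ k
  rw [hY, hV]
  exact h

end PolynomialTable

end SLInv
end

/-! ### Independence at points with proportional linear forms -/

noncomputable section
namespace SLInv

section Independence

/-- Products of independent families in a tower are independent, also when the inner family depends
on the outer index. Here the factor in the inner variable depends on the parity of the degree in the
outer one. -/
lemma linearIndependent_smul_family {R S M : Type*} [Ring R] [Ring S] [AddCommGroup M]
    [Module R S] [Module S M] [Module R M] [IsScalarTower R S M] {ι κ : Type*} {b : ι → κ → S}
    (hb : ∀ i, LinearIndependent R (b i)) {c : ι → M} (hc : LinearIndependent S c) :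
    LinearIndependent R fun p : ι × κ => b p.1 p.2 • c p.1 := by
  classical
  rw [linearIndependent_iff'] at hc ⊢
  intro s g hg p hp
  let g' : ι × κ → R := fun p => if p ∈ s then g p else 0
  have h1 : ∑ i ∈ s.image Prod.fst, (∑ k ∈ s.image Prod.snd, g' (i, k) • b i k) • c i = 0 := by
    rw [← hg]
    simp only [Finset.sum_smul, smul_assoc]
    rw [← Finset.sum_product' (s.image Prod.fst) (s.image Prod.snd)
      (fun i k => g' (i, k) • b i k • c i)]
    symm
    apply Finset.sum_subset_zero_on_sdiff Finset.subset_product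
    · intro q hq
      simp only [g', if_neg (Finset.mem_sdiff.1 hq).2, zero_smul]
    · intro q hq
      simp only [g', if_pos hq]
  have h2 := hc _ _ h1 p.1 (Finset.mem_image_of_mem _ hp)
  have h3 := linearIndependent_iff'.1 (hb p.1) _ _ h2 p.2 (Finset.mem_image_of_mem _ hp)
  simpa [g', hp] using h3

/-- The sequence of the products of powers of a polynomial `φ` of degree `d` with polynomials of
degrees `0, …, d - 1`. -/
def powerSequence {R : Type*} [CommRing R] [IsDomain R] {d : ℕ} [NeZero d] (φ : Polynomial R)
    (hφ : φ.degree = d) (w : Fin d → Polynomial R) (hw : ∀ j, (w j).degree = (j : ℕ)) :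
    Polynomial.Sequence R where
  elems' n := φ ^ (n / d) * w ⟨n % d, Nat.mod_lt n (NeZero.pos d)⟩
  degree_eq' n := by
    rw [Polynomial.degree_mul, Polynomial.degree_pow, hφ, hw, nsmul_eq_mul]
    norm_cast
    exact Nat.div_add_mod' n d

lemma powerSequence_apply {R : Type*} [CommRing R] [IsDomain R] {d : ℕ} [NeZero d]
    (φ : Polynomial R) (hφ : φ.degree = d) (w : Fin d → Polynomial R)
    (hw : ∀ j, (w j).degree = (j : ℕ)) (i : ℕ) (j : Fin d) :
    powerSequence φ hφ w hw (d * i + j) = φ ^ i * w j := by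
  change φ ^ ((d * i + j) / d) * w ⟨(d * i + j) % d, _⟩ = _
  congr 2
  · rw [Nat.mul_add_div (NeZero.pos d), Nat.div_eq_of_lt j.2, add_zero]
  · ext
    simp [Nat.mod_eq_of_lt j.2]

variable {K F : Type*} [Field K] [Field F] [Algebra K F] (α : Fin 2 → F)

/-- The common value of the coefficient of the Hessian at a special point. -/
def specialHess : Polynomial F :=
  Polynomial.C (α 1) - Polynomial.C (α 0) * Polynomial.X ^ 3

/-- The quadratic coefficient of the cubic form at a special point. -/
def specialQuad : Polynomial F := Polynomial.C (α 0)⁻¹ * specialHess α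

/-- The coordinates of a point where the two linear forms are proportional. -/
def specialCoords : Fin 8 → Polynomial (Polynomial F) :=
  ![0, -1, 0, -Polynomial.C (Polynomial.X : Polynomial F),
    Polynomial.C (Polynomial.C (α 0)), 0, 3 * Polynomial.C (specialQuad α), Polynomial.X]

/-- The value of the discriminant at the special point. -/
def specialDisc : Polynomial (Polynomial F) :=
  Polynomial.C (Polynomial.C (α 0 ^ 2)) * Polynomial.X ^ 2 +
    Polynomial.C (4 * Polynomial.C (α 0) * (specialQuad α) ^ 3)

lemma degree_specialDisc (hα : α 0 ≠ 0) : (specialDisc α).degree = (2 : ℕ) := by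
  have h : Polynomial.C (α 0 ^ 2) ≠ 0 := by
    simp [hα]
  rw [specialDisc, Polynomial.degree_add_eq_left_of_degree_lt]
  · exact Polynomial.degree_C_mul_X_pow 2 h
  · rw [Polynomial.degree_C_mul_X_pow 2 h]
    exact Polynomial.degree_C_le.trans_lt (by norm_num)

lemma degree_specialHess (hα : α 0 ≠ 0) : (specialHess α).degree = (3 : ℕ) := by
  rw [specialHess, Polynomial.degree_sub_eq_right_of_degree_lt]
  · exact Polynomial.degree_C_mul_X_pow 3 (hα)
  · rw [Polynomial.degree_C_mul_X_pow 3 (hα)]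
    exact Polynomial.degree_C_le.trans_lt (by norm_num)

/-- The values of the basis elements at the special point, up to powers of the last variable. -/
def specialBasis : Fin 2 → Fin 5 → Polynomial F :=
  ![![1, Polynomial.C (-α 0) * Polynomial.X, Polynomial.C (-α 0) * Polynomial.X ^ 2,
      specialHess α, specialHess α * Polynomial.X],
    ![Polynomial.C (α 0 ^ 2), Polynomial.C (α 0 ^ 2) * Polynomial.X,
      Polynomial.C (α 0 ^ 2) * Polynomial.X ^ 2, Polynomial.C (α 0 ^ 2) * Polynomial.X ^ 3,
      Polynomial.C (α 0 ^ 2) * (specialHess α * Polynomial.X)]]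

lemma degree_specialBasis (hα : α 0 ≠ 0) (i : Fin 2) (j : Fin 5) :
    (specialBasis α i j).degree = ((j : ℕ) : WithBot ℕ) := by
  fin_cases i <;> fin_cases j <;>
    simp [specialBasis, Polynomial.degree_mul, Polynomial.degree_C, hα, degree_specialHess α hα]
  all_goals norm_num

/-- The position of a basis element. -/
def slot : Fin 8 ⊕ Bool → Fin 2 × Fin 5 :=
  Sum.elim ![(0, 1), (0, 2), (0, 3), (0, 4), (1, 0), (1, 1), (1, 2), (1, 3)]
    fun s => if s then (1, 4) else (0, 0)

lemma slot_injective : Function.Injective slot := by decide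

/-- The products of the powers of an invariant with basis elements at the special point. -/
def specialSequence (hα : α 0 ≠ 0) (i : Fin 2) : Polynomial.Sequence F :=
  powerSequence (d := 5) (specialHess α * Polynomial.X ^ 2)
    (by rw [Polynomial.degree_mul, degree_specialHess α hα, Polynomial.degree_X_pow]; norm_num)
    (specialBasis α i) (degree_specialBasis α hα i)

/-- The products of the powers of the discriminant with `1` and the variable. -/
def discSequence (hα : α 0 ≠ 0) : Polynomial.Sequence (Polynomial F) :=
  powerSequence (d := 2) (specialDisc α) (degree_specialDisc α hα) ![1, Polynomial.X]
    (fun j => by fin_cases j <;> simp)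

/-- The family of all products of monomials in the parameters and powers with basis elements. -/
def specialFamily (hα : α 0 ≠ 0) (p : ℕ × ((Fin 2 →₀ ℕ) × ℕ)) : Polynomial (Polynomial F) :=
  ((α 0 ^ p.2.1 0 * α 1 ^ p.2.1 1) • specialSequence α hα (Fin.ofNat 2 p.1) p.2.2) •
    discSequence α hα p.1

lemma linearIndependent_specialFamily (hα : α 0 ≠ 0)
    (h : LinearIndependent K fun κ : Fin 2 →₀ ℕ => α 0 ^ κ 0 * α 1 ^ κ 1) :
    LinearIndependent K (specialFamily α hα) := by
  have h1 := fun n : ℕ => linearIndependent_smul (R := K) (S := F) (A := Polynomial F) h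
    (specialSequence α hα (Fin.ofNat 2 n)).linearIndependent
  exact linearIndependent_smul_family (R := K) (S := Polynomial F)
    (M := Polynomial (Polynomial F)) h1 (discSequence α hα).linearIndependent

/-- The position of a product in the family. -/
def familyIndex (p : Σ _ : Fin 8 ⊕ Bool, Fin 4 →₀ ℕ) : ℕ × ((Fin 2 →₀ ℕ) × ℕ) :=
  (2 * p.2 0 + (slot p.1).1, (Finsupp.single 0 (p.2 2) + Finsupp.single 1 (p.2 3),
    5 * p.2 1 + (slot p.1).2))

/-- Division with remainder: the outer position modulo `2` and the inner position modulo `5`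
determine the slot, and the quotients are the exponents of `y_1` and `y_2`. -/
lemma familyIndex_injective : Function.Injective familyIndex := by
  rintro ⟨e, m⟩ ⟨e', m'⟩ h
  simp only [familyIndex, Prod.mk.injEq] at h
  obtain ⟨h1, h2, h3⟩ := h
  have h4 := DFunLike.congr_fun h2 0
  have h5 := DFunLike.congr_fun h2 1
  simp at h4 h5
  have b1 := (slot e).1.2
  have b2 := (slot e').1.2
  have b3 := (slot e).2.2
  have b4 := (slot e').2.2
  have h6 : e = e' := slot_injective (Prod.ext (Fin.ext (by omega)) (Fin.ext (by omega)))
  subst h6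
  have h7 : m = m' := by
    ext i
    fin_cases i
    · change m 0 = m' 0; omega
    · change m 1 = m' 1; omega
    · exact h4
    · exact h5
  rw [h7]

/-- The values of four of the invariants at the special point. -/
def specialY : Fin 4 → Polynomial (Polynomial F) :=
  ![specialDisc α, Polynomial.C (specialHess α * Polynomial.X ^ 2),
    Polynomial.C (Polynomial.C (α 0)), Polynomial.C (Polynomial.C (α 1))]

lemma specialFamily_familyIndex (hα : α 0 ≠ 0) (p : Σ _ : Fin 8 ⊕ Bool, Fin 4 →₀ ℕ) :
    specialFamily α hα (familyIndex p) = aeval (specialY α) (monomial p.2 (1 : K)) *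
      (Polynomial.X ^ ((slot p.1).1 : ℕ) *
        Polynomial.C (specialBasis α (slot p.1).1 (slot p.1).2)) := by
  obtain ⟨e, m⟩ := p
  have h1 : Fin.ofNat 2 (2 * m 0 + (slot e).1) = (slot e).1 := by
    ext
    simp [Nat.mod_eq_of_lt (slot e).1.2]
  have h2 : (Finsupp.single 0 (m 2) + Finsupp.single 1 (m 3) : Fin 2 →₀ ℕ) 0 = m 2 := by simp
  have h2' : (Finsupp.single 0 (m 2) + Finsupp.single 1 (m 3) : Fin 2 →₀ ℕ) 1 = m 3 := by simp
  have h3 : (![1, Polynomial.X] : Fin 2 → Polynomial (Polynomial F)) (slot e).1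
      = Polynomial.X ^ ((slot e).1 : ℕ) := by
    generalize (slot e).1 = i
    fin_cases i <;> simp
  rw [specialFamily, familyIndex]
  simp only [h1, h2, h2']
  rw [specialSequence, discSequence, powerSequence_apply, powerSequence_apply, h3, aeval_monomial,
    Finsupp.prod_fintype _ _ (fun _ => pow_zero _), Fin.prod_univ_four]
  simp only [specialY, Polynomial.smul_eq_C_mul, map_one, one_mul, Matrix.cons_val_zero,
    Matrix.cons_val_one, Matrix.cons_val, map_mul, map_pow]
  ring

/-- Independence of the values of the basis elements at the special point. -/
lemma polyComb_special_injective (hα : α 0 ≠ 0)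
    (h : LinearIndependent K fun κ : Fin 2 →₀ ℕ => α 0 ^ κ 0 * α 1 ^ κ 1) :
    Function.Injective (polyComb (K := K) (specialY α) fun e : Fin 8 ⊕ Bool =>
      (Polynomial.X ^ ((slot e).1 : ℕ) * Polynomial.C (specialBasis α (slot e).1 (slot e).2) :
        Polynomial (Polynomial F))) := by
  let bb := Finsupp.basis fun _ : Fin 8 ⊕ Bool => basisMonomials (Fin 4) K
  have h1 := bb.injective_constr_of_linearIndependent (R₂ := K)
    ((linearIndependent_specialFamily (K := K) α hα h).comp _ familyIndex_injective)
  convert h1 using 1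
  refine congrArg DFunLike.coe ?_
  refine bb.ext fun p => ?_
  rw [Module.Basis.constr_basis, Function.comp_apply, specialFamily_familyIndex (K := K)]
  simp [bb]

end Independence

/-! ### Values of the generators at the special point -/

section Specialization

set_option linter.unusedSectionVars false

variable {K F : Type*} [Field K] [CharZero K] [Field F] [Algebra K F] (α : Fin 2 → F)

variable (K) in
/-- The evaluation at the special point. -/
def specialize : MvPolynomial (Coord ![1, 1, 3]) K →ₐ[K] Polynomial (Polynomial F) :=
  aeval (ofCoords (specialCoords α))

lemma three_inv_mul_three {A : Type*} [CommRing A] [Algebra K A] :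
    algebraMap K A 3⁻¹ * 3 = 1 := by
  rw [← map_ofNat (algebraMap K A) 3, ← map_mul, inv_mul_cancel₀ (by norm_num), map_one]

lemma cubicCoeff_specialCoords :
    cubicCoeff (algebraMap K _ 3⁻¹) (specialCoords α) = ![Polynomial.C (Polynomial.C (α 0)), 0,
      Polynomial.C (specialQuad α), Polynomial.X] := by
  ext1 i
  fin_cases i
  · rfl
  · simp [cubicCoeff, specialCoords]
  · simp only [cubicCoeff, specialCoords]
    simp only [Fin.reduceFinMk, Matrix.cons_val]
    rw [← mul_assoc, three_inv_mul_three, one_mul]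
  · rfl

lemma zeros_specialCoords :
    zeros (specialCoords α) = ![1, 0, Polynomial.C Polynomial.X, 0] := by
  ext1 i
  fin_cases i <;> simp [zeros, specialCoords, neg_neg]

lemma C_param_mul_special (hα : α 0 ≠ 0) : Polynomial.C (Polynomial.C (α 0)) *
    Polynomial.C (specialQuad α) = Polynomial.C (specialHess α) := by
  rw [← map_mul, specialQuad, ← mul_assoc, ← map_mul, mul_inv_cancel₀ hα, map_one, one_mul]

lemma specialize_polyY_zero : specialize K α (polyY K 0) = 0 := by
  rw [specialize, aeval_polyY, coords_ofCoords]
  simp [genY, detForm, specialCoords]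

/-- With `s` the inner variable, the cubic is chosen so that its Hessian has leading coefficient `α
1 - α 0 s ^ 3`. The last parameter, which adds `α 0 s ^ 3` to this, becomes the constant `α 1`,
while `y_3` becomes `α 0`. -/
lemma specialize_polyY_succ (hα : α 0 ≠ 0) (i : Fin 4) :
    specialize K α (polyY K i.succ) = specialY α i := by
  rw [specialize, aeval_polyY, coords_ofCoords]
  simp only [genY, zeros_specialCoords, cubicCoeff_specialCoords]
  fin_cases i
  · simp [discriminant, specialY, specialDisc, map_ofNat]
  · simp [polarQuadratic, hessian, C_param_mul_special α hα, specialY]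
  · simp [polarCubic, specialY]
  · simp [polarCubic, polarQuadratic, hessian, C_param_mul_special α hα, specialY]
    simp [specialHess]

/-- Both zeros are multiples of `(1, 0)`, so polarization only produces powers of the inner
variable, and the cubic covariant contributes the factor `α 0 ^ 2` times the outer variable. The ten
values have each outer degree `0, 1` with each inner degree `0, …, 4` exactly once. This fits with
`y_1` of outer degree `2` and `y_2` of inner degree `5`. -/
lemma specialize_tableBasis (hα : α 0 ≠ 0) (e : Fin 8 ⊕ Bool) :
    specialize K α (tableBasis (polyV K) e) =
    Polynomial.X ^ ((slot e).1 : ℕ) * Polynomial.C (specialBasis α (slot e).1 (slot e).2) := by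
  have hV : ∀ k, specialize K α (polyV K k) = Polynomial.X ^ ((slot (Sum.inl k)).1 : ℕ) *
      Polynomial.C (specialBasis α (slot (Sum.inl k)).1 (slot (Sum.inl k)).2) := by
    intro k
    rw [specialize, aeval_polyV, coords_ofCoords]
    simp only [genV, zeros_specialCoords, cubicCoeff_specialCoords]
    fin_cases k <;> simp [polarCubic, polarQuadratic, hessian, cubicCovariant,
      C_param_mul_special α hα, slot, specialBasis] <;> ring
  rcases e with k | _ | _
  · exact hV k
  · simp [tableBasis, slot, specialBasis]
  · simp only [tableBasis, Sum.elim_inr, if_true, map_mul, hV]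
    simp [slot, specialBasis]
    ring

universe u in
/-- Two independent elements of a field extension. -/
lemma exists_algebraicallyIndependent_pair (K : Type u) [Field K] :
    ∃ (F : Type u) (_ : Field F) (_ : Algebra K F) (α : Fin 2 → F), α 0 ≠ 0 ∧
      LinearIndependent K fun κ : Fin 2 →₀ ℕ => α 0 ^ κ 0 * α 1 ^ κ 1 := by
  have hinj := IsFractionRing.injective (MvPolynomial (Fin 2) K)
    (FractionRing (MvPolynomial (Fin 2) K))
  refine ⟨FractionRing (MvPolynomial (Fin 2) K), inferInstance, inferInstance,
    fun i => algebraMap _ _ (X i : MvPolynomial (Fin 2) K),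
    (map_ne_zero_iff _ hinj).2 (X_ne_zero 0), ?_⟩
  have h := (basisMonomials (Fin 2) K).linearIndependent
  rw [coe_basisMonomials] at h
  have h2 := h.map' (IsScalarTower.toAlgHom K (MvPolynomial (Fin 2) K)
    (FractionRing (MvPolynomial (Fin 2) K))).toLinearMap (LinearMap.ker_eq_bot.2 hinj)
  have h3 : ((IsScalarTower.toAlgHom K (MvPolynomial (Fin 2) K)
      (FractionRing (MvPolynomial (Fin 2) K))).toLinearMap ∘ fun s => monomial s 1) =
      fun κ : Fin 2 →₀ ℕ => algebraMap _ _ (X 0 : MvPolynomial (Fin 2) K) ^ κ 0 *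
        algebraMap _ _ (X 1 : MvPolynomial (Fin 2) K) ^ κ 1 := by
    ext1 κ
    rw [Function.comp_apply, monomial_eq, Finsupp.prod_fintype _ _ (fun _ => pow_zero _),
      Fin.prod_univ_two]
    simp
  rw [h3] at h2
  exact h2

/-- A combination of the basis elements that is divisible by the first invariant has coefficients
divisible by the first variable. -/
lemma X_dvd_of_polyComb_eq {c : Fin 8 ⊕ Bool →₀ MvPolynomial (Fin 5) K}
    {P : MvPolynomial (Coord ![1, 1, 3]) K}
    (h : polyComb (polyY K) (tableBasis (polyV K)) c = polyY K 0 * P) (e : Fin 8 ⊕ Bool) :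
    X 0 ∣ c e := by
  obtain ⟨F, _, _, α, hα, hind⟩ := exists_algebraicallyIndependent_pair K
  have h1 := congrArg (specialize K α) h
  rw [map_mul, specialize_polyY_zero, zero_mul, map_polyComb] at h1
  -- Since `y_0` vanishes at the special point, only the coefficients modulo the first variable are
  -- seen there.
  have h2 : polyComb (specialY α) (fun e : Fin 8 ⊕ Bool => specialize K α (tableBasis (polyV K) e))
      (c.mapRange (killFirst K 1 4) (map_zero _)) = 0 := by
    rw [← h1, polyComb_apply, polyComb_apply]
    refine Finset.sum_congr rfl fun e _ => ?_
    congr 1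
    rw [Finsupp.mapRange_apply]
    have : (aeval (R := K) (specialY α)).comp (killFirst K 1 4)
        = aeval (fun i => specialize K α (polyY K i)) := by
      refine MvPolynomial.algHom_ext fun i => ?_
      refine Fin.addCases (fun i => ?_) (fun i => ?_) i
      · rw [AlgHom.comp_apply, killFirst_X_castAdd, map_zero, aeval_X, Subsingleton.elim i 0]
        exact (specialize_polyY_zero (K := K) α).symm
      · rw [AlgHom.comp_apply, killFirst_X_natAdd, aeval_X, aeval_X,
          ← specialize_polyY_succ (K := K) α hα]
        congr 2
        ext
        simp
        omega
    exact AlgHom.congr_fun this (c e)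
  simp only [specialize_tableBasis α hα] at h2
  have h3 := polyComb_special_injective α hα hind (h2.trans (map_zero _).symm)
  have h4 := DFunLike.congr_fun h3 e
  rw [Finsupp.mapRange_apply, Finsupp.zero_apply, killFirst_eq_zero_iff, firstVars] at h4
  have h5 : {i : Fin (1 + 4) | (i : ℕ) < 1 ∧ (i : ℕ) < 1} = {0} := by
    ext i
    rw [Set.mem_singleton_iff, Fin.ext_iff]
    change (i : ℕ) < 1 ∧ (i : ℕ) < 1 ↔ (i : ℕ) = 0
    omega
  rw [h5, Set.image_singleton, Ideal.mem_span_singleton] at h4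
  exact h4

end Specialization

end SLInv
end

/-! ### Freeness of the algebra of invariants over the parameters -/

noncomputable section
namespace SLInv

section Structure

set_option linter.unusedSectionVars false

variable {K : Type*} [Field K] [CharZero K]

lemma polyY_zero_ne_zero : polyY K 0 ≠ 0 :=
  mul_ne_zero (C_ne_zero.2 (by norm_num)) detForm_coords_X_ne_zero

lemma exists_X_smul_of_polyComb_eq {c : Fin 8 ⊕ Bool →₀ MvPolynomial (Fin 5) K}
    {P : MvPolynomial (Coord ![1, 1, 3]) K}
    (h : polyComb (polyY K) (tableBasis (polyV K)) c = polyY K 0 * P) :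
    ∃ c', c = (X 0 : MvPolynomial (Fin 5) K) • c' ∧
      polyComb (polyY K) (tableBasis (polyV K)) c' = P := by
  choose q hq using X_dvd_of_polyComb_eq h
  have hc : c = (X 0 : MvPolynomial (Fin 5) K) • Finsupp.equivFunOnFinite.symm q := by
    ext1 e
    simp [hq e]
  refine ⟨_, hc, mul_left_cancel₀ polyY_zero_ne_zero ?_⟩
  rw [← h]
  conv_rhs => rw [hc, polyComb_smul, aeval_X]

/-- All coefficients of a relation are divisible by `X 0`, and the quotient is again a relation. So
the coefficients are divisible by every power of `X 0`. -/
lemma polyComb_poly_injective :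
    Function.Injective (polyComb (K := K) (polyY K) (tableBasis (polyV K))) := by
  rw [injective_iff_map_eq_zero]
  have key : ∀ (n : ℕ) (c : Fin 8 ⊕ Bool →₀ MvPolynomial (Fin 5) K),
      polyComb (polyY K) (tableBasis (polyV K)) c = 0 → ∀ e, X 0 ^ n ∣ c e := by
    intro n
    induction n with
    | zero => simp
    | succ n ih =>
      intro c hc e
      obtain ⟨c', rfl, hc'⟩ := exists_X_smul_of_polyComb_eq (c := c) (P := 0) (by rw [hc, mul_zero])
      rw [Finsupp.smul_apply, smul_eq_mul, pow_succ']
      exact mul_dvd_mul_left _ (ih c' hc' e)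
  intro c hc
  ext1 e
  by_contra he
  obtain ⟨n, hn⟩ := FiniteMultiplicity.of_not_isUnit
    (X_prime (R := K) (i := (0 : Fin 5))).not_isUnit he
  exact hn (key _ c hc e)

/-- The span is saturated with respect to `y_0`. This removes the denominators left by the normal
form. -/
lemma mem_range_of_pow_mul_mem (n : ℕ) {P : MvPolynomial (Coord ![1, 1, 3]) K}
    (h : polyY K 0 ^ n * P ∈ LinearMap.range (polyComb (K := K) (polyY K) (tableBasis (polyV K)))) :
    P ∈ LinearMap.range (polyComb (K := K) (polyY K) (tableBasis (polyV K))) := by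
  induction n with
  | zero => simpa using h
  | succ n ih =>
    obtain ⟨c, hc⟩ := h
    rw [pow_succ', mul_assoc] at hc
    obtain ⟨c', -, hc'⟩ := exists_X_smul_of_polyComb_eq hc
    exact ih ⟨c', hc'⟩

/-- A graded algebra that is free with basis `1`, `v k`, `v 2 * v 5` over the polynomial ring in
the `y i`, with a multiplication table for the `v k`. -/
structure IsFreeTable {S : Type*} [CommRing S] [Algebra K S] (𝒮 : ℕ → Submodule K S)
    (y : Fin 5 → S) (v : Fin 8 → S) : Prop where
  connected : IsConnectedGradedAlgebra 𝒮
  mem_y : ∀ i, y i ∈ 𝒮 (degY i)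
  mem_v : ∀ k, v k ∈ 𝒮 (artDeg k)
  table : HasMulTable K y v
  bijective : Function.Bijective (polyComb (K := K) y (tableBasis v))

variable (K) in
/-- The five parameters of the algebra of invariants. -/
def invY (i : Fin 5) : invariants K ![1, 1, 3] := ⟨polyY K i, polyY_mem_invariants i⟩

variable (K) in
/-- The eight further generators of the algebra of invariants. -/
def invV (k : Fin 8) : invariants K ![1, 1, 3] := ⟨polyV K k, polyV_mem_invariants k⟩

lemma val_polyComb_inv (c : Fin 8 ⊕ Bool →₀ MvPolynomial (Fin 5) K) :
    ((polyComb (invY K) (tableBasis (invV K)) c : invariants K ![1, 1, 3]) :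
      MvPolynomial (Coord ![1, 1, 3]) K) = polyComb (polyY K) (tableBasis (polyV K)) c := by
  refine (map_polyComb (invariants K ![1, 1, 3]).val c).trans ?_
  congr 2
  funext e
  rcases e with k | _ | _ <;> simp [tableBasis, invV]

lemma polyComb_inv_bijective :
    Function.Bijective (polyComb (K := K) (invY K) (tableBasis (invV K))) := by
  constructor
  · intro c d h
    refine polyComb_poly_injective ?_
    rw [← val_polyComb_inv, ← val_polyComb_inv, h]
  · intro x
    obtain ⟨N, hN⟩ := exists_pow_mul_mem_genAlgebra x.2
    obtain ⟨c, hc⟩ := mem_range_of_pow_mul_mem N (hasMulTable_poly.adjoin_le hN)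
    exact ⟨c, Subtype.ext ((val_polyComb_inv c).trans hc)⟩

end Structure

/-! ### The grading of the algebra of invariants -/

section GradedInvariants

set_option linter.unusedSectionVars false

variable {K : Type*} [Field K] [CharZero K]

lemma tableBasis_mem {S : Type*} [CommRing S] [Algebra K S] {𝒮 : ℕ → Submodule K S}
    (h𝒮 : IsConnectedGradedAlgebra 𝒮) {v : Fin 8 → S} (hv : ∀ k, v k ∈ 𝒮 (artDeg k))
    (e : Fin 8 ⊕ Bool) : tableBasis v e ∈ 𝒮 (basisDeg e) := by
  rcases e with k | _ | _
  · exact hv k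
  · exact h𝒮.one_mem
  · exact h𝒮.mul_mem (hv 2) (hv 5)

lemma polyComb_mem {S : Type*} [CommRing S] [Algebra K S] {𝒮 : ℕ → Submodule K S}
    (h𝒮 : IsConnectedGradedAlgebra 𝒮) {n : ℕ} {ι : Type*} [Fintype ι] {y : Fin n → S} {b : ι → S}
    {deg : Fin n → ℕ} {δ : ι → ℕ} (hy : ∀ i, y i ∈ 𝒮 (deg i)) (hb : ∀ e, b e ∈ 𝒮 (δ e)) {s : ℕ}
    {c : ι →₀ MvPolynomial (Fin n) K} (hc : c ∈ freePiece deg δ s) : polyComb y b c ∈ 𝒮 s := by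
  rw [polyComb_apply]
  refine sum_mem fun e _ => ?_
  by_cases he : c e = 0
  · rw [he, map_zero, zero_mul]
    exact zero_mem _
  · obtain ⟨m, hm⟩ := Finset.nonempty_iff_ne_empty.2 (mt support_eq_empty.1 he)
    have h1 : (c e).IsWeightedHomogeneous deg (s - δ e) := by
      intro m' hm'
      have := hc e m' (mem_support_iff.2 hm')
      omega
    have h2 := hc e m hm
    have h3 := h𝒮.mul_mem (h𝒮.aeval_mem hy h1) (hb e)
    rwa [Nat.sub_add_cancel (by omega)] at h3

lemma isConnectedGradedAlgebra_homogeneousSubmodule (σ : Type*) :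
    IsConnectedGradedAlgebra (homogeneousSubmodule σ K) where
  isGrading := isGrading_weightedHomogeneousSubmodule 1
  one_mem := isHomogeneous_one σ K
  mul_mem := fun hx hy => IsHomogeneous.mul hx hy
  eq_algebraMap := fun x hx => ⟨coeff 0 x, totalDegree_eq_zero_iff_eq_C.1
    ((totalDegree_zero_iff_isHomogeneous σ).2 hx)⟩

lemma isConnectedGradedAlgebra_invariantsPiece :
    IsConnectedGradedAlgebra (invariantsPiece K ![1, 1, 3]) where
  isGrading := by
    constructor
    -- The homogeneous parts are taken in the coordinates of the free basis, so they are invariants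
    -- by construction.
    · intro x
      obtain ⟨c, rfl⟩ := polyComb_inv_bijective.2 x
      obtain ⟨T, g, hg, rfl⟩ := (isGrading_freePiece degY basisDeg).exists_sum c
      refine ⟨T, fun s => polyComb (invY K) (tableBasis (invV K)) (g s), fun s => ?_,
        map_sum _ _ _⟩
      have h := polyComb_mem (isConnectedGradedAlgebra_homogeneousSubmodule _) polyY_isHomogeneous
        (tableBasis_mem (isConnectedGradedAlgebra_homogeneousSubmodule _) polyV_isHomogeneous)
        (hg s)
      rw [← val_polyComb_inv] at h
      exact h
    · intro T g hg h s hs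
      refine Subtype.ext ((isConnectedGradedAlgebra_homogeneousSubmodule (K := K)
        (Coord ![1, 1, 3])).isGrading.eq_zero T (fun s => (g s).1) hg ?_ s hs)
      simpa using congrArg Subtype.val h
  one_mem := isHomogeneous_one _ K
  mul_mem := fun hx hy => IsHomogeneous.mul hx hy
  eq_algebraMap := fun x hx => by
    obtain ⟨c, hc⟩ := (isConnectedGradedAlgebra_homogeneousSubmodule _).eq_algebraMap x.1 hx
    exact ⟨c, Subtype.ext hc⟩

/-- The structure of the algebra of invariants. -/
theorem isFreeTable_invariants :
    IsFreeTable (invariantsPiece K ![1, 1, 3]) (invY K) (invV K) where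
  connected := isConnectedGradedAlgebra_invariantsPiece
  mem_y := polyY_isHomogeneous
  mem_v := polyV_isHomogeneous
  table := fun i j => by
    obtain ⟨c₀, c, h⟩ := hasMulTable_poly (K := K) i j
    exact ⟨c₀, c, IsMulEntry.of_injective (invariants K ![1, 1, 3]).val Subtype.val_injective h⟩
  bijective := polyComb_inv_bijective

end GradedInvariants

end SLInv
end

/-! ### Gradings given by weights on a basis -/

noncomputable section
namespace SLInv

section WeightBasis

variable {K : Type*} [Field K] {M Q : Type*} [AddCommGroup M] [Module K M]

lemma isGrading_of_repr (B : Module.Basis Q K M) (wt : Q → ℕ) {ℳ : ℕ → Submodule K M}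
    (hℳ : ∀ s x, x ∈ ℳ s ↔ ∀ q, wt q ≠ s → B.repr x q = 0) : IsGrading ℳ := by
  classical
  constructor
  · intro x
    refine ⟨(B.repr x).support.image wt, fun s => B.repr.symm ((B.repr x).filter fun q => wt q = s),
      fun s => ?_, ?_⟩
    · rw [hℳ]
      intro q hq
      rw [LinearEquiv.apply_symm_apply, Finsupp.filter_apply, if_neg hq]
    · apply B.repr.injective
      ext q
      simp only [map_sum, LinearEquiv.apply_symm_apply, Finsupp.finsetSum_apply,
        Finsupp.filter_apply, Finset.sum_ite_eq]
      split_ifs with hq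
      · rfl
      · by_contra hne
        exact hq (Finset.mem_image_of_mem _ (Finsupp.mem_support_iff.2 hne))
  · intro T g hg h0 s hs
    apply B.repr.injective
    rw [map_zero]
    ext q
    by_cases hq : wt q = s
    · have h1 := DFunLike.congr_fun (congrArg B.repr h0) q
      rw [map_sum, Finsupp.finsetSum_apply, Finset.sum_eq_single s] at h1
      · rw [h1, map_zero]
      · intro t _ hts
        exact (hℳ t _).1 (hg t) q (by rw [hq]; exact hts.symm)
      · exact fun hcon => absurd hs hcon
    · exact (hℳ s _).1 (hg s) q hq

/-- A basis of the subspace of the elements supported on a part of a basis. -/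
def supportedBasis (B : Module.Basis Q K M) (P : Q → Prop) (N : Submodule K M)
    (hN : ∀ x, x ∈ N ↔ ∀ q, ¬ P q → B.repr x q = 0) : Module.Basis {q // P q} K N :=
  Module.Basis.ofRepr ((B.repr.submoduleMap N).trans
    ((LinearEquiv.ofEq _ (Finsupp.supported K K {q | P q}) (by
      ext c
      rw [Finsupp.mem_supported']
      constructor
      · rintro ⟨x, hx, rfl⟩
        exact (hN x).1 hx
      · intro hc
        exact ⟨B.repr.symm c, (hN _).2 (by simpa using hc), by simp⟩)).trans
      (Finsupp.supportedEquivFinsupp {q | P q})))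

end WeightBasis

/-! ### From the free basis to the Betti numbers -/

section Reduction

set_option linter.unusedSectionVars false

variable {K : Type*} [Field K] [CharZero K]

/-- The degrees of the thirteen generators. -/
def genDeg : Fin (5 + 8) → ℕ := Fin.append degY artDeg

/-- The thirteen generators. -/
def genFamily {S : Type*} (y : Fin 5 → S) (v : Fin 8 → S) : Fin (5 + 8) → S := Fin.append y v

lemma genDeg_pos (i : Fin (5 + 8)) : 0 < genDeg i := by
  revert i; decide

namespace IsFreeTable

variable {S : Type*} [CommRing S] [Algebra K S] {𝒮 : ℕ → Submodule K S} {y : Fin 5 → S}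
  {v : Fin 8 → S}

lemma basis_mem (h : IsFreeTable 𝒮 y v) (e : Fin 8 ⊕ Bool) : tableBasis v e ∈ 𝒮 (basisDeg e) :=
  tableBasis_mem h.connected h.mem_v e

/-- The coordinates with respect to the basis `1`, `v k`, `v 2 * v 5`. -/
def equiv (h : IsFreeTable 𝒮 y v) : S ≃ₗ[K] (Fin 8 ⊕ Bool →₀ MvPolynomial (Fin 5) K) :=
  (LinearEquiv.ofBijective _ h.bijective).symm

lemma polyComb_equiv (h : IsFreeTable 𝒮 y v) (x : S) :
    polyComb y (tableBasis v) (h.equiv x) = x :=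
  (LinearEquiv.ofBijective _ h.bijective).apply_symm_apply x

lemma equiv_polyComb (h : IsFreeTable 𝒮 y v) (c : Fin 8 ⊕ Bool →₀ MvPolynomial (Fin 5) K) :
    h.equiv (polyComb y (tableBasis v) c) = c :=
  (LinearEquiv.ofBijective _ h.bijective).symm_apply_apply c

lemma equiv_y_mul (h : IsFreeTable 𝒮 y v) (i : Fin 5) (x : S) :
    h.equiv (y i * x) = (X i : MvPolynomial (Fin 5) K) • h.equiv x := by
  conv_lhs => rw [← h.polyComb_equiv x, ← aeval_X (R := K) y i, ← polyComb_smul]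
  rw [h.equiv_polyComb]

lemma equiv_tableBasis (h : IsFreeTable 𝒮 y v) (e : Fin 8 ⊕ Bool) :
    h.equiv (tableBasis v e) = Finsupp.single e 1 := by
  rw [← h.equiv_polyComb (Finsupp.single e 1)]
  simp

lemma mem_iff (h : IsFreeTable 𝒮 y v) (s : ℕ) (x : S) :
    x ∈ 𝒮 s ↔ h.equiv x ∈ freePiece degY basisDeg s := by
  have hφ : ∀ s, ∀ c ∈ freePiece (K := K) degY basisDeg s, polyComb y (tableBasis v) c ∈ 𝒮 s :=
    fun s c hc => polyComb_mem h.connected h.mem_y h.basis_mem hc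
  constructor
  · intro hx
    rw [← h.polyComb_equiv x] at hx
    obtain ⟨c, hc, h1⟩ := IsGrading.exists_mem_of_map_mem (isGrading_freePiece degY basisDeg)
      h.connected.isGrading (polyComb y (tableBasis v)) hφ hx
    rwa [← h.bijective.1 h1]
  · intro hx
    rw [← h.polyComb_equiv x]
    exact hφ s _ hx

/-- The structure of a module over the polynomial ring in thirteen variables. -/
@[reducible]
def genModule (K : Type*) [Field K] {S : Type*} [CommRing S] [Algebra K S] {n : ℕ}
    (f : Fin n → S) : Module (MvPolynomial (Fin n) K) S :=
  Module.compHom S (aeval (R := K) f).toRingHom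

lemma genModule_isScalarTower {n : ℕ} (f : Fin n → S) :
    letI := genModule K f
    IsScalarTower K (MvPolynomial (Fin n) K) S := by
  let _ := genModule K f
  refine ⟨fun r p x => ?_⟩
  change aeval f (r • p) * x = r • (aeval f p * x)
  rw [map_smul, smul_mul_assoc]

/-- The first five variables act as the parameters, so membership is tested on the coordinates in
the free basis. These live in the polynomial ring in five variables, which is the case `n = 0` of
`firstVars`. -/
lemma mem_firstVars_smul_top_iff (h : IsFreeTable 𝒮 y v) (k : ℕ) (x : S) :
    letI := genModule K (genFamily y v)
    x ∈ firstVars K 5 8 k • (⊤ : Submodule (MvPolynomial (Fin (5 + 8)) K) S) ↔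
      ∀ e, h.equiv x e ∈ firstVars K 5 0 k := by
  let _ := genModule K (genFamily y v)
  have hsmul : ∀ (p : MvPolynomial (Fin (5 + 8)) K) (x : S),
    p • x = aeval (genFamily y v) p * x := fun _ _ => rfl
  constructor
  · intro hx e
    refine Submodule.smul_induction_on (p := fun x => h.equiv x e ∈ firstVars K 5 0 k) hx
      ?_ ?_
    · intro r hr z _
      refine Submodule.span_induction (p := fun r _ => ∀ z, h.equiv (r • z) e ∈ firstVars K 5 0 k)
        ?_ ?_ ?_ ?_ hr z
      · rintro _ ⟨i, hi, rfl⟩ z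
        obtain ⟨i, rfl⟩ : ∃ i' : Fin 5, i = Fin.castAdd 8 i' := ⟨⟨i, hi.1⟩, rfl⟩
        rw [hsmul, aeval_X, genFamily, Fin.append_left, h.equiv_y_mul, Finsupp.smul_apply,
          smul_eq_mul]
        exact Ideal.mul_mem_right _ _ (Ideal.subset_span ⟨i, hi, rfl⟩)
      · intro z
        rw [zero_smul, map_zero]
        exact zero_mem _
      · intro a b _ _ ha hb z
        rw [add_smul, map_add]
        exact add_mem (ha z) (hb z)
      · intro a b _ hb z
        rw [smul_eq_mul, mul_comm, mul_smul]
        exact hb _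
    · intro a b ha hb
      rw [map_add]
      exact add_mem ha hb
  · intro hx
    rw [← h.polyComb_equiv x, polyComb_apply]
    refine sum_mem fun e _ => ?_
    have h1 : aeval y (h.equiv x e) = aeval (R := K) (genFamily y v)
        (rename (Fin.castAdd 8) (h.equiv x e)) := by
      rw [aeval_rename]
      congr 2
      funext i
      exact (Fin.append_left y v i).symm
    rw [h1]
    refine Submodule.smul_mem_smul (r := rename (Fin.castAdd 8) (h.equiv x e)) ?_
      (Submodule.mem_top (x := tableBasis v e))
    have h2 : (firstVars K 5 0 k).map (rename (R := K) (Fin.castAdd 8)).toRingHom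
        ≤ firstVars K 5 8 k := by
      rw [firstVars, Ideal.map_span, Ideal.span_le]
      rintro _ ⟨_, ⟨i, hi, rfl⟩, rfl⟩
      refine Ideal.subset_span ⟨Fin.castAdd 8 i, hi, ?_⟩
      exact (rename_X (R := K) _ _).symm
    exact h2 (Ideal.mem_map_of_mem _ (hx e))

lemma regular (h : IsFreeTable 𝒮 y v) (i : Fin 5) (x : S) :
    letI := genModule K (genFamily y v)
    (X (Fin.castAdd 8 i) : MvPolynomial (Fin (5 + 8)) K) • x
      ∈ firstVars K 5 8 i • (⊤ : Submodule (MvPolynomial (Fin (5 + 8)) K) S) →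
      x ∈ firstVars K 5 8 i • (⊤ : Submodule (MvPolynomial (Fin (5 + 8)) K) S) := by
  let _ := genModule K (genFamily y v)
  intro hx
  rw [h.mem_firstVars_smul_top_iff] at hx ⊢
  intro e
  have h1 := hx e
  change h.equiv (aeval (genFamily y v) (X (Fin.castAdd 8 i)) * x) e ∈ _ at h1
  rw [aeval_X, genFamily, Fin.append_left, h.equiv_y_mul, Finsupp.smul_apply, smul_eq_mul] at h1
  exact mem_firstVars_of_X_mul_mem (n := 0) i h1

/-- The coordinates of the Artinian reduction. -/
def artCoord (h : IsFreeTable 𝒮 y v) : S →ₗ[K] (Fin 8 ⊕ Bool →₀ K) :=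
  (Finsupp.mapRange.linearMap (lcoeff K 0)).comp h.equiv.toLinearMap

lemma artCoord_apply (h : IsFreeTable 𝒮 y v) (x : S) (e : Fin 8 ⊕ Bool) :
    h.artCoord x e = constantCoeff (h.equiv x e) := rfl

lemma artCoord_tableBasis (h : IsFreeTable 𝒮 y v) (e : Fin 8 ⊕ Bool) :
    h.artCoord (tableBasis v e) = Finsupp.single e 1 := by
  ext e'
  rw [artCoord_apply, equiv_tableBasis]
  by_cases he : e = e'
  · subst he; simp
  · rw [Finsupp.single_eq_of_ne' he, Finsupp.single_eq_of_ne' he, map_zero]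

lemma artCoord_surjective (h : IsFreeTable 𝒮 y v) : Function.Surjective h.artCoord := by
  intro c
  refine ⟨polyComb y (tableBasis v) (c.mapRange C (map_zero _)), ?_⟩
  ext e
  rw [artCoord_apply, h.equiv_polyComb]
  simp

lemma mem_span_of_constantCoeff {n : ℕ} (f : Fin n → S) {p : MvPolynomial (Fin n) K}
    (hp : constantCoeff p = 0) : aeval f p ∈ Ideal.span (Set.range f) := by
  have h1 : p ∈ Ideal.span (Set.range (X : Fin n → MvPolynomial (Fin n) K)) := by
    rw [← Set.image_univ, mem_ideal_span_X_image]
    intro m hm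
    by_contra hcon
    push Not at hcon
    have : m = 0 := Finsupp.ext fun i => hcon i trivial
    rw [this, mem_support_iff] at hm
    exact hm hp
  have h2 := Ideal.mem_map_of_mem (aeval (R := K) f) h1
  rw [Ideal.map_span, ← Set.range_comp] at h2
  convert h2 using 3
  funext i
  simp

/-- In the coordinates of the free basis, the ideal of the parameters is the vanishing of all
constant terms. -/
lemma mem_span_iff (h : IsFreeTable 𝒮 y v) (x : S) :
    x ∈ Ideal.span (Set.range y) ↔ h.artCoord x = 0 := by
  constructor
  · intro hx
    obtain ⟨c, rfl⟩ := (Ideal.mem_span_range_iff_exists_fun).1 hx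
    rw [map_sum]
    refine Finset.sum_eq_zero fun i _ => ?_
    ext e
    rw [mul_comm, artCoord_apply, h.equiv_y_mul]
    simp
  · intro hx
    rw [← h.polyComb_equiv x, polyComb_apply]
    refine sum_mem fun e _ => Ideal.mul_mem_right _ _ (mem_span_of_constantCoeff y ?_)
    exact DFunLike.congr_fun hx e

lemma positiveComb_le_span (h : IsFreeTable 𝒮 y v) {x : S}
    (hx : x ∈ positiveComb K y (tableBasis v)) : x ∈ Ideal.span (Set.range y) := by
  obtain ⟨c, hc, rfl⟩ := mem_positiveComb.1 hx
  rw [h.mem_span_iff]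
  ext e
  rw [artCoord_apply, h.equiv_polyComb, hc e]
  rfl

/-- The basis of the Artinian reduction. -/
def artBasis (h : IsFreeTable 𝒮 y v) :
    Module.Basis (Fin 8 ⊕ Bool) K (S ⧸ Ideal.span (Set.range y)) :=
  Module.Basis.ofRepr ((Submodule.Quotient.restrictScalarsEquiv K _).symm.trans
    ((Submodule.quotEquivOfEq _ _ (SetLike.ext fun x => h.mem_span_iff x)).trans
      (h.artCoord.quotKerEquivOfSurjective h.artCoord_surjective)))

lemma artBasis_repr (h : IsFreeTable 𝒮 y v) (x : S) :
    h.artBasis.repr (Ideal.Quotient.mk _ x) = h.artCoord x := rfl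

lemma artBasis_apply (h : IsFreeTable 𝒮 y v) (e : Fin 8 ⊕ Bool) :
    h.artBasis e = Ideal.Quotient.mk _ (tableBasis v e) := by
  apply h.artBasis.repr.injective
  rw [artBasis_repr, artCoord_tableBasis, Module.Basis.repr_self]

/-- The grading of the Artinian reduction. -/
def artPiece (𝒮 : ℕ → Submodule K S) (y : Fin 5 → S) (s : ℕ) :
    Submodule K (S ⧸ Ideal.span (Set.range y)) :=
  (𝒮 s).map (Ideal.Quotient.mkₐ K (Ideal.span (Set.range y))).toLinearMap

lemma mem_artPiece (h : IsFreeTable 𝒮 y v) (s : ℕ) (x : S ⧸ Ideal.span (Set.range y)) :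
    x ∈ artPiece 𝒮 y s ↔ ∀ e, basisDeg e ≠ s → h.artBasis.repr x e = 0 := by
  constructor
  · rintro ⟨z, hz, rfl⟩ e he
    rw [SetLike.mem_coe, h.mem_iff] at hz
    change h.artCoord z e = 0
    rw [artCoord_apply]
    by_contra hne
    exact he (by simpa using hz e 0 (mem_support_iff.2 hne))
  · intro hx
    rw [← h.artBasis.sum_repr x]
    refine sum_mem fun e _ => ?_
    by_cases he : basisDeg e = s
    · refine Submodule.smul_mem _ _ ?_
      rw [artBasis_apply, ← he]
      exact ⟨_, h.basis_mem e, rfl⟩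
    · rw [hx e he, zero_smul]
      exact zero_mem _

lemma isArtinianReduction (h : IsFreeTable 𝒮 y v) :
    letI := genModule K fun k => Ideal.Quotient.mk (Ideal.span (Set.range y)) (v k)
    IsArtinianReduction h.artBasis (artPiece 𝒮 y) := by
  let _ := genModule K fun k => Ideal.Quotient.mk (Ideal.span (Set.range y)) (v k)
  have hX : ∀ k x, (X k : MvPolynomial (Fin 8) K) • (Ideal.Quotient.mk (Ideal.span (Set.range y)) x)
      = Ideal.Quotient.mk _ (v k * x) := by
    intro k x
    change aeval _ (X k) * _ = _
    rw [aeval_X, map_mul]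
  refine ⟨fun k => ?_, fun k l => ?_, fun k => ?_, h.mem_artPiece⟩
  · rw [artBasis_apply, artBasis_apply, hX]
    simp [tableBasis]
  · have h1 := h.positiveComb_le_span (h.table.mul_sub_mem k l)
    rw [← Ideal.Quotient.eq] at h1
    rw [artBasis_apply, hX]
    refine h1.trans ?_
    split_ifs
    · rw [artBasis_apply]; rfl
    · rw [map_zero]
  · have h1 := h.positiveComb_le_span (h.table.socle_mul_mem k)
    rw [artBasis_apply, hX, mul_comm]
    exact Ideal.Quotient.eq_zero_iff_mem.2 h1

lemma isGrading_artPiece (h : IsFreeTable 𝒮 y v) : IsGrading (artPiece 𝒮 y) :=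
  isGrading_of_repr h.artBasis basisDeg fun s x => h.mem_artPiece s x

lemma isGradedAction_genFamily {n : ℕ} {T : Type*} [CommRing T] [Algebra K T]
    {𝒯 : ℕ → Submodule K T} (hmul : ∀ {s t x y}, x ∈ 𝒯 s → y ∈ 𝒯 t → x * y ∈ 𝒯 (s + t))
    {f : Fin n → T} {deg : Fin n → ℕ} (hf : ∀ i, f i ∈ 𝒯 (deg i)) :
    letI := genModule K f
    IsGradedAction deg 𝒯 := by
  let _ := genModule K f
  intro k s x hx
  change aeval f (X k) * x ∈ _
  rw [aeval_X, mul_comm]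
  exact hmul hx (hf k)

lemma genFamily_mem (h : IsFreeTable 𝒮 y v) (i : Fin (5 + 8)) :
    genFamily y v i ∈ 𝒮 (genDeg i) := by
  refine Fin.addCases (fun i => ?_) (fun i => ?_) i
  · rw [genFamily, genDeg, Fin.append_left, Fin.append_left]
    exact h.mem_y i
  · rw [genFamily, genDeg, Fin.append_right, Fin.append_right]
    exact h.mem_v i

/-- The graded Betti numbers of an algebra with a free multiplication table. -/
theorem resolution (h : IsFreeTable 𝒮 y v) (hfin : ∀ s, FiniteDimensional K (𝒮 s)) :
    letI := genModule K (genFamily y v)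
    Nonempty (MinimalGradedFreeResolution genDeg S 𝒮 bettiTable) := by
  let _ := genModule K (genFamily y v)
  have := genModule_isScalarTower (K := K) (genFamily y v)
  let _ := genModule K fun k => Ideal.Quotient.mk (Ideal.span (Set.range y)) (v k)
  have := genModule_isScalarTower (K := K)
    fun k => Ideal.Quotient.mk (Ideal.span (Set.range y)) (v k)
  -- Some minimal resolution exists. Its Betti numbers survive the reduction modulo the parameters
  -- and are then identified through the Koszul homology of the Artinian algebra.
  obtain ⟨β, ⟨r⟩⟩ := exists_minimalGradedFreeResolution genDeg_pos h.connected.isGrading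
    (isGradedAction_genFamily h.connected.mul_mem h.genFamily_mem) hfin
  have hker : ∀ (p : MvPolynomial (Fin (5 + 8)) K),
      Ideal.Quotient.mk (Ideal.span (Set.range y)) (aeval (genFamily y v) p) =
      aeval (fun k => Ideal.Quotient.mk (Ideal.span (Set.range y)) (v k)) (killFirst K 5 8 p) := by
    intro p
    have : (Ideal.Quotient.mkₐ K (Ideal.span (Set.range y))).comp (aeval (genFamily y v)) =
      (aeval (R := K) (fun k => Ideal.Quotient.mk (Ideal.span (Set.range y)) (v k))).comp
        (killFirst K 5 8) := by
      refine MvPolynomial.algHom_ext fun i => ?_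
      refine Fin.addCases (fun i => ?_) (fun i => ?_) i
      · rw [AlgHom.comp_apply, AlgHom.comp_apply, killFirst_X_castAdd, map_zero, aeval_X, genFamily,
          Fin.append_left]
        exact Ideal.Quotient.eq_zero_iff_mem.2 (Ideal.subset_span ⟨i, rfl⟩)
      · rw [AlgHom.comp_apply, AlgHom.comp_apply, killFirst_X_natAdd, aeval_X, aeval_X, genFamily,
          Fin.append_right]
        rfl
    exact AlgHom.congr_fun this p
  obtain ⟨r'⟩ := r.reduce (N := S ⧸ Ideal.span (Set.range y)) (𝒩 := artPiece 𝒮 y) h.regular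
    (Ideal.Quotient.mk _).toAddMonoidHom
    (fun p x => by
      change Ideal.Quotient.mk _ (aeval _ p * x) = aeval _ _ * Ideal.Quotient.mk _ x
      rw [map_mul, hker])
    Ideal.Quotient.mk_surjective
    (fun x hx => by
      obtain ⟨c, rfl⟩ := Ideal.mem_span_range_iff_exists_fun.1 (Ideal.Quotient.eq_zero_iff_mem.1 hx)
      refine sum_mem fun i _ => ?_
      have h1 : c i * y i = (X (Fin.castAdd 8 i) : MvPolynomial (Fin (5 + 8)) K) • c i := by
        change _ = aeval (genFamily y v) (X _) * _
        rw [aeval_X, genFamily, Fin.append_left, mul_comm]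
      rw [h1]
      exact Submodule.smul_mem_smul (Ideal.subset_span ⟨Fin.castAdd 8 i, ⟨i.2, i.2⟩, rfl⟩)
        Submodule.mem_top)
    (fun s x hx => ⟨x, hx, rfl⟩)
  have hdeg : (fun k => genDeg (Fin.natAdd 5 k)) = artDeg :=
    _root_.funext fun k => Fin.append_right _ _ _
  rw [hdeg] at r'
  have hβ : β = bettiTable := by
    funext i j
    rw [r'.betti_eq_koszulDim (by decide) h.isGrading_artPiece
      (isGradedAction_genFamily (by
        rintro s t _ _ ⟨x, hx, rfl⟩ ⟨z, hz, rfl⟩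
        exact ⟨x * z, h.connected.mul_mem hx hz, rfl⟩) fun k => ⟨_, h.mem_v k, rfl⟩) i j]
    exact h.isArtinianReduction.koszulDim_eq i j
  rw [hβ] at r
  exact ⟨r⟩

end IsFreeTable

end Reduction

end SLInv
end

/-! ### Exponents in thirteen variables -/

noncomputable section
namespace SLInv

section Glue

/-- The exponent vector in thirteen variables with given parts. -/
def glue (n : Fin 5 →₀ ℕ) (q : Fin 8 →₀ ℕ) : Fin (5 + 8) →₀ ℕ :=
  n.mapDomain (Fin.castAdd 8) + q.mapDomain (Fin.natAdd 5)

@[simp] lemma glue_castAdd (n : Fin 5 →₀ ℕ) (q : Fin 8 →₀ ℕ) (i : Fin 5) :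
    glue n q (Fin.castAdd 8 i) = n i := by
  rw [glue, Finsupp.add_apply, Finsupp.mapDomain_apply (Fin.castAdd_injective 5 8),
    Finsupp.mapDomain_of_notMem_range, add_zero]
  rintro ⟨k, hk⟩
  have := congrArg Fin.val hk
  simp only [Fin.val_natAdd, Fin.val_castAdd] at this
  omega

@[simp] lemma glue_natAdd (n : Fin 5 →₀ ℕ) (q : Fin 8 →₀ ℕ) (k : Fin 8) :
    glue n q (Fin.natAdd 5 k) = q k := by
  rw [glue, Finsupp.add_apply, Finsupp.mapDomain_apply (Fin.natAdd_injective 8 5),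
    Finsupp.mapDomain_of_notMem_range, zero_add]
  rintro ⟨i, hi⟩
  have := congrArg Fin.val hi
  simp only [Fin.val_natAdd, Fin.val_castAdd] at this
  omega

lemma exists_glue_eq (m : Fin (5 + 8) →₀ ℕ) : ∃ n q, glue n q = m := by
  refine ⟨Finsupp.equivFunOnFinite.symm fun i => m (Fin.castAdd 8 i),
    Finsupp.equivFunOnFinite.symm fun k => m (Fin.natAdd 5 k), ?_⟩
  ext i
  refine Fin.addCases (fun i => ?_) (fun i => ?_) i <;> simp

lemma glue_inj {n n' : Fin 5 →₀ ℕ} {q q' : Fin 8 →₀ ℕ} :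
    glue n q = glue n' q' ↔ n = n' ∧ q = q' := by
  constructor
  · intro h
    constructor
    · ext i
      simpa using DFunLike.congr_fun h (Fin.castAdd 8 i)
    · ext i
      simpa using DFunLike.congr_fun h (Fin.natAdd 5 i)
  · rintro ⟨rfl, rfl⟩
    rfl

lemma glue_single_left (i : Fin 5) (a : ℕ) :
    glue (Finsupp.single i a) 0 = Finsupp.single (Fin.castAdd 8 i) a := by
  simp [glue]

lemma glue_single_right (k : Fin 8) (a : ℕ) :
    glue 0 (Finsupp.single k a) = Finsupp.single (Fin.natAdd 5 k) a := by
  simp [glue]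

lemma weight_glue (n : Fin 5 →₀ ℕ) (q : Fin 8 →₀ ℕ) :
    Finsupp.weight genDeg (glue n q) = Finsupp.weight degY n + Finsupp.weight artDeg q := by
  rw [Finsupp.weight_apply, Finsupp.weight_apply, Finsupp.weight_apply,
    Finsupp.sum_fintype _ _ (by simp), Finsupp.sum_fintype _ _ (by simp),
    Finsupp.sum_fintype _ _ (by simp), Fin.sum_univ_add]
  simp only [glue_castAdd, glue_natAdd, genDeg, Fin.append_left, Fin.append_right]

variable {K : Type*} [Field K] {S : Type*} [CommRing S] [Algebra K S]

lemma aeval_genFamily_monomial (y : Fin 5 → S) (v : Fin 8 → S) (n : Fin 5 →₀ ℕ)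
    (q : Fin 8 →₀ ℕ) : aeval (genFamily y v) (monomial (glue n q) (1 : K)) =
      aeval y (monomial n (1 : K)) * aeval v (monomial q (1 : K)) := by
  rw [aeval_monomial, aeval_monomial, aeval_monomial, Finsupp.prod_fintype _ _ (by simp),
    Finsupp.prod_fintype _ _ (by simp), Finsupp.prod_fintype _ _ (by simp), Fin.prod_univ_add]
  simp [genFamily]

lemma eq_zero_or_single_of_weight_lt {q : Fin 8 →₀ ℕ} (hq : Finsupp.weight artDeg q < 8) :
    q = 0 ∨ ∃ k, q = Finsupp.single k 1 := by
  have key : ∀ (q : Fin 8 →₀ ℕ), q ≠ 0 → ∃ k q', q = Finsupp.single k 1 + q' := by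
    intro q hq
    obtain ⟨k, hk⟩ := Finsupp.ne_iff.1 hq
    refine ⟨k, q - Finsupp.single k 1, (add_tsub_cancel_of_le ?_).symm⟩
    rw [Finsupp.single_le_iff]
    exact Nat.one_le_iff_ne_zero.2 hk
  have h4 : ∀ k, 4 ≤ artDeg k := by decide
  by_contra! hcon
  obtain ⟨k, q', rfl⟩ := key q hcon.1
  obtain ⟨l, q'', rfl⟩ := key q' (by
    rintro rfl
    exact hcon.2 k (add_zero _))
  simp only [map_add, Finsupp.weight_single, one_smul] at hq
  have h1 := h4 k
  have h2 := h4 l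
  omega

end Glue

/-! ### Minimality of the thirteen generators -/

section Minimality

set_option linter.unusedSectionVars false

variable {K : Type*} [Field K] [CharZero K]

namespace IsFreeTable

variable {S : Type*} [CommRing S] [Algebra K S] {𝒮 : ℕ → Submodule K S} {y : Fin 5 → S}
  {v : Fin 8 → S}

/-- The basis over `K` of an algebra with a free multiplication table. -/
def monomialBasis (h : IsFreeTable 𝒮 y v) :
    Module.Basis (Σ _ : Fin 8 ⊕ Bool, Fin 5 →₀ ℕ) K S :=
  (Finsupp.basis fun _ => basisMonomials (Fin 5) K).map h.equiv.symm

lemma monomialBasis_apply (h : IsFreeTable 𝒮 y v) (e : Fin 8 ⊕ Bool) (n : Fin 5 →₀ ℕ) :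
    h.monomialBasis ⟨e, n⟩ = aeval y (monomial n (1 : K)) * tableBasis v e := by
  apply h.equiv.injective
  rw [monomialBasis, Module.Basis.map_apply, LinearEquiv.apply_symm_apply, ← polyComb_single,
    h.equiv_polyComb]
  simp

lemma monomialBasis_repr (h : IsFreeTable 𝒮 y v) (x : S) (e : Fin 8 ⊕ Bool) (n : Fin 5 →₀ ℕ) :
    h.monomialBasis.repr x ⟨e, n⟩ = coeff n (h.equiv x e) := by
  rfl

lemma mem_iff_repr (h : IsFreeTable 𝒮 y v) (s : ℕ) (x : S) : x ∈ 𝒮 s ↔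
    ∀ q : Σ _ : Fin 8 ⊕ Bool, Fin 5 →₀ ℕ, ¬ Finsupp.weight degY q.2 + basisDeg q.1 = s →
      h.monomialBasis.repr x q = 0 := by
  rw [h.mem_iff, mem_freePiece]
  constructor
  · rintro hx ⟨e, n⟩ hq
    rw [monomialBasis_repr]
    by_contra hne
    exact hq (hx e n (mem_support_iff.2 hne))
  · intro hx e n hn
    by_contra hne
    exact mem_support_iff.1 hn (hx ⟨e, n⟩ hne)

/-- The basis over `K` of a graded piece. -/
def pieceBasis (h : IsFreeTable 𝒮 y v) (s : ℕ) : Module.Basis {q : Σ _ : Fin 8 ⊕ Bool, Fin 5 →₀ ℕ //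
    Finsupp.weight degY q.2 + basisDeg q.1 = s} K (𝒮 s) :=
  supportedBasis h.monomialBasis _ _ (h.mem_iff_repr s)

lemma finiteDimensional (h : IsFreeTable 𝒮 y v) (s : ℕ) : FiniteDimensional K (𝒮 s) := by
  have h1 : {n : Fin 5 →₀ ℕ | Finsupp.weight degY n ≤ s}.Finite :=
    Finsupp.finite_of_nat_weight_le degY (by decide) s
  have : Finite {n : Fin 5 →₀ ℕ // Finsupp.weight degY n ≤ s} := h1
  have : Finite {q : Σ _ : Fin 8 ⊕ Bool, Fin 5 →₀ ℕ //
      Finsupp.weight degY q.2 + basisDeg q.1 = s} := by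
    refine Finite.of_injective (β := (Fin 8 ⊕ Bool) × {n : Fin 5 →₀ ℕ // Finsupp.weight degY n ≤ s})
      (fun q => ⟨q.1.1, q.1.2, by have := q.2; omega⟩) ?_
    rintro ⟨⟨e, n⟩, h1⟩ ⟨⟨e', n'⟩, h2⟩ h
    simp only [Prod.mk.injEq, Subtype.mk.injEq] at h
    obtain ⟨rfl, rfl⟩ := h
    rfl
  exact Module.Finite.of_basis (h.pieceBasis s)

/-- The index of the basis vector that is a given generator. -/
def genIndex : Fin (5 + 8) → Σ _ : Fin 8 ⊕ Bool, Fin 5 →₀ ℕ :=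
  Fin.addCases (fun i => ⟨Sum.inr false, Finsupp.single i 1⟩) fun k => ⟨Sum.inl k, 0⟩

lemma weight_genIndex (i : Fin (5 + 8)) :
    Finsupp.weight degY (genIndex i).2 + basisDeg (genIndex i).1 = genDeg i := by
  refine Fin.addCases (fun i => ?_) (fun i => ?_) i
  · simp [genIndex, genDeg, basisDeg, Finsupp.weight_single]
  · simp [genIndex, genDeg, basisDeg]

/-- Generators have degree at most `6`, while a product of two of the `v` has degree at least `8`.
So each monomial of the degree of a generator involves at most one `v` and is itself a vector of the
monomial basis. -/
lemma repr_genIndex (h : IsFreeTable 𝒮 y v) (i : Fin (5 + 8)) (m : Fin (5 + 8) →₀ ℕ) :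
    h.monomialBasis.repr (aeval (genFamily y v) (monomial m (1 : K))) (genIndex i) =
      if m = Finsupp.single i 1 then 1 else 0 := by
  by_cases hw : Finsupp.weight genDeg m = genDeg i
  · have hle : genDeg i ≤ 6 := by
      clear hw
      revert i
      decide
    obtain ⟨n, q, rfl⟩ := exists_glue_eq m
    rw [weight_glue] at hw
    rw [aeval_genFamily_monomial]
    rcases eq_zero_or_single_of_weight_lt (q := q) (by omega) with rfl | ⟨k, rfl⟩
    · have h1 : aeval y (monomial n (1 : K)) * aeval v (monomial 0 (1 : K)) =
          h.monomialBasis ⟨Sum.inr false, n⟩ := by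
        rw [monomialBasis_apply]
        simp [tableBasis]
      rw [h1, Module.Basis.repr_self, Finsupp.single_apply]
      refine if_congr ?_ rfl rfl
      refine Fin.addCases (fun i => ?_) (fun k => ?_) i
      · rw [← glue_single_left, glue_inj]
        simp [genIndex]
      · rw [← glue_single_right, glue_inj]
        simp [genIndex, eq_comm]
    · have h1 : aeval y (monomial n (1 : K)) * aeval v (monomial (Finsupp.single k 1) (1 : K)) =
          h.monomialBasis ⟨Sum.inl k, n⟩ := by
        rw [monomialBasis_apply]
        congr 1
        exact aeval_X v k
      rw [h1, Module.Basis.repr_self, Finsupp.single_apply]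
      refine if_congr ?_ rfl rfl
      refine Fin.addCases (fun i => ?_) (fun l => ?_) i
      · rw [← glue_single_left, glue_inj]
        simp [genIndex]
      · rw [← glue_single_right, glue_inj]
        simp [genIndex, Finsupp.single_left_inj, and_comm]
  · rw [if_neg (by rintro rfl; simp [Finsupp.weight_single] at hw)]
    refine (h.mem_iff_repr _ _).1 (h.connected.aeval_mem h.genFamily_mem
      (isWeightedHomogeneous_monomial genDeg m (1 : K) rfl)) _ ?_
    rw [weight_genIndex]
    exact fun hcon => hw hcon.symm

lemma repr_genIndex_aeval (h : IsFreeTable 𝒮 y v) (i : Fin (5 + 8))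
    (p : MvPolynomial (Fin (5 + 8)) K) :
    h.monomialBasis.repr (aeval (genFamily y v) p) (genIndex i) =
      coeff (Finsupp.single i 1) p := by
  induction p using MvPolynomial.induction_on' with
  | monomial m r =>
    rw [show monomial m r = r • monomial m (1 : K) by simp [smul_monomial], map_smul, map_smul,
      Finsupp.smul_apply, h.repr_genIndex, coeff_smul, coeff_monomial]
  | add p q hp hq => rw [map_add, map_add, Finsupp.add_apply, hp, hq, coeff_add]

lemma coeff_single_of_mem_adjoin {n : ℕ} {i : Fin n} {p : MvPolynomial (Fin n) K}
    (hp : p ∈ Algebra.adjoin K (X '' {i}ᶜ)) : coeff (Finsupp.single i 1) p = 0 := by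
  by_contra hne
  have h1 : i ∈ p.vars := by
    rw [mem_vars_iff_mem_support]
    exact ⟨_, mem_support_iff.2 hne, by simp⟩
  exact (mem_supported.1 hp h1) rfl

/-- The thirteen generators form a minimal system of generators. -/
theorem isMinimalSystem (h : IsFreeTable 𝒮 y v) :
    IsConnectedGradedAlgebra.IsMinimalSystem 𝒮 (genFamily y v) genDeg where
  homogeneous := h.genFamily_mem
  generates := by
    rw [eq_top_iff]
    intro x _
    have hy : ∀ i, y i ∈ Algebra.adjoin K (Set.range (genFamily y v)) := fun i =>
      Algebra.subset_adjoin ⟨Fin.castAdd 8 i, Fin.append_left _ _ _⟩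
    have hv : ∀ i, v i ∈ Algebra.adjoin K (Set.range (genFamily y v)) := fun i =>
      Algebra.subset_adjoin ⟨Fin.natAdd 5 i, Fin.append_right _ _ _⟩
    rw [← h.polyComb_equiv x, polyComb_apply]
    refine sum_mem fun e _ => mul_mem ?_ ?_
    · have h1 : Algebra.adjoin K (Set.range y) ≤ Algebra.adjoin K (Set.range (genFamily y v)) :=
        Algebra.adjoin_le (by rintro _ ⟨i, rfl⟩; exact hy i)
      rw [Algebra.adjoin_range_eq_range_aeval] at h1
      exact h1 ⟨_, rfl⟩
    · rcases e with k | _ | _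
      · exact hv k
      · exact one_mem _
      · exact mul_mem (hv 2) (hv 5)
  minimal := by
    intro i hi
    have h1 : Algebra.adjoin K (genFamily y v '' {i}ᶜ) =
        (Algebra.adjoin K (X '' {i}ᶜ)).map (aeval (R := K) (genFamily y v)) := by
      rw [AlgHom.map_adjoin, Set.image_image]
      simp
    rw [h1] at hi
    obtain ⟨p, hp, h2⟩ := hi
    have h3 := h.repr_genIndex_aeval i p
    have h4 := h.repr_genIndex_aeval i (X i)
    rw [aeval_X, coeff_X_same] at h4
    rw [coeff_single_of_mem_adjoin hp] at h3
    change aeval (genFamily y v) p = _ at h2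
    rw [h2, h4] at h3
    exact one_ne_zero h3

end IsFreeTable

end Minimality

end SLInv
end

/-! ### Quotients by monomial ideals -/

noncomputable section
namespace SLInv

section MonomialIdeal

set_option linter.unusedSectionVars false

variable {K : Type*} [Field K] {m : ℕ}

/-- The ideal spanned by the monomials outside a lower set of exponents. -/
def monomialIdeal (K : Type*) [Field K] {m : ℕ} (Ω : LowerSet (Fin m →₀ ℕ)) :
    Ideal (MvPolynomial (Fin m) K) where
  carrier := {p | ∀ μ ∈ Ω, coeff μ p = 0}
  add_mem' := fun hp hq μ hμ => by rw [coeff_add, hp μ hμ, hq μ hμ, add_zero]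
  zero_mem' := fun μ _ => coeff_zero μ
  smul_mem' := fun c p hp μ hμ => by
    classical
    rw [smul_eq_mul, coeff_mul]
    refine Finset.sum_eq_zero fun x hx => ?_
    have hx' := Finset.HasAntidiagonal.mem_antidiagonal.1 hx
    rw [hp x.2 (Ω.lower (le_add_self.trans_eq hx') hμ), mul_zero]

variable (Ω : LowerSet (Fin m →₀ ℕ))

lemma mem_monomialIdeal {p : MvPolynomial (Fin m) K} :
    p ∈ monomialIdeal K Ω ↔ ∀ μ ∈ Ω, coeff μ p = 0 := Iff.rfl

lemma isHomogeneousIdeal_monomialIdeal (deg : Fin m → ℕ) :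
    IsHomogeneousIdeal deg (monomialIdeal K Ω) := by
  classical
  intro p hp s μ hμ
  rw [coeff_weightedHomogeneousComponent, hp μ hμ, ite_self]

/-- The coefficients with exponents in the lower set. -/
def lowerCoeff : MvPolynomial (Fin m) K →ₗ[K] (Ω →₀ K) :=
  (Finsupp.lsubtypeDomain (Ω : Set (Fin m →₀ ℕ))).comp (basisMonomials (Fin m) K).repr.toLinearMap

lemma lowerCoeff_surjective : Function.Surjective (lowerCoeff (K := K) Ω) := by
  intro c
  refine ⟨(basisMonomials (Fin m) K).repr.symm (c.mapDomain Subtype.val), ?_⟩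
  ext μ
  have h : lowerCoeff Ω ((basisMonomials (Fin m) K).repr.symm (c.mapDomain Subtype.val)) μ =
    (basisMonomials (Fin m) K).repr
      ((basisMonomials (Fin m) K).repr.symm (c.mapDomain Subtype.val)) μ.1 := rfl
  rw [h, LinearEquiv.apply_symm_apply, Finsupp.mapDomain_apply Subtype.val_injective]

lemma mem_monomialIdeal_iff (p : MvPolynomial (Fin m) K) :
    p ∈ monomialIdeal K Ω ↔ lowerCoeff Ω p = 0 := by
  rw [Finsupp.ext_iff]
  exact ⟨fun hp μ => hp μ.1 μ.2, fun hp μ hμ => hp ⟨μ, hμ⟩⟩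

/-- The basis of the quotient by a monomial ideal. -/
def lowerBasis : Module.Basis Ω K (MvPolynomial (Fin m) K ⧸ monomialIdeal K Ω) :=
  Module.Basis.ofRepr ((Submodule.Quotient.restrictScalarsEquiv K _).symm.trans
    ((Submodule.quotEquivOfEq _ _ (SetLike.ext fun x => mem_monomialIdeal_iff Ω x)).trans
      ((lowerCoeff Ω).quotKerEquivOfSurjective (lowerCoeff_surjective Ω))))

lemma lowerBasis_repr (p : MvPolynomial (Fin m) K) (μ : Ω) :
    (lowerBasis Ω).repr (Ideal.Quotient.mk _ p) μ = coeff μ.1 p := rfl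

variable (deg : Fin m → ℕ)

lemma mem_quotientPiece_iff (s : ℕ) (x : MvPolynomial (Fin m) K ⧸ monomialIdeal K Ω) :
    x ∈ quotientPiece deg (monomialIdeal K Ω) s ↔
      ∀ μ : Ω, ¬ Finsupp.weight deg μ.1 = s → (lowerBasis Ω).repr x μ = 0 := by
  classical
  constructor
  · rintro ⟨p, hp, rfl⟩ μ hμ
    change (lowerBasis Ω).repr (Ideal.Quotient.mk _ p) μ = 0
    rw [lowerBasis_repr]
    by_contra hne
    exact hμ (hp hne)
  · intro hx
    obtain ⟨p, rfl⟩ := Ideal.Quotient.mk_surjective x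
    refine ⟨weightedHomogeneousComponent deg s p, weightedHomogeneousComponent_mem deg p s, ?_⟩
    apply (lowerBasis Ω).repr.injective
    ext μ
    change (lowerBasis Ω).repr (Ideal.Quotient.mk _ _) μ = _
    rw [lowerBasis_repr, lowerBasis_repr, coeff_weightedHomogeneousComponent]
    split_ifs with h
    · rfl
    · exact (hx μ h).symm

/-- The basis of a graded piece of the quotient by a monomial ideal. -/
def quotientPieceBasis (s : ℕ) : Module.Basis {μ : Ω // Finsupp.weight deg μ.1 = s} K
    (quotientPiece deg (monomialIdeal K Ω) s) :=
  supportedBasis (lowerBasis Ω) _ _ (mem_quotientPiece_iff Ω deg s)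

lemma exists_resolution_monomialIdeal [CharZero K] (hdeg : ∀ i, 0 < deg i) :
    ∃ β, Nonempty (MinimalGradedFreeResolution deg (MvPolynomial (Fin m) K ⧸ monomialIdeal K Ω)
      (quotientPiece deg (monomialIdeal K Ω)) β) := by
  refine exists_minimalGradedFreeResolution hdeg
    (isGrading_of_repr (lowerBasis Ω) (fun μ => Finsupp.weight deg μ.1)
      (mem_quotientPiece_iff Ω deg)) ?_ fun s => ?_
  · rintro k s _ ⟨p, hp, rfl⟩
    refine ⟨X k * p, ?_, rfl⟩
    have h1 := (isWeightedHomogeneous_X K deg k).mul hp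
    rwa [add_comm] at h1
  · have h1 : {μ : Fin m →₀ ℕ | Finsupp.weight deg μ ≤ s}.Finite :=
      Finsupp.finite_of_nat_weight_le deg (fun i => (hdeg i).ne') s
    have : Finite {μ : Fin m →₀ ℕ // Finsupp.weight deg μ ≤ s} := h1
    have : Finite {μ : Ω // Finsupp.weight deg μ.1 = s} :=
      Finite.of_injective (β := {μ : Fin m →₀ ℕ // Finsupp.weight deg μ ≤ s})
        (fun μ => ⟨μ.1.1, μ.2.le⟩) fun μ ν h => Subtype.ext (Subtype.ext (Subtype.mk.inj h))
    exact Module.Finite.of_basis (quotientPieceBasis Ω deg s)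

lemma bettiTable_zero_eq_zero {j : ℕ} (hj : j ≠ 0) : bettiTable 0 j = 0 := by
  by_cases h : 50 < j
  · exact bettiTable_eq_zero (Or.inr h)
  · push Not at h
    interval_cases j <;> first | rfl | exact absurd rfl hj

lemma le_of_bettiTable_one_ne_zero {j : ℕ} (hj : bettiTable 1 j ≠ 0) : j ≤ 12 := by
  by_contra! h
  by_cases h' : 50 < j
  · exact hj (bettiTable_eq_zero (Or.inr h'))
  · push Not at h'
    interval_cases j <;> exact hj rfl

/-- A minimal exponent outside the lower set has the weight of a generator of the ideal. -/
lemma not_nonempty_resolution (hdeg : ∀ i, 0 < deg i) {μ : Fin m →₀ ℕ}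
    (hμ : μ ∉ Ω) (hμ' : ∀ ν, ν ≤ μ → ν ≠ μ → ν ∈ Ω) (hw : 12 < Finsupp.weight deg μ) :
    ¬ Nonempty (MinimalGradedFreeResolution deg (MvPolynomial (Fin m) K ⧸ monomialIdeal K Ω)
      (quotientPiece deg (monomialIdeal K Ω)) bettiTable) := by
  classical
  rintro ⟨r⟩
  let b₀ : Σ j, Fin (bettiTable 0 j) := ⟨0, ⟨0, by decide⟩⟩
  have hb : ∀ b : Σ j, Fin (bettiTable 0 j), b = b₀ := by
    rintro ⟨j, a⟩
    by_cases hj : j = 0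
    · subst hj
      exact congrArg (Sigma.mk 0) (Fin.ext (Nat.lt_one_iff.1 a.2))
    · exact absurd (a.2.trans_eq (bettiTable_zero_eq_zero hj)) (Nat.not_lt_zero _)
  have h0 : (0 : Fin m →₀ ℕ) ∈ Ω := hμ' 0 zero_le (by rintro rfl; simp at hw)
  obtain ⟨p, hp, hpε⟩ := r.ε_graded b₀
  have hpC : p = C (coeff 0 p) := by
    ext ν
    rw [coeff_C]
    split_ifs with hν
    · rw [hν]
    · by_contra hne
      have h1 : Finsupp.weight deg ν = 0 := hp hne
      refine hν ?_
      ext i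
      have h2 := Finsupp.le_weight deg (hdeg i).ne' ν
      rw [h1] at h2
      exact (Nat.le_zero.1 h2).symm
  have hε : ∀ c, r.ε c = Ideal.Quotient.mk _ (c b₀ * C (coeff 0 p)) := by
    intro c
    have hc : c = c b₀ • Finsupp.single b₀ 1 := by
      ext1 b
      rw [hb b]
      simp
    conv_lhs => rw [hc, map_smul, ← hpε]
    conv_rhs => rw [← hpC]
    rfl
  have hp0 : coeff 0 p ≠ 0 := by
    intro hcon
    obtain ⟨c, hc⟩ := r.surjective 1
    rw [hε, hcon, C_0, mul_zero, map_zero] at hc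
    have h1 := Ideal.Quotient.eq_zero_iff_mem.1 (hc.symm.trans rfl :
      Ideal.Quotient.mk (monomialIdeal K Ω) 1 = 0)
    simpa using h1 0 h0
  have hker : ∀ c, r.ε c = 0 ↔ c b₀ ∈ monomialIdeal K Ω := by
    intro c
    rw [hε, Ideal.Quotient.eq_zero_iff_mem, mem_monomialIdeal, mem_monomialIdeal]
    refine forall₂_congr fun ν _ => ?_
    rw [mul_comm, coeff_C_mul, mul_eq_zero, or_iff_right hp0]
  have h1 : r.ε (Finsupp.single b₀ (monomial μ 1)) = 0 := by
    rw [hker, mem_monomialIdeal]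
    intro ν hν
    rw [Finsupp.single_eq_same, coeff_monomial, if_neg]
    rintro rfl
    exact hμ hν
  -- The monomial with exponent `μ` is a combination of the columns of `d 0`. Some column then
  -- contains a monomial dividing it, of weight at most `12`.
  obtain ⟨z, hz⟩ := (r.exact_zero _).1 h1
  have hz' : r.d 0 z = z.sum fun b c => c • r.d 0 (Finsupp.single b 1) := by
    conv_lhs => rw [← Finsupp.sum_single z]
    rw [Finsupp.sum, map_sum]
    refine Finset.sum_congr rfl fun b _ => ?_
    change _ = z b • r.d 0 (Finsupp.single b 1)
    rw [← map_smul, Finsupp.smul_single, smul_eq_mul, mul_one]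
  have h2 := congrArg (coeff μ) (DFunLike.congr_fun (hz'.symm.trans hz) b₀)
  rw [Finsupp.single_eq_same, coeff_monomial, if_pos rfl, Finsupp.sum, Finsupp.finsetSum_apply,
    coeff_sum] at h2
  obtain ⟨b, -, hb1⟩ := Finset.exists_ne_zero_of_sum_ne_zero (h2.trans_ne one_ne_zero)
  rw [Finsupp.smul_apply, smul_eq_mul, coeff_mul] at hb1
  obtain ⟨x, hx, hx1⟩ := Finset.exists_ne_zero_of_sum_ne_zero hb1
  have hx2 := right_ne_zero_of_mul hx1
  have hx3 := r.d_graded 0 b b₀ x.2 (mem_support_iff.2 hx2)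
  have hx4 : b.1 ≤ 12 := le_of_bettiTable_one_ne_zero fun h => by
    have := b.2.2
    simp only [zero_add, h] at this
    omega
  -- By its weight the divisor is proper, so it is standard. But the columns of `d 0` lie in the
  -- ideal, which contains no standard monomial.
  have hx5 : x.2 ∈ Ω := by
    refine hμ' _ (le_add_self.trans_eq (Finset.HasAntidiagonal.mem_antidiagonal.1 hx)) ?_
    rintro hcon
    rw [hcon] at hx3
    change Finsupp.weight deg μ + 0 = b.1 at hx3
    omega
  exact hx2 ((hker _).1 ((r.exact_zero _).2 ⟨_, rfl⟩) _ hx5)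

end MonomialIdeal

/-! ### A lower set of exponents with the right weights -/

section StandardExponents

/-- The standard exponents. -/
def IsStandard (n : Fin 5 →₀ ℕ) (q : Fin 8 →₀ ℕ) : Prop :=
  q = 0 ∨ (∃ k, q = Finsupp.single k 1 ∧ (k = 1 → n 1 = 0)) ∨ q = Finsupp.single 0 2 ∨
    q = Finsupp.single 0 1 + Finsupp.single 4 1

lemma eq_of_le_single_add_single {q : Fin 8 →₀ ℕ} {a b : ℕ}
    (hq : q ≤ Finsupp.single 0 a + Finsupp.single 4 b) :
    ∃ i j, i ≤ a ∧ j ≤ b ∧ q = Finsupp.single 0 i + Finsupp.single 4 j := by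
  refine ⟨q 0, q 4, by simpa using hq 0, by simpa using hq 4, ?_⟩
  ext k
  have := hq k
  fin_cases k <;> simp_all

lemma isStandard_single_add_single {i j : ℕ} (hi : i ≤ 2) (hj : j ≤ 1) (hij : i + j ≤ 2)
    (n : Fin 5 →₀ ℕ) :
    IsStandard n (Finsupp.single 0 i + Finsupp.single 4 j) := by
  interval_cases j
  · rw [Finsupp.single_zero, add_zero]
    interval_cases i
    · exact Or.inl (Finsupp.single_zero _)
    · exact Or.inr (Or.inl ⟨0, rfl, fun h => absurd h (by decide)⟩)
    · exact Or.inr (Or.inr (Or.inl rfl))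
  · interval_cases i
    · rw [Finsupp.single_zero, zero_add]
      exact Or.inr (Or.inl ⟨4, rfl, fun h => absurd h (by decide)⟩)
    · exact Or.inr (Or.inr (Or.inr rfl))
    · omega

lemma IsStandard.mono {n n' : Fin 5 →₀ ℕ} {q q' : Fin 8 →₀ ℕ} (h : IsStandard n q) (hn : n' ≤ n)
    (hq : q' ≤ q) : IsStandard n' q' := by
  rcases h with rfl | ⟨k, rfl, hk⟩ | rfl | rfl
  · exact Or.inl (le_antisymm hq zero_le)
  · by_cases h0 : q' k = 0
    · refine Or.inl ?_
      ext l
      have := hq l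
      by_cases hl : l = k
      · rw [hl, h0]; rfl
      · simpa [Finsupp.single_eq_of_ne hl] using this
    · refine Or.inr (Or.inl ⟨k, le_antisymm hq ?_, fun h => ?_⟩)
      · rw [Finsupp.single_le_iff]; omega
      · have := hn 1
        have := hk h
        omega
  · rw [← add_zero (Finsupp.single 0 2), ← Finsupp.single_zero 4] at hq
    obtain ⟨i, j, hi, hj, rfl⟩ := eq_of_le_single_add_single hq
    exact isStandard_single_add_single hi (by omega) (by omega) n'
  · obtain ⟨i, j, hi, hj, rfl⟩ := eq_of_le_single_add_single hq
    exact isStandard_single_add_single (by omega) hj (by omega) n'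

lemma glue_le_glue {n n' : Fin 5 →₀ ℕ} {q q' : Fin 8 →₀ ℕ} (h : glue n q ≤ glue n' q') :
    n ≤ n' ∧ q ≤ q' :=
  ⟨fun i => by simpa using h (Fin.castAdd 8 i), fun k => by simpa using h (Fin.natAdd 5 k)⟩

/-- The lower set of the standard exponents. -/
def standardSet : LowerSet (Fin (5 + 8) →₀ ℕ) where
  carrier := {μ | ∃ n q, glue n q = μ ∧ IsStandard n q}
  lower' := by
    rintro _ ν hν ⟨n, q, rfl, h⟩
    obtain ⟨n', q', rfl⟩ := exists_glue_eq ν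
    obtain ⟨h1, h2⟩ := glue_le_glue hν
    exact ⟨n', q', rfl, h.mono h1 h2⟩

lemma glue_mem_standardSet {n : Fin 5 →₀ ℕ} {q : Fin 8 →₀ ℕ} :
    glue n q ∈ standardSet ↔ IsStandard n q := by
  constructor
  · rintro ⟨n', q', h, h'⟩
    obtain ⟨rfl, rfl⟩ := glue_inj.1 h
    exact h'
  · exact fun h => ⟨n, q, rfl, h⟩

open Classical in
/-- The standard exponent that corresponds to an element of the basis of an algebra with a free
multiplication table. -/
def standardExponent : (Σ _ : Fin 8 ⊕ Bool, Fin 5 →₀ ℕ) → (Fin 5 →₀ ℕ) × (Fin 8 →₀ ℕ)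
  | ⟨Sum.inr false, n⟩ => (n, 0)
  | ⟨Sum.inr true, n⟩ => (n, Finsupp.single 0 1 + Finsupp.single 4 1)
  | ⟨Sum.inl k, n⟩ => if k = 1 ∧ n 1 ≠ 0 then (n - Finsupp.single 1 1, Finsupp.single 0 2)
      else (n, Finsupp.single k 1)

lemma single_add_single_ne_single (k : Fin 8) (a : ℕ) :
    (Finsupp.single 0 1 + Finsupp.single 4 1 : Fin 8 →₀ ℕ) ≠ Finsupp.single k a := by
  intro h
  have h0 := DFunLike.congr_fun h 0
  have h4 := DFunLike.congr_fun h 4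
  by_cases hk : k = 0
  · subst hk; simp at h4
  · rw [Finsupp.single_eq_of_ne (Ne.symm hk)] at h0
    simp at h0

lemma isStandard_standardExponent (x : Σ _ : Fin 8 ⊕ Bool, Fin 5 →₀ ℕ) :
    IsStandard (standardExponent x).1 (standardExponent x).2 := by
  obtain ⟨k | _ | _, n⟩ := x
  · rw [standardExponent]
    split_ifs with h
    · exact Or.inr (Or.inr (Or.inl rfl))
    · exact Or.inr (Or.inl ⟨k, rfl, fun hk => by tauto⟩)
  · exact Or.inl rfl
  · exact Or.inr (Or.inr (Or.inr rfl))

lemma standardExponent_injective : Function.Injective standardExponent := by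
  have h1 : ∀ {n : Fin 5 →₀ ℕ}, n 1 ≠ 0 → Finsupp.single 1 1 ≤ n := fun h =>
    Finsupp.single_le_iff.2 (Nat.one_le_iff_ne_zero.2 h)
  rintro ⟨k | _ | _, n⟩ ⟨k' | _ | _, n'⟩ h <;> simp only [standardExponent] at h
  · split_ifs at h with hk hk' hk'
    · obtain ⟨rfl, hn⟩ := hk
      obtain ⟨rfl, hn'⟩ := hk'
      rw [Prod.mk.injEq, tsub_left_inj (h1 hn) (h1 hn')] at h
      rw [h.1]
    · simp [Finsupp.single_eq_single_iff] at h
    · simp [Finsupp.single_eq_single_iff] at h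
    · simp only [Prod.mk.injEq, Finsupp.single_left_inj one_ne_zero] at h
      rw [h.1, h.2]
  · split_ifs at h <;> simp at h
  · split_ifs at h <;> exact absurd (congrArg Prod.snd h).symm (single_add_single_ne_single _ _)
  · split_ifs at h <;> simp [eq_comm (a := (0 : Fin 8 →₀ ℕ))] at h
  · simp at h
    rw [h]
  · have := DFunLike.congr_fun (congrArg Prod.snd h) 0
    simp at this
  · split_ifs at h <;> exact absurd (congrArg Prod.snd h) (single_add_single_ne_single _ _)
  · have := DFunLike.congr_fun (congrArg Prod.snd h) 0
    simp at this
  · simp at h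
    rw [h]

lemma exists_standardExponent_eq {n : Fin 5 →₀ ℕ} {q : Fin 8 →₀ ℕ} (h : IsStandard n q) :
    ∃ x, standardExponent x = (n, q) := by
  rcases h with rfl | ⟨k, rfl, hk⟩ | rfl | rfl
  · exact ⟨⟨Sum.inr false, n⟩, rfl⟩
  · exact ⟨⟨Sum.inl k, n⟩, by rw [standardExponent, if_neg (by tauto)]⟩
  · refine ⟨⟨Sum.inl 1, n + Finsupp.single 1 1⟩, ?_⟩
    rw [standardExponent, if_pos ⟨rfl, by simp⟩, add_tsub_cancel_right]
  · exact ⟨⟨Sum.inr true, n⟩, rfl⟩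

/-- `y_1`, `v_0` and `v_1` all have degree `4`, so trading `y_1 v_1` for `v_0²` keeps the weight, as
does replacing `v_2 v_5` by `v_0 v_4` in degree `10`. -/
lemma weight_standardExponent (x : Σ _ : Fin 8 ⊕ Bool, Fin 5 →₀ ℕ) :
    Finsupp.weight genDeg (glue (standardExponent x).1 (standardExponent x).2) =
      Finsupp.weight degY x.2 + basisDeg x.1 := by
  rw [weight_glue]
  obtain ⟨k | _ | _, n⟩ := x
  · rw [standardExponent]
    split_ifs with h
    · obtain ⟨rfl, hn⟩ := h
      have h1 : n = (n - Finsupp.single 1 1) + Finsupp.single 1 1 :=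
        (tsub_add_cancel_of_le (Finsupp.single_le_iff.2 (Nat.one_le_iff_ne_zero.2 hn))).symm
      conv_rhs => rw [h1]
      simp only [map_add, Finsupp.weight_single, add_assoc]
      rfl
    · simp only [Finsupp.weight_single, one_smul]
      rfl
  · simp [standardExponent, basisDeg]
  · simp only [standardExponent, map_add, Finsupp.weight_single]
    rfl

/-- The standard exponents index a basis of an algebra with a free multiplication table. -/
def standardEquiv : (Σ _ : Fin 8 ⊕ Bool, Fin 5 →₀ ℕ) ≃ standardSet :=
  Equiv.ofBijective (fun x => ⟨glue (standardExponent x).1 (standardExponent x).2,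
    glue_mem_standardSet.2 (isStandard_standardExponent x)⟩) <| by
    constructor
    · intro x x' h
      obtain ⟨h1, h2⟩ := glue_inj.1 (congrArg Subtype.val h)
      exact standardExponent_injective (Prod.ext h1 h2)
    · rintro ⟨_, n, q, rfl, h⟩
      obtain ⟨x, hx⟩ := exists_standardExponent_eq h
      exact ⟨x, by simp only [hx]⟩

end StandardExponents

/-! ### Equal Hilbert series, different degrees of generators -/

section HilbertSeries

set_option linter.unusedSectionVars false

variable {K : Type*} [Field K] [CharZero K]

lemma IsFreeTable.hilbertSeries_eq {S : Type*} [CommRing S] [Algebra K S] {𝒮 : ℕ → Submodule K S}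
    {y : Fin 5 → S} {v : Fin 8 → S} (h : IsFreeTable 𝒮 y v) :
    hilbertSeries (quotientPiece genDeg (monomialIdeal K standardSet)) = hilbertSeries 𝒮 := by
  ext s
  rw [hilbertSeries, hilbertSeries, PowerSeries.coeff_mk, PowerSeries.coeff_mk, Nat.cast_inj,
    Module.finrank_eq_nat_card_basis (quotientPieceBasis standardSet genDeg s),
    Module.finrank_eq_nat_card_basis (h.pieceBasis s)]
  refine (Nat.card_congr (standardEquiv.subtypeEquiv fun x => ?_)).symm
  rw [← weight_standardExponent]
  rfl

/-- `v_0² v_4` is minimal among the nonstandard monomials and has weight `4 + 4 + 6 = 14`. Making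
`v_0²` standard at the expense of `y_1 v_1` serves this: otherwise `v_0²` would itself be a
generator of the ideal and divide `v_0² v_4`. -/
lemma not_nonempty_resolution_standardSet :
    ¬ Nonempty (MinimalGradedFreeResolution genDeg
      (MvPolynomial (Fin (5 + 8)) K ⧸ monomialIdeal K standardSet)
      (quotientPiece genDeg (monomialIdeal K standardSet)) bettiTable) := by
  refine not_nonempty_resolution standardSet genDeg genDeg_pos
    (μ := glue 0 (Finsupp.single 0 2 + Finsupp.single 4 1)) ?_ ?_ ?_
  · rw [glue_mem_standardSet]
    rintro (h | ⟨k, h, -⟩ | h | h)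
    · simpa using DFunLike.congr_fun h 0
    · have h0 := DFunLike.congr_fun h 0
      have := Finsupp.single_apply (a := k) (a' := 0) (b := 1)
      rw [← h0] at this
      split_ifs at this <;> simp at this
    · simpa using DFunLike.congr_fun h 4
    · simpa using DFunLike.congr_fun h 0
  · intro ν hν hne
    obtain ⟨n, q, rfl⟩ := exists_glue_eq ν
    obtain ⟨h1, h2⟩ := glue_le_glue hν
    rw [glue_mem_standardSet]
    obtain ⟨i, j, hi, hj, rfl⟩ := eq_of_le_single_add_single h2
    have hn : n = 0 := le_antisymm h1 zero_le
    refine isStandard_single_add_single hi hj ?_ n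
    by_contra! hij
    obtain rfl : i = 2 := by omega
    obtain rfl : j = 1 := by omega
    exact hne (by rw [hn])
  · rw [weight_glue]
    simp only [map_add, map_zero, Finsupp.weight_single]
    decide

end HilbertSeries

end SLInv
end

/-! ### Pulling back ideals and their resolutions -/

noncomputable section
namespace SLInv

section QuotientTransport

set_option linter.unusedSectionVars false

variable {K : Type*} [Field K] {m n : ℕ} {deg : Fin m → ℕ} {e : Fin n → ℕ}
  {Θ : MvPolynomial (Fin m) K ≃ₐ[K] MvPolynomial (Fin n) K}

lemma IsGradedEquiv.weightedHomogeneousComponent_map (h : IsGradedEquiv deg e Θ) (s : ℕ)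
    (p : MvPolynomial (Fin m) K) : weightedHomogeneousComponent e s (Θ p) =
      Θ (weightedHomogeneousComponent deg s p) := by
  induction p using MvPolynomial.induction_on' with
  | monomial μ r =>
    have h1 := isWeightedHomogeneous_monomial deg μ r rfl
    have h2 := h.map h1
    by_cases hs : Finsupp.weight deg μ = s
    · subst hs
      rw [h1.weightedHomogeneousComponent_same, h2.weightedHomogeneousComponent_same]
    · rw [h1.weightedHomogeneousComponent_ne s (Ne.symm hs),
        h2.weightedHomogeneousComponent_ne s (Ne.symm hs), map_zero]
  | add p q hp hq => simp only [map_add, hp, hq]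

lemma IsGradedEquiv.isHomogeneousIdeal_comap (h : IsGradedEquiv deg e Θ)
    {J : Ideal (MvPolynomial (Fin n) K)} (hJ : IsHomogeneousIdeal e J) :
    IsHomogeneousIdeal deg (J.comap Θ) := by
  intro p hp s
  rw [Ideal.mem_comap, ← h.weightedHomogeneousComponent_map]
  exact hJ _ hp s

variable (Θ) in
/-- The isomorphism of quotients induced by an isomorphism of polynomial rings. -/
def quotientComapEquiv (J : Ideal (MvPolynomial (Fin n) K)) :
    (MvPolynomial (Fin m) K ⧸ J.comap Θ) ≃ₐ[K] MvPolynomial (Fin n) K ⧸ J :=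
  Ideal.quotientEquivAlg _ _ Θ (Ideal.map_comap_of_surjective _ Θ.surjective J).symm

lemma quotientComapEquiv_mk (J : Ideal (MvPolynomial (Fin n) K)) (p : MvPolynomial (Fin m) K) :
    quotientComapEquiv Θ J (Ideal.Quotient.mk _ p) = Ideal.Quotient.mk _ (Θ p) := rfl

lemma quotientComapEquiv_symm_mk (J : Ideal (MvPolynomial (Fin n) K))
    (p : MvPolynomial (Fin n) K) :
    (quotientComapEquiv Θ J).symm (Ideal.Quotient.mk _ p) = Ideal.Quotient.mk _ (Θ.symm p) := by
  rw [AlgEquiv.symm_apply_eq, quotientComapEquiv_mk, AlgEquiv.apply_symm_apply]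

lemma IsGradedEquiv.map_mem_quotientPiece (h : IsGradedEquiv deg e Θ)
    (J : Ideal (MvPolynomial (Fin n) K)) (s : ℕ) :
    ∀ x ∈ quotientPiece deg (J.comap Θ) s, quotientComapEquiv Θ J x ∈ quotientPiece e J s := by
  rintro _ ⟨p, hp, rfl⟩
  exact ⟨Θ p, h.map hp, rfl⟩

lemma IsGradedEquiv.symm_map_mem_quotientPiece (h : IsGradedEquiv deg e Θ)
    (J : Ideal (MvPolynomial (Fin n) K)) (s : ℕ) :
    ∀ x ∈ quotientPiece e J s,
      (quotientComapEquiv Θ J).symm x ∈ quotientPiece deg (J.comap Θ) s := by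
  rintro _ ⟨p, hp, rfl⟩
  exact ⟨Θ.symm p, h.symm.map hp, (quotientComapEquiv_symm_mk J p).symm⟩

lemma IsGradedEquiv.hilbertSeries_comap (h : IsGradedEquiv deg e Θ)
    (J : Ideal (MvPolynomial (Fin n) K)) :
    hilbertSeries (quotientPiece deg (J.comap Θ)) = hilbertSeries (quotientPiece e J) := by
  ext s
  rw [hilbertSeries, hilbertSeries, PowerSeries.coeff_mk, PowerSeries.coeff_mk, Nat.cast_inj]
  have h1 : (quotientPiece deg (J.comap Θ) s).map
      (quotientComapEquiv Θ J).toLinearEquiv.toLinearMap = quotientPiece e J s := by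
    ext x
    constructor
    · rintro ⟨z, hz, rfl⟩
      exact h.map_mem_quotientPiece J s z hz
    · intro hx
      exact ⟨_, h.symm_map_mem_quotientPiece J s x hx, (quotientComapEquiv Θ J).apply_symm_apply x⟩
  rw [← h1]
  exact (LinearEquiv.finrank_map_eq (quotientComapEquiv Θ J).toLinearEquiv _).symm

lemma IsGradedEquiv.nonempty_resolution_comap_iff (h : IsGradedEquiv deg e Θ)
    (J : Ideal (MvPolynomial (Fin n) K)) (β : ℕ → ℕ → ℕ) :
    Nonempty (MinimalGradedFreeResolution deg (MvPolynomial (Fin m) K ⧸ J.comap Θ)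
      (quotientPiece deg (J.comap Θ)) β) ↔
    Nonempty (MinimalGradedFreeResolution e (MvPolynomial (Fin n) K ⧸ J)
      (quotientPiece e J) β) := by
  constructor
  · rintro ⟨r⟩
    refine r.transport h.symm (quotientComapEquiv Θ J).toRingEquiv.toAddEquiv ?_
      (h.map_mem_quotientPiece J)
    intro p x
    obtain ⟨x, rfl⟩ := Ideal.Quotient.mk_surjective x
    change Ideal.Quotient.mk _ (Θ (p * x)) = Ideal.Quotient.mk _ (Θ p * Θ x)
    rw [map_mul]
  · rintro ⟨r⟩
    refine r.transport h (quotientComapEquiv Θ J).symm.toRingEquiv.toAddEquiv ?_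
      (h.symm_map_mem_quotientPiece J)
    intro p x
    obtain ⟨x, rfl⟩ := Ideal.Quotient.mk_surjective x
    change (quotientComapEquiv Θ J).symm (Ideal.Quotient.mk _ (p * x)) =
      Θ.symm p • (quotientComapEquiv Θ J).symm (Ideal.Quotient.mk _ x)
    rw [quotientComapEquiv_symm_mk, quotientComapEquiv_symm_mk, map_mul]
    rfl

end QuotientTransport

/-! ### Arbitrary minimal generating systems -/

section Main

variable {K : Type*} [Field K] [CharZero K]

lemma isMinimalGeneratingSystem_genFamily :
    IsMinimalGeneratingSystem (genFamily (invY K) (invV K)) genDeg :=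
  ⟨isFreeTable_invariants.isMinimalSystem.homogeneous,
    isFreeTable_invariants.isMinimalSystem.generates,
    isFreeTable_invariants.isMinimalSystem.minimal⟩

lemma IsMinimalGeneratingSystem.exists_isGradedEquiv {m : ℕ}
    {f : Fin m → invariants K ![1, 1, 3]} {deg : Fin m → ℕ}
    (hf : IsMinimalGeneratingSystem f deg) :
    ∃ Θ : MvPolynomial (Fin m) K ≃ₐ[K] MvPolynomial (Fin (5 + 8)) K,
      IsGradedEquiv deg genDeg Θ ∧
        ∀ p, aeval (genFamily (invY K) (invV K)) (Θ p) = aeval f p :=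
  isFreeTable_invariants.connected.exists_isGradedEquiv
    ⟨hf.homogeneous, hf.generates, hf.minimal⟩ isFreeTable_invariants.isMinimalSystem

/-- The minimal graded free resolution of the algebra of invariants. -/
theorem IsMinimalGeneratingSystem.resolution {m : ℕ} {f : Fin m → invariants K ![1, 1, 3]}
    {deg : Fin m → ℕ} (hf : IsMinimalGeneratingSystem f deg) :
    letI := moduleVia f
    Nonempty (MinimalGradedFreeResolution deg (invariants K ![1, 1, 3])
      (invariantsPiece K ![1, 1, 3]) bettiTable) := by
  let _ := moduleVia f
  let _ := IsFreeTable.genModule K (genFamily (invY K) (invV K))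
  obtain ⟨Θ, hΘ, hΘ'⟩ := hf.exists_isGradedEquiv
  obtain ⟨r⟩ := isFreeTable_invariants.resolution
    (isFreeTable_invariants (K := K)).finiteDimensional
  refine r.transport hΘ (AddEquiv.refl _) (fun p x => ?_) fun s x hx => hx
  change aeval (genFamily (invY K) (invV K)) p * x = aeval f (Θ.symm p) * x
  rw [← hΘ', AlgEquiv.apply_symm_apply]

end Main

end SLInv
end

theorem mainTheorem1 (K : Type*) [Field K] [CharZero K] :
    (∃ (m : ℕ) (f : Fin m → SLInv.invariants K ![1, 1, 3]) (deg : Fin m → ℕ),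
      SLInv.IsMinimalGeneratingSystem f deg) ∧
    ∀ (m : ℕ) (f : Fin m → SLInv.invariants K ![1, 1, 3]) (deg : Fin m → ℕ),
      SLInv.IsMinimalGeneratingSystem f deg →
      letI : Module (MvPolynomial (Fin m) K) (SLInv.invariants K ![1, 1, 3]) := SLInv.moduleVia f
      -- the homological dimension is 8
      CategoryTheory.projectiveDimension
        (ModuleCat.of (MvPolynomial (Fin m) K) (SLInv.invariants K ![1, 1, 3])) = 8 ∧
      -- the minimal graded free resolution and the Betti diagram
      Nonempty (SLInv.MinimalGradedFreeResolution deg (SLInv.invariants K ![1, 1, 3])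
        (SLInv.invariantsPiece K ![1, 1, 3]) SLInv.bettiTable) ∧
      -- the Hilbert series does not determine the Betti numbers
      ∃ (J : Ideal (MvPolynomial (Fin m) K)) (β : ℕ → ℕ → ℕ),
        SLInv.IsHomogeneousIdeal deg J ∧
        SLInv.hilbertSeries (SLInv.quotientPiece deg J) =
          SLInv.hilbertSeries (SLInv.invariantsPiece K ![1, 1, 3]) ∧
        Nonempty (SLInv.MinimalGradedFreeResolution deg (MvPolynomial (Fin m) K ⧸ J)
          (SLInv.quotientPiece deg J) β) ∧
        ¬ Nonempty (SLInv.MinimalGradedFreeResolution deg (MvPolynomial (Fin m) K ⧸ J)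
          (SLInv.quotientPiece deg J) SLInv.bettiTable) := by
  refine ⟨⟨_, _, _, SLInv.isMinimalGeneratingSystem_genFamily⟩, fun m f deg hf => ?_⟩
  obtain ⟨Θ, hΘ, -⟩ := hf.exists_isGradedEquiv
  obtain ⟨β, hβ⟩ := SLInv.exists_resolution_monomialIdeal (K := K) SLInv.standardSet SLInv.genDeg
    SLInv.genDeg_pos
  -- The monomial ideal lives in the variables of the thirteen explicit generators. `Θ` pulls it
  -- back to the variables of the given system.
  refine ⟨?_, hf.resolution, (SLInv.monomialIdeal K SLInv.standardSet).comap Θ, β,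
    hΘ.isHomogeneousIdeal_comap (SLInv.isHomogeneousIdeal_monomialIdeal _ _),
    (hΘ.hilbertSeries_comap _).trans SLInv.isFreeTable_invariants.hilbertSeries_eq,
    (hΘ.nonempty_resolution_comap_iff _ β).2 hβ,
    fun h => SLInv.not_nonempty_resolution_standardSet
      ((hΘ.nonempty_resolution_comap_iff _ _).1 h)⟩
  let _ : Module (MvPolynomial (Fin m) K) (SLInv.invariants K ![1, 1, 3]) := SLInv.moduleVia f
  obtain ⟨r⟩ := hf.resolution
  -- The length is `6 + 2`, and `50` is the degree of the generator of `F_8`.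
  exact r.projectiveDimension_eq 6 50 (fun j => SLInv.bettiTable_eq_zero (Or.inl (by norm_num)))
    (by decide)
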